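/- **Setting.** Let $d\ge 1$, $\ell\ge 1$, let $(\ell+1)\mid N$ with $N \ge 1$, and let $V=[0,N-1]^d$ be the $d$-dimensional toroidal grid (coordinates modulo $N$, nearest-neighbour adjacency), so $|V|=N^d$. Let $S$ be a finite totally ordered set of spins, $\Omega\subseteq S^V$ a set of configurations, ordered coordinatewise, and $\pi$ a probability distribution on $\Omega$ that is positive on $\Omega$. For $B\subseteq V$ and $\sigma\in\Omega$ let $\sigma_B^\bullet$ be the set of $\omega\in\Omega$ that agree with $\sigma$ off $B$, and let the block update $U_B\sigma$ be $\pi$ conditioned on $\sigma_B^\bullet$. Assume: * (Markov random field) for every $B\subseteq V$ and $\sigma\in\Omega$, the law of the spins in $B$ under $U_B\sigma$ depends only on the restriction of $\sigma$ to the exterior boundary of $B$; * (monotone) whenever $\sigma\le\tau$ in $\Omega$ and $v\in V$, the law of the spin at $v$ under $U_{\{v\}}\sigma$ is stochastically dominated by the law of the spin at $v$ under $U_{\{v\}}\tau$. Let $H$ be the Hamming distance and, for distributions $\mu,\nu$ on $\Omega$, let $\rho(\mu,\nu)$ (Kantorovich distance) be the minimum of $\mathbf E H(X,Y)$ over all couplings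 $(X,Y)$ of $\mu$ and $\nu$. For $v\in V$ let $B_v=\{v+a: a\in\{0,\dots,\ell-1\}^d\}$ be the cube of side $\ell$ anchored at $v$. Assume further, for some $\gamma>0$ and $T\in\mathbb N$: * (contracting block dynamics) for all $\sigma,\tau\in\Omega$, $\ \frac1{|V|}\sum_{v\in V}\rho(U_{B_v}\sigma,U_{B_v}\tau)\le\Big(1-\gamma\frac{\ell^d}{|V|}\Big)H(\sigma,\tau)$; * (blocks mix in bounded time) for every $v\in V$ and $\sigma\in\Omega$, the single-site Glauber dynamics inside $B_v$ with the spins off $B_v$ frozen as in $\sigma$ (each step applies $U_{\{u\}}$ at a uniformly random $u\in B_v$) has mixing time at most $T$: after some number $t \le T$ of steps its law is within total variation distance $1/4$ of $U_{B_v}\sigma$, from every initial configuration in $\sigma_{B_v}^\bullet$. **Theorem 1.2.** There is a constant $C>0$ depending only on $\gamma$, $\ell$ and the bound $T$ on the block mixing times (in particular not on $d$, $N$, $S$, $\Omega$, $\pi$) such that the single-site Glauber dynamics on $V$ (each step applies $U_{\{v\}}$ at a uniformly random $v\in V$) satisfies, for every $0<\varepsilon<1$: 1. started from the top or the bottom configuration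 of $\Omega$, its law is within total variation distance $\varepsilon$ of $\pi$ after at most $C\,|V|\,\big(\log|V|+\log\frac1\varepsilon\big)$ steps; 2. its mixing time $\tau(\varepsilon)$, i.e. the least $t$ such that the law after $t$ steps is within total variation distance $\varepsilon$ of $\pi$ from every initial configuration in $\Omega$, satisfies $\tau(\varepsilon)\le C\,|V|\,\big(\log|V|+\log|S|+\log\frac1\varepsilon\big)$. In particular, for a fixed spin set $S$ and a fixed $\varepsilon$, single-site dynamics on $V$ has mixing time $O(|V|\log|V|)$. -/

import Mathlib

/-! ### Distances between distributions on a finite set -/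

/-- Total variation distance of two distributions on a finite set. -/
noncomputable def tvDist {X : Type*} [Fintype X] (μ ν : X → ℝ) : ℝ :=
  (1 / 2) * ∑ x, |μ x - ν x|

/-- `c` is a coupling of the distributions `μ` and `ν`: a nonnegative joint distribution
with marginals `μ` and `ν`. -/
structure IsCoupling {X : Type*} [Fintype X] (μ ν : X → ℝ) (c : X → X → ℝ) : Prop where
  nonneg : ∀ x y, 0 ≤ c x y
  left : ∀ x, ∑ y, c x y = μ x
  right : ∀ y, ∑ x, c x y = ν y

/-- Kantorovich distance of two distributions on configurations: the least expected Hamming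
distance over all couplings. -/
noncomputable def kantorovich {V S : Type*} [Fintype V] [DecidableEq V] [Fintype S]
    [DecidableEq S] (μ ν : (V → S) → ℝ) : ℝ :=
  sInf {r : ℝ | ∃ c : (V → S) → (V → S) → ℝ, IsCoupling μ ν c ∧
    r = ∑ σ, ∑ τ, c σ τ * (hammingDist σ τ : ℝ)}

/-- The mixing time, at level `ε`, of the chain with transition matrix `P`, towards `μ`, over
the initial states in `A`: the least `t` such that `P ^ t` started anywhere in `A` is within
total variation distance `ε` of `μ` (and `⊤` if there is no such `t`). -/
noncomputable def mixingTime {X : Type*} [Fintype X] [DecidableEq X]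
    (P : Matrix X X ℝ) (A : Set X) (μ : X → ℝ) (ε : ℝ) : ℕ∞ :=
  ⨅ (t : ℕ) (_ : ∀ ω ∈ A, tvDist ((P ^ t) ω) μ ≤ ε), (t : ℕ∞)

/-! ### Spin systems -/

/-- A system `⟨Ω, S, V, π⟩`: a set `Ω` of configurations in `S ^ V` and a distribution `π` on
`Ω` that is positive on `Ω`; `π` is extended by zero to all of `S ^ V`. -/
structure SpinSystem (V S : Type*) [Fintype V] [DecidableEq V] [Fintype S] where
  Ω : Set (V → S)
  π : (V → S) → ℝ
  pos : ∀ σ ∈ Ω, 0 < π σ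
  zero : ∀ σ, σ ∉ Ω → π σ = 0
  sum_eq_one : ∑ σ, π σ = 1

namespace SpinSystem

/-- The system is monotone: for `σ ≤ τ` in `Ω` and every site `v`, the conditional distribution
of the spin at `v` given `σ` off `v` is stochastically dominated by the one given `τ` off `v`. -/
def IsMonotone {V S : Type*} [Fintype V] [DecidableEq V] [Fintype S] [LinearOrder S]
    (Λ : SpinSystem V S) : Prop :=
  ∀ σ ∈ Λ.Ω, ∀ τ ∈ Λ.Ω, σ ≤ τ → ∀ v : V, ∀ g : S → ℝ, Monotone g →
    ∑ s, g s * (Λ.π (Function.update σ v s) / ∑ r, Λ.π (Function.update σ v r)) ≤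
      ∑ s, g s * (Λ.π (Function.update τ v s) / ∑ r, Λ.π (Function.update τ v r))

variable {V S : Type*} [Fintype V] [DecidableEq V] [Fintype S] [DecidableEq S]

/-- `σ_B^•` : the configurations in `Ω` that agree with `σ` off `B`. -/
def agree (Λ : SpinSystem V S) (B : Finset V) (σ : V → S) : Set (V → S) :=
  {ω | ω ∈ Λ.Ω ∧ ∀ v, v ∉ B → ω v = σ v}

/-- The block update `U_B σ`: the distribution `π` conditioned on agreeing with `σ` off `B`. -/
noncomputable def blockUpdate (Λ : SpinSystem V S) (B : Finset V) (σ ω : V → S) : ℝ :=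
  if ∀ v, v ∉ B → ω v = σ v then
    Λ.π ω / ∑ τ with ∀ v, v ∉ B → τ v = σ v, Λ.π τ
  else 0

/-- The system is a Markov random field on the graph `G`: for every set `B` of sites, the law
under `U_B σ` of the spins in `B` depends only on the restriction of `σ` to the exterior
boundary of `B`. -/
def IsMarkovRandomField (Λ : SpinSystem V S) (G : SimpleGraph V) : Prop :=
  ∀ B : Finset V, ∀ σ ∈ Λ.Ω, ∀ τ ∈ Λ.Ω,
    (∀ u, u ∉ B → (∃ v ∈ B, G.Adj v u) → σ u = τ u) →
    ∀ η : V → S, Λ.blockUpdate B σ (B.piecewise η σ) = Λ.blockUpdate B τ (B.piecewise η τ)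

/-- The block dynamics determined by the family of blocks `B i`, each with `b` sites, contracts
with parameter `γ`: for any two configurations, if a uniformly random block is updated in both
(with the best coupling of the two updates), the expected number of discrepancies shrinks by a
factor of `1 - γ b / |V|` or less. -/
def IsContracting (Λ : SpinSystem V S) {ι : Type*} [Fintype ι] (B : ι → Finset V) (b : ℕ)
    (γ : ℝ) : Prop :=
  ∀ σ ∈ Λ.Ω, ∀ τ ∈ Λ.Ω,
    (1 / (Fintype.card ι : ℝ)) *
        ∑ i, kantorovich (Λ.blockUpdate (B i) σ) (Λ.blockUpdate (B i) τ) ≤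
      (1 - γ * b / (Fintype.card V : ℝ)) * (hammingDist σ τ : ℝ)

/-- One step of single-site Glauber dynamics on the set `A` of sites: a uniformly random site
of `A` is updated, all the spins off `A` being left as they are. -/
noncomputable def glauber (Λ : SpinSystem V S) (A : Finset V) : Matrix (V → S) (V → S) ℝ :=
  Matrix.of fun σ ω => (1 / (A.card : ℝ)) * ∑ v ∈ A, Λ.blockUpdate {v} σ ω

/-- Mixing time of single-site dynamics on the whole of `V`, over all initial configurations. -/
noncomputable def glauberMixingTime (Λ : SpinSystem V S) (ε : ℝ) : ℕ∞ :=
  mixingTime (Λ.glauber Finset.univ) Λ.Ω Λ.π ε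

/-- Mixing time of single-site dynamics restricted to the block `B`, with the spins off `B`
frozen as in `σ`, over all initial configurations in `σ_B^•`; the stationary distribution
is `U_B σ`. -/
noncomputable def blockMixingTime (Λ : SpinSystem V S) (B : Finset V) (σ : V → S) (ε : ℝ) :
    ℕ∞ :=
  mixingTime (Λ.glauber B) (Λ.agree B σ) (Λ.blockUpdate B σ) ε

end SpinSystem

/-! ### The torus -/

/-- The toroidal grid `[0, N-1]^d`, with coordinates modulo `N`: two distinct sites are adjacent
if they differ by `1` modulo `N` in one coordinate and agree in all the others. -/
def torusGraph (d N : ℕ) : SimpleGraph (Fin d → ZMod N) :=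
  SimpleGraph.fromRel fun x y => ∃ i, y = x + Pi.single i 1

/-- The cube of side `ℓ` anchored at `v`: the sites `v + a` with `a ∈ {0, …, ℓ-1}^d`. -/
def torusCube {d N : ℕ} [NeZero N] (ℓ : ℕ) (v : Fin d → ZMod N) : Finset (Fin d → ZMod N) :=
  {x | ∀ i, (x i - v i).val < ℓ}

/-! Write P for single-site dynamics on V and b = ℓ^d. The contraction of the block dynamics is
carried over to P in three moves. No coupling of trajectories is built: every estimate is dual,
bounding differences of expectations of Hamming-Lipschitz functions.

Censored rounds. Cubes anchored at a translate of the sublattice of multiples of ℓ+1 are disjoint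
and not adjacent. When updates outside them are suppressed, the cubes evolve independently given how
many steps each receives (`parallel_glauber`). In K|V| steps a cube receives a binomial number with
mean bK, so its law is close to that of a block update. Hence a round acts like simultaneous block
updates, up to an error exponentially small in K for each cube that sees a discrepancy
(`censored_pow_sub_le`). One discrepancy is seen by at most (2d+1)ℓ^d cubes, so for large K the
error costs at most half of the gain γ. Averaging over the translate gives an operator R that
contracts Lipschitz functions by exp(-κ), with κ = γb/(2(ℓ+1)^d) (`translateAverage_contraction`).

Removing the censorship. A single-site update moves along a chain, so against increasing functions
it lies below the identity in the order `CensorLE`; this order survives averages and products. From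
the top or bottom configuration, total variation distance is governed by the pairing of a point mass
with the indicator of a monotone event. Therefore K|V|k steps of P are at least as close to π as the
oscillation of R^k on indicators, at most exp(-κk)|V| (`tvDist_le_of_censorLE`). For other starts,
adding the sum of the ranks of the spins makes any indicator increasing, at the cost of a factor
2|V||S| (`tvDist_le_of_extremes`); this is where log|S| comes from.

Uniformity in d. If ℓ^d > 4T, then T steps reach a given site of a block too rarely for the block to
mix unless it is frozen, and contraction then forces Ω to be a single configuration
(`subsingleton_of_card_lt`). Otherwise either ℓ = 1 and P itself contracts at a rate free of d, or ℓ
≥ 2 and d < 4T, which leaves finitely many dimensions whose constants are summed. The argument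
behind the frozen case, `mem_of_closed`, also shows that single-site moves connect Ω, and this
provides the top and bottom. -/

set_option linter.unusedSectionVars false
namespace SpinSystem

/-! ### Reversible kernels on Ω and the comparison order on them -/

section Kernels

variable {V S : Type*} [Fintype V] [DecidableEq V] [Fintype S]

/-- The bilinear form `∑ σ, π σ f σ g σ`. -/
noncomputable def pairing (Λ : SpinSystem V S) (f g : (V → S) → ℝ) : ℝ :=
  ∑ σ, Λ.π σ * (f σ * g σ)

/-- `M` restricts to a transition matrix on `Ω`. -/
structure IsKernel (Λ : SpinSystem V S) (M : Matrix (V → S) (V → S) ℝ) : Prop where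
  nonneg : ∀ σ ω, 0 ≤ M σ ω
  row_sum : ∀ σ ∈ Λ.Ω, ∑ ω, M σ ω = 1
  eq_zero : ∀ σ ∈ Λ.Ω, ∀ ω, ω ∉ Λ.Ω → M σ ω = 0

/-- `M` satisfies detailed balance with respect to `π`. -/
def IsReversible (Λ : SpinSystem V S) (M : Matrix (V → S) (V → S) ℝ) : Prop :=
  ∀ σ ω, Λ.π σ * M σ ω = Λ.π ω * M ω σ

/-- `M` maps functions increasing on `Ω` to functions increasing on `Ω`. -/
def PreservesMonotone [Preorder S] (Λ : SpinSystem V S) (M : Matrix (V → S) (V → S) ℝ) : Prop :=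
  ∀ f : (V → S) → ℝ, MonotoneOn f Λ.Ω → MonotoneOn (M.mulVec f) Λ.Ω

/-- The comparison of kernels used for censoring. -/
def CensorLE [Preorder S] (Λ : SpinSystem V S) (A B : Matrix (V → S) (V → S) ℝ) : Prop :=
  ∀ f g : (V → S) → ℝ, MonotoneOn f Λ.Ω → MonotoneOn g Λ.Ω →
    Λ.pairing f (A.mulVec g) ≤ Λ.pairing f (B.mulVec g)

variable {Λ : SpinSystem V S}

theorem pi_nonneg (Λ : SpinSystem V S) (σ : V → S) : 0 ≤ Λ.π σ := by
  by_cases h : σ ∈ Λ.Ω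
  · exact (Λ.pos σ h).le
  · exact (Λ.zero σ h).ge

theorem mem_of_pi_ne_zero (Λ : SpinSystem V S) {σ : V → S} (h : Λ.π σ ≠ 0) : σ ∈ Λ.Ω := by
  by_contra h'
  exact h (Λ.zero σ h')

theorem nonempty (Λ : SpinSystem V S) : Λ.Ω.Nonempty := by
  by_contra h
  rw [Set.not_nonempty_iff_eq_empty] at h
  have := Λ.sum_eq_one
  rw [Finset.sum_eq_zero fun σ _ => Λ.zero σ (by simp [h])] at this
  exact zero_ne_one this

theorem average_apply {ι X : Type*} (s : Finset ι) (M : ι → Matrix X X ℝ) (c : ℝ) (σ ω : X) :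
    (c • ∑ i ∈ s, M i) σ ω = c * ∑ i ∈ s, M i σ ω := by
  simp [Matrix.sum_apply]

theorem average_mulVec {ι X : Type*} [Fintype X] (s : Finset ι) (M : ι → Matrix X X ℝ) (c : ℝ)
    (f : X → ℝ) (σ : X) :
    ((c • ∑ i ∈ s, M i).mulVec f) σ = c * ∑ i ∈ s, ((M i).mulVec f) σ := by
  simp [Matrix.smul_mulVec, Matrix.sum_mulVec]

theorem pairing_average {ι : Type*} (s : Finset ι) (M : ι → Matrix (V → S) (V → S) ℝ) (c : ℝ)
    (f g : (V → S) → ℝ) :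
    Λ.pairing f ((c • ∑ i ∈ s, M i).mulVec g) = c * ∑ i ∈ s, Λ.pairing f ((M i).mulVec g) := by
  simp only [pairing, average_mulVec, Finset.mul_sum]
  rw [Finset.sum_comm]
  exact Finset.sum_congr rfl fun i _ => Finset.sum_congr rfl fun σ _ => by ring

theorem pairing_congr {f f' g g' : (V → S) → ℝ} (hf : ∀ σ ∈ Λ.Ω, f σ = f' σ)
    (hg : ∀ σ ∈ Λ.Ω, g σ = g' σ) : Λ.pairing f g = Λ.pairing f' g' := by
  refine Finset.sum_congr rfl fun σ _ => ?_
  by_cases h : σ ∈ Λ.Ω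
  · rw [hf σ h, hg σ h]
  · simp [Λ.zero σ h]

section Kernel

variable {M M' : Matrix (V → S) (V → S) ℝ}

theorem IsKernel.mulVec_mono (hM : Λ.IsKernel M) {f g : (V → S) → ℝ} {σ : V → S} (hσ : σ ∈ Λ.Ω)
    (h : ∀ ω ∈ Λ.Ω, M σ ω ≠ 0 → f ω ≤ g ω) : (M.mulVec f) σ ≤ (M.mulVec g) σ := by
  refine Finset.sum_le_sum fun ω _ => ?_
  by_cases hω : ω ∈ Λ.Ω
  · by_cases h0 : M σ ω = 0
    · simp [h0]
    · exact mul_le_mul_of_nonneg_left (h ω hω h0) (hM.nonneg σ ω)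
  · simp [hM.eq_zero σ hσ ω hω]

theorem IsKernel.mulVec_congr (hM : Λ.IsKernel M) {f g : (V → S) → ℝ} {σ : V → S} (hσ : σ ∈ Λ.Ω)
    (h : ∀ ω ∈ Λ.Ω, M σ ω ≠ 0 → f ω = g ω) : (M.mulVec f) σ = (M.mulVec g) σ :=
  le_antisymm (hM.mulVec_mono hσ fun ω h1 h2 => (h ω h1 h2).le)
    (hM.mulVec_mono hσ fun ω h1 h2 => (h ω h1 h2).ge)

theorem IsKernel.mulVec_const (hM : Λ.IsKernel M) (a : ℝ) {σ : V → S} (hσ : σ ∈ Λ.Ω) :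
    (M.mulVec fun _ => a) σ = a := by
  simp [Matrix.mulVec, dotProduct, ← Finset.sum_mul, hM.row_sum σ hσ]

theorem IsKernel.mulVec_le (hM : Λ.IsKernel M) {f : (V → S) → ℝ} {σ : V → S} (hσ : σ ∈ Λ.Ω)
    {a : ℝ} (h : ∀ ω ∈ Λ.Ω, M σ ω ≠ 0 → f ω ≤ a) : (M.mulVec f) σ ≤ a :=
  (hM.mulVec_mono (g := fun _ => a) hσ h).trans_eq (hM.mulVec_const a hσ)

theorem IsKernel.le_mulVec (hM : Λ.IsKernel M) {f : (V → S) → ℝ} {σ : V → S} (hσ : σ ∈ Λ.Ω)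
    {a : ℝ} (h : ∀ ω ∈ Λ.Ω, M σ ω ≠ 0 → a ≤ f ω) : a ≤ (M.mulVec f) σ :=
  (hM.mulVec_const a hσ).symm.trans_le (hM.mulVec_mono (f := fun _ => a) hσ h)

theorem IsKernel.one [DecidableEq S] : Λ.IsKernel 1 := by
  refine ⟨fun σ ω => ?_, fun σ _ => ?_, fun σ hσ ω hω => ?_⟩
  · rw [Matrix.one_apply]; split_ifs <;> norm_num
  · simp [Matrix.one_apply]
  · rw [Matrix.one_apply_ne]; rintro rfl; exact hω hσ

theorem IsKernel.mul (hM : Λ.IsKernel M) (hM' : Λ.IsKernel M') : Λ.IsKernel (M * M') := by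
  refine ⟨fun σ ω => ?_, fun σ hσ => ?_, fun σ hσ ω hω => ?_⟩
  · exact Finset.sum_nonneg fun τ _ => mul_nonneg (hM.nonneg _ _) (hM'.nonneg _ _)
  · simp only [Matrix.mul_apply]
    rw [Finset.sum_comm, ← hM.row_sum σ hσ]
    refine Finset.sum_congr rfl fun τ _ => ?_
    rw [← Finset.mul_sum]
    by_cases hτ : τ ∈ Λ.Ω
    · rw [hM'.row_sum τ hτ, mul_one]
    · rw [hM.eq_zero σ hσ τ hτ, zero_mul]
  · rw [Matrix.mul_apply]
    refine Finset.sum_eq_zero fun τ _ => ?_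
    by_cases hτ : τ ∈ Λ.Ω
    · rw [hM'.eq_zero τ hτ ω hω, mul_zero]
    · rw [hM.eq_zero σ hσ τ hτ, zero_mul]

theorem IsKernel.pow [DecidableEq S] (hM : Λ.IsKernel M) (k : ℕ) : Λ.IsKernel (M ^ k) := by
  induction k with
  | zero => rw [pow_zero]; exact IsKernel.one
  | succ k ih => rw [pow_succ]; exact ih.mul hM

theorem IsKernel.average {ι : Type*} {s : Finset ι} (hs : s.Nonempty)
    {M : ι → Matrix (V → S) (V → S) ℝ} (hM : ∀ i ∈ s, Λ.IsKernel (M i)) :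
    Λ.IsKernel ((1 / (s.card : ℝ)) • ∑ i ∈ s, M i) := by
  have hc : (s.card : ℝ) ≠ 0 := by simpa using hs.ne_empty
  refine ⟨fun σ ω => ?_, fun σ hσ => ?_, fun σ hσ ω hω => ?_⟩
  · rw [average_apply]
    exact mul_nonneg (by positivity) (Finset.sum_nonneg fun i hi => (hM i hi).nonneg σ ω)
  · simp only [average_apply]
    rw [← Finset.mul_sum, Finset.sum_comm, Finset.sum_congr rfl fun i hi => (hM i hi).row_sum σ hσ]
    simp [hc]
  · rw [average_apply, Finset.sum_eq_zero fun i hi => (hM i hi).eq_zero σ hσ ω hω, mul_zero]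

theorem IsReversible.one [DecidableEq S] : Λ.IsReversible 1 := by
  intro σ ω
  by_cases h : σ = ω
  · rw [h]
  · rw [Matrix.one_apply_ne h, Matrix.one_apply_ne (Ne.symm h)]; simp

theorem IsReversible.pow [DecidableEq S] (hM : Λ.IsReversible M) (k : ℕ) :
    Λ.IsReversible (M ^ k) := by
  induction k with
  | zero => rw [pow_zero]; exact IsReversible.one
  | succ k ih =>
    intro σ ω
    rw [pow_succ, ← (Commute.self_pow M k).eq]
    nth_rw 2 [(Commute.self_pow M k).eq]
    rw [Matrix.mul_apply, Matrix.mul_apply, Finset.mul_sum, Finset.mul_sum]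
    refine Finset.sum_congr rfl fun τ _ => ?_
    rw [← mul_assoc, hM σ τ, mul_right_comm, ih τ ω]
    ring

theorem IsReversible.average {ι : Type*} {s : Finset ι} {c : ℝ}
    {M : ι → Matrix (V → S) (V → S) ℝ} (hM : ∀ i ∈ s, Λ.IsReversible (M i)) :
    Λ.IsReversible (c • ∑ i ∈ s, M i) := by
  intro σ ω
  rw [average_apply, average_apply, mul_left_comm, mul_left_comm (Λ.π ω), Finset.mul_sum,
    Finset.mul_sum _ _ (Λ.π ω), Finset.sum_congr rfl fun i hi => hM i hi σ ω]

theorem IsReversible.pairing_mulVec (hM : Λ.IsReversible M) (f g : (V → S) → ℝ) :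
    Λ.pairing f (M.mulVec g) = Λ.pairing (M.mulVec f) g := by
  simp only [pairing, Matrix.mulVec, dotProduct, Finset.mul_sum, Finset.sum_mul]
  rw [Finset.sum_comm]
  refine Finset.sum_congr rfl fun ω _ => Finset.sum_congr rfl fun σ _ => ?_
  linear_combination (f σ * g ω) * hM σ ω

/-- A reversible kernel preserves `π`. -/
theorem IsReversible.sum_pi_mulVec (hM : Λ.IsReversible M) (hK : Λ.IsKernel M)
    (g : (V → S) → ℝ) : ∑ σ, Λ.π σ * (M.mulVec g) σ = ∑ σ, Λ.π σ * g σ := by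
  have h := hM.pairing_mulVec (fun _ => 1) g
  have h' := pairing_congr (Λ := Λ) (f := M.mulVec fun _ => 1) (f' := fun _ => 1) (g := g) (g' := g)
    (fun σ hσ => hK.mulVec_const 1 hσ) fun _ _ => rfl
  rw [h'] at h
  simpa [pairing] using h

section Order

variable [Preorder S]

theorem PreservesMonotone.one [DecidableEq S] : Λ.PreservesMonotone 1 := fun f hf => by
  rwa [Matrix.one_mulVec]

theorem PreservesMonotone.mul (hM : Λ.PreservesMonotone M) (hM' : Λ.PreservesMonotone M') :
    Λ.PreservesMonotone (M * M') := fun f hf => by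
  rw [← Matrix.mulVec_mulVec]; exact hM _ (hM' f hf)

theorem PreservesMonotone.pow [DecidableEq S] (hM : Λ.PreservesMonotone M) (k : ℕ) :
    Λ.PreservesMonotone (M ^ k) := by
  induction k with
  | zero => rw [pow_zero]; exact .one
  | succ k ih => rw [pow_succ]; exact ih.mul hM

theorem PreservesMonotone.average {ι : Type*} {s : Finset ι} {c : ℝ} (hc : 0 ≤ c)
    {M : ι → Matrix (V → S) (V → S) ℝ} (hM : ∀ i ∈ s, Λ.PreservesMonotone (M i)) :
    Λ.PreservesMonotone (c • ∑ i ∈ s, M i) := by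
  intro f hf σ hσ τ hτ hle
  rw [average_mulVec, average_mulVec]
  exact mul_le_mul_of_nonneg_left (Finset.sum_le_sum fun i hi => hM i hi f hf hσ hτ hle) hc

theorem CensorLE.refl (M : Matrix (V → S) (V → S) ℝ) : Λ.CensorLE M M := fun _ _ _ _ => le_rfl

theorem CensorLE.average {ι : Type*} {s : Finset ι} {c : ℝ} (hc : 0 ≤ c)
    {A B : ι → Matrix (V → S) (V → S) ℝ} (h : ∀ i ∈ s, Λ.CensorLE (A i) (B i)) :
    Λ.CensorLE (c • ∑ i ∈ s, A i) (c • ∑ i ∈ s, B i) := by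
  intro f g hf hg
  rw [pairing_average, pairing_average]
  exact mul_le_mul_of_nonneg_left (Finset.sum_le_sum fun i hi => h i hi f g hf hg) hc

/-- The factors are replaced one at a time. Reversibility puts `A` on `f`, which stays increasing,
so the inner factor can be replaced; after moving `A` back, the outer factor is compared against the
increasing function `B' g`. -/
theorem CensorLE.mul {A A' B B' : Matrix (V → S) (V → S) ℝ} (hA : Λ.IsReversible A)
    (hA' : Λ.PreservesMonotone A) (hB : Λ.PreservesMonotone B') (h : Λ.CensorLE A B)
    (h' : Λ.CensorLE A' B') : Λ.CensorLE (A * A') (B * B') := by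
  intro f g hf hg
  rw [← Matrix.mulVec_mulVec, ← Matrix.mulVec_mulVec]
  calc Λ.pairing f (A.mulVec (A'.mulVec g)) = Λ.pairing (A.mulVec f) (A'.mulVec g) :=
        hA.pairing_mulVec _ _
    _ ≤ Λ.pairing (A.mulVec f) (B'.mulVec g) := h' _ _ (hA' f hf) hg
    _ = Λ.pairing f (A.mulVec (B'.mulVec g)) := (hA.pairing_mulVec _ _).symm
    _ ≤ _ := h _ _ hf (hB g hg)

theorem CensorLE.pow [DecidableEq S] {A B : Matrix (V → S) (V → S) ℝ} (hA : Λ.IsReversible A)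
    (hA' : Λ.PreservesMonotone A) (hB : Λ.PreservesMonotone B) (h : Λ.CensorLE A B) (k : ℕ) :
    Λ.CensorLE (A ^ k) (B ^ k) := by
  induction k with
  | zero => rw [pow_zero, pow_zero]; exact .refl 1
  | succ k ih => rw [pow_succ', pow_succ']; exact CensorLE.mul hA hA' (hB.pow k) h ih

end Order

end Kernel

end Kernels

end SpinSystem

namespace SpinSystem

/-! ### Block updates as reversible kernels -/

section BlockUpdate

variable {V S : Type*} [Fintype V] [DecidableEq V] [Fintype S] [DecidableEq S]
  {Λ : SpinSystem V S}

/-- The block update as a matrix. -/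
noncomputable def blockKernel (Λ : SpinSystem V S) (B : Finset V) : Matrix (V → S) (V → S) ℝ :=
  Matrix.of (Λ.blockUpdate B)

theorem blockUpdate_nonneg (B : Finset V) (σ ω : V → S) : 0 ≤ Λ.blockUpdate B σ ω := by
  unfold blockUpdate
  split_ifs
  · exact div_nonneg (Λ.pi_nonneg _) (Finset.sum_nonneg fun _ _ => Λ.pi_nonneg _)
  · exact le_rfl

theorem mem_agree_of_blockUpdate_ne_zero {B : Finset V} {σ ω : V → S}
    (h : Λ.blockUpdate B σ ω ≠ 0) : ω ∈ Λ.agree B σ := by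
  unfold blockUpdate at h
  split_ifs at h with h1
  · exact ⟨Λ.mem_of_pi_ne_zero fun h0 => h (by rw [h0, zero_div]), h1⟩
  · exact absurd rfl h

theorem sum_agree_pos (B : Finset V) {σ : V → S} (hσ : σ ∈ Λ.Ω) :
    0 < ∑ τ with ∀ v, v ∉ B → τ v = σ v, Λ.π τ :=
  Finset.sum_pos' (fun _ _ => Λ.pi_nonneg _) ⟨σ, by simp, Λ.pos σ hσ⟩

theorem blockUpdate_ne_zero {B : Finset V} {σ ω : V → S} (hσ : σ ∈ Λ.Ω)
    (h : ω ∈ Λ.agree B σ) : Λ.blockUpdate B σ ω ≠ 0 := by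
  unfold blockUpdate
  rw [if_pos h.2]
  exact (div_pos (Λ.pos _ h.1) (sum_agree_pos B hσ)).ne'

theorem isKernel_blockKernel (Λ : SpinSystem V S) (B : Finset V) :
    Λ.IsKernel (Λ.blockKernel B) := by
  refine ⟨fun σ ω => blockUpdate_nonneg B σ ω, fun σ hσ => ?_, fun σ _ ω hω => ?_⟩
  · simp only [blockKernel, Matrix.of_apply, blockUpdate]
    rw [← Finset.sum_filter, ← Finset.sum_div, div_self (sum_agree_pos B hσ).ne']
  · by_contra h
    exact hω (mem_agree_of_blockUpdate_ne_zero h).1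

theorem isReversible_blockKernel (Λ : SpinSystem V S) (B : Finset V) :
    Λ.IsReversible (Λ.blockKernel B) := by
  intro σ ω
  simp only [blockKernel, Matrix.of_apply, blockUpdate]
  by_cases h : ∀ v, v ∉ B → ω v = σ v
  · have h' : ∀ v, v ∉ B → σ v = ω v := fun v hv => (h v hv).symm
    have hf : (Finset.univ.filter fun τ : V → S => ∀ v, v ∉ B → τ v = σ v) =
        Finset.univ.filter fun τ : V → S => ∀ v, v ∉ B → τ v = ω v := by
      ext τ
      simp only [Finset.mem_filter, Finset.mem_univ, true_and]
      exact forall₂_congr fun v hv => by rw [h v hv]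
    rw [if_pos h, if_pos h', hf]
    ring
  · have h' : ¬ ∀ v, v ∉ B → σ v = ω v := fun h' => h fun v hv => (h' v hv).symm
    rw [if_neg h, if_neg h']
    simp

theorem glauber_eq (Λ : SpinSystem V S) (A : Finset V) :
    Λ.glauber A = (1 / (A.card : ℝ)) • ∑ v ∈ A, Λ.blockKernel {v} := by
  ext σ ω
  rw [average_apply]
  rfl

theorem isKernel_glauber (Λ : SpinSystem V S) {A : Finset V} (hA : A.Nonempty) :
    Λ.IsKernel (Λ.glauber A) := by
  rw [glauber_eq]
  exact IsKernel.average hA fun v _ => Λ.isKernel_blockKernel _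

theorem isReversible_glauber (Λ : SpinSystem V S) (A : Finset V) :
    Λ.IsReversible (Λ.glauber A) := by
  rw [glauber_eq]
  exact IsReversible.average fun v _ => Λ.isReversible_blockKernel _

theorem sum_agree_singleton (σ : V → S) (v : V) (f : (V → S) → ℝ) :
    ∑ τ with ∀ u, u ∉ ({v} : Finset V) → τ u = σ u, f τ = ∑ s, f (Function.update σ v s) := by
  refine (Finset.sum_nbij (fun s => Function.update σ v s) ?_ ?_ ?_ fun _ _ => rfl).symm
  · intro s _
    simp only [Finset.mem_filter, Finset.mem_univ, true_and, Finset.mem_singleton]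
    exact fun u hu => Function.update_of_ne hu _ _
  · exact (Function.update_injective σ v).injOn
  · intro τ hτ
    simp only [Finset.coe_filter, Finset.mem_univ, true_and, Finset.mem_singleton,
      Set.mem_ofPred_eq] at hτ
    refine ⟨τ v, by simp, ?_⟩
    ext u
    by_cases hu : u = v
    · subst hu; simp
    · simp [hu, hτ u hu]

theorem siteKernel_mulVec (σ : V → S) (v : V) (f : (V → S) → ℝ) :
    ((Λ.blockKernel {v}).mulVec f) σ =
      ∑ s, Λ.blockUpdate {v} σ (Function.update σ v s) * f (Function.update σ v s) := by
  rw [← sum_agree_singleton σ v fun τ => Λ.blockUpdate {v} σ τ * f τ, Finset.sum_filter]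
  refine Finset.sum_congr rfl fun τ _ => ?_
  by_cases h : ∀ u, u ∉ ({v} : Finset V) → τ u = σ u
  · rw [if_pos h]; rfl
  · rw [if_neg h]
    simp only [blockKernel, Matrix.of_apply, blockUpdate]
    rw [if_neg h, zero_mul]

theorem blockUpdate_update (σ : V → S) (v : V) (s : S) :
    Λ.blockUpdate {v} σ (Function.update σ v s) =
      Λ.π (Function.update σ v s) / ∑ r, Λ.π (Function.update σ v r) := by
  unfold blockUpdate
  rw [sum_agree_singleton, if_pos]
  intro u hu
  rw [Finset.mem_singleton] at hu
  exact Function.update_of_ne hu _ _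

end BlockUpdate

/-! ### Monotonicity and censoring of a single-site update -/

section Monotone

/-- A real function increasing on a set in a finite preorder has an increasing extension. -/
theorem exists_monotone_extension_of_finite {X : Type*} [Preorder X] [Finite X] {f : X → ℝ}
    {s : Set X} (hf : MonotoneOn f s) : ∃ g : X → ℝ, Monotone g ∧ Set.EqOn f g s := by
  -- A common lower bound is added to every supremum, so that points with nothing of `s` below them
  -- cause no harm.
  obtain ⟨a, ha⟩ := (Set.toFinite (f '' s)).bddBelow
  have hb : ∀ x, BddAbove (insert a (f '' (Set.Iic x ∩ s))) := fun x => (Set.toFinite _).bddAbove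
  refine ⟨fun x => sSup (insert a (f '' (Set.Iic x ∩ s))), fun x y hxy => ?_, fun x hx => ?_⟩
  · exact csSup_le_csSup (hb y) (Set.insert_nonempty _ _)
      (Set.insert_subset_insert (Set.image_mono (Set.inter_subset_inter_left _
        (Set.Iic_subset_Iic.2 hxy))))
  · refine le_antisymm (le_csSup (hb x) (Or.inr ⟨x, ⟨le_rfl, hx⟩, rfl⟩))
      (csSup_le (Set.insert_nonempty _ _) ?_)
    rintro _ (rfl | ⟨y, ⟨hy, hys⟩, rfl⟩)
    · exact ha ⟨x, hx, rfl⟩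
    · exact hf hys hx hy

variable {V S : Type*} [Fintype V] [DecidableEq V] [Fintype S] [LinearOrder S]
  {Λ : SpinSystem V S}

theorem preservesMonotone_siteKernel (h : Λ.IsMonotone) (v : V) :
    Λ.PreservesMonotone (Λ.blockKernel {v}) := by
  intro f hf σ hσ τ hτ hle
  -- Updating `τ` with a spin that is legal for `σ` may leave Ω, where `f` need not be monotone.
  -- With a global extension the change of surroundings and the change of spin law can be treated
  -- separately.
  obtain ⟨g, hg, hfg⟩ := exists_monotone_extension_of_finite hf
  have hK := Λ.isKernel_blockKernel {v}
  rw [hK.mulVec_congr hσ fun ω hω _ => hfg hω, hK.mulVec_congr hτ fun ω hω _ => hfg hω,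
    siteKernel_mulVec, siteKernel_mulVec]
  simp only [blockUpdate_update]
  refine (Finset.sum_le_sum fun s _ => mul_le_mul_of_nonneg_left
    (hg (update_le_update_iff.2 ⟨le_rfl, fun u _ => hle u⟩))
    (div_nonneg (Λ.pi_nonneg _) (Finset.sum_nonneg fun _ _ => Λ.pi_nonneg _))).trans
    (b := ∑ s, Λ.π (Function.update σ v s) / (∑ r, Λ.π (Function.update σ v r)) *
        g (Function.update τ v s)) ?_
  have := h σ hσ τ hτ hle v (fun s => g (Function.update τ v s))
    fun s t hst => hg (update_le_update_iff.2 ⟨hst, fun _ _ => le_rfl⟩)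
  simpa only [mul_comm] using this

/-- The Dirichlet form ∑ π(σ) M(σ,ω) (f σ - f ω)(g σ - g ω) has nonnegative terms, because M joins
only comparable configurations, and by reversibility it equals 2⟨f,g⟩ - 2⟨f,Mg⟩. -/
theorem censorLE_one {M : Matrix (V → S) (V → S) ℝ} (hK : Λ.IsKernel M) (hM : Λ.IsReversible M)
    (hc : ∀ σ ∈ Λ.Ω, ∀ ω ∈ Λ.Ω, M σ ω ≠ 0 → σ ≤ ω ∨ ω ≤ σ) : Λ.CensorLE M 1 := by
  intro f g hf hg
  rw [Matrix.one_mulVec]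
  have h0 : 0 ≤ ∑ σ, ∑ ω, Λ.π σ * M σ ω * ((f σ - f ω) * (g σ - g ω)) := by
    refine Finset.sum_nonneg fun σ _ => Finset.sum_nonneg fun ω _ => ?_
    by_cases hσ : σ ∈ Λ.Ω
    · by_cases hω : ω ∈ Λ.Ω
      · by_cases h : M σ ω = 0
        · simp [h]
        · refine mul_nonneg (mul_nonneg (Λ.pi_nonneg _) (hK.nonneg _ _)) ?_
          rcases hc σ hσ ω hω h with h | h
          · exact mul_nonneg_of_nonpos_of_nonpos (sub_nonpos.2 (hf hσ hω h))
              (sub_nonpos.2 (hg hσ hω h))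
          · exact mul_nonneg (sub_nonneg.2 (hf hω hσ h)) (sub_nonneg.2 (hg hω hσ h))
      · simp [hK.eq_zero σ hσ ω hω]
    · simp [Λ.zero σ hσ]
  have h1 : ∑ σ, ∑ ω, Λ.π σ * M σ ω * (f σ * g σ) = Λ.pairing f g := by
    refine Finset.sum_congr rfl fun σ _ => ?_
    rw [← Finset.sum_mul, ← Finset.mul_sum]
    by_cases hσ : σ ∈ Λ.Ω
    · rw [hK.row_sum σ hσ, mul_one]
    · simp [Λ.zero σ hσ]
  have h2 : ∑ σ, ∑ ω, Λ.π σ * M σ ω * (f ω * g ω) = Λ.pairing f g := by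
    rw [← h1, Finset.sum_comm]
    exact Finset.sum_congr rfl fun σ _ => Finset.sum_congr rfl fun ω _ => by rw [hM ω σ]
  have h3 : ∑ σ, ∑ ω, Λ.π σ * M σ ω * (f σ * g ω) = Λ.pairing f (M.mulVec g) := by
    simp only [pairing, Matrix.mulVec, dotProduct, Finset.mul_sum]
    exact Finset.sum_congr rfl fun σ _ => Finset.sum_congr rfl fun ω _ => by ring
  have h4 : ∑ σ, ∑ ω, Λ.π σ * M σ ω * (f ω * g σ) = Λ.pairing f (M.mulVec g) := by
    rw [← h3, Finset.sum_comm]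
    exact Finset.sum_congr rfl fun σ _ => Finset.sum_congr rfl fun ω _ => by rw [hM ω σ]
  have h5 : ∑ σ, ∑ ω, Λ.π σ * M σ ω * ((f σ - f ω) * (g σ - g ω)) =
      2 * Λ.pairing f g - 2 * Λ.pairing f (M.mulVec g) := by
    calc _ = ∑ σ, ∑ ω, Λ.π σ * M σ ω * (f σ * g σ) + ∑ σ, ∑ ω, Λ.π σ * M σ ω * (f ω * g ω)
          - ∑ σ, ∑ ω, Λ.π σ * M σ ω * (f σ * g ω) - ∑ σ, ∑ ω, Λ.π σ * M σ ω * (f ω * g σ) := by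
          simp only [← Finset.sum_add_distrib, ← Finset.sum_sub_distrib]
          exact Finset.sum_congr rfl fun σ _ => Finset.sum_congr rfl fun ω _ => by ring
      _ = _ := by rw [h1, h2, h3, h4]; ring
  linarith

theorem censorLE_siteKernel (Λ : SpinSystem V S) (v : V) :
    Λ.CensorLE (Λ.blockKernel {v}) 1 := by
  refine censorLE_one (Λ.isKernel_blockKernel _) (Λ.isReversible_blockKernel _)
    fun σ _ ω _ h => ?_
  have h' := (mem_agree_of_blockUpdate_ne_zero h).2
  simp only [Finset.mem_singleton] at h'
  rcases le_total (σ v) (ω v) with hle | hle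
  · refine Or.inl fun u => ?_
    by_cases hu : u = v
    · rw [hu]; exact hle
    · exact (h' u hu).ge
  · refine Or.inr fun u => ?_
    by_cases hu : u = v
    · rw [hu]; exact hle
    · exact (h' u hu).le

end Monotone

/-! ### Total variation from an extreme start -/

section TotalVariation

variable {V S : Type*} [Fintype V] [DecidableEq V] [Fintype S] {Λ : SpinSystem V S}

theorem tvDist_eq_sum_indicator {X : Type*} [Fintype X] {μ ν : X → ℝ} (p : X → Prop)
    [DecidablePred p] (h : ∑ x, μ x = ∑ x, ν x) (h1 : ∀ x, p x → ν x ≤ μ x)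
    (h2 : ∀ x, ¬ p x → μ x ≤ ν x) :
    tvDist μ ν = ∑ x, μ x * (if p x then 1 else 0) - ∑ x, ν x * (if p x then 1 else 0) := by
  have : ∀ x, |μ x - ν x| =
      2 * (μ x * (if p x then 1 else 0) - ν x * (if p x then 1 else 0)) - (μ x - ν x) := by
    intro x
    by_cases hx : p x
    · rw [abs_of_nonneg (sub_nonneg.2 (h1 x hx)), if_pos hx]; ring
    · rw [abs_of_nonpos (sub_nonpos.2 (h2 x hx)), if_neg hx]; ring
  unfold tvDist
  rw [Finset.sum_congr rfl fun x _ => this x, Finset.sum_sub_distrib, ← Finset.mul_sum,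
    Finset.sum_sub_distrib, Finset.sum_sub_distrib, h]
  ring

theorem sum_row_eq {M : Matrix (V → S) (V → S) ℝ} (hK : Λ.IsKernel M) {m : V → S}
    (hm : m ∈ Λ.Ω) : ∑ x, M m x = ∑ x, Λ.π x := by
  rw [hK.row_sum m hm, Λ.sum_eq_one]

open Classical in
-- By reversibility the density of `M m` with respect to π at `ω` is `M ω m / π m`. The optimal
-- event is thus a level set of `M` applied to the point mass at `m`, a function whose monotonicity
-- can be controlled.
theorem tvDist_eq_of_isReversible {M : Matrix (V → S) (V → S) ℝ} (hK : Λ.IsKernel M)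
    (hM : Λ.IsReversible M) {m : V → S} (hm : m ∈ Λ.Ω) :
    tvDist (M m) Λ.π = (M.mulVec fun ω => if Λ.π m ≤ M ω m then 1 else 0) m -
      ∑ ω, Λ.π ω * (if Λ.π m ≤ M ω m then 1 else 0) := by
  refine tvDist_eq_sum_indicator (fun ω => Λ.π m ≤ M ω m) (sum_row_eq hK hm)
    (fun ω h => ?_) fun ω h => ?_
  · have h' := mul_le_mul_of_nonneg_left h (Λ.pi_nonneg ω)
    rw [← hM m ω, mul_comm] at h'
    exact le_of_mul_le_mul_left h' (Λ.pos m hm)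
  · have h' := mul_le_mul_of_nonneg_left (not_le.1 h).le (Λ.pi_nonneg ω)
    rw [← hM m ω, mul_comm (Λ.π ω)] at h'
    exact le_of_mul_le_mul_left h' (Λ.pos m hm)

theorem pairing_single [DecidableEq S] (m : V → S) (g : (V → S) → ℝ) :
    Λ.pairing (Pi.single m 1) g = Λ.π m * g m := by
  unfold pairing
  rw [Finset.sum_eq_single m]
  · simp
  · intro σ _ h
    simp [h]
  · simp

theorem pairing_neg_neg (f g : (V → S) → ℝ) : Λ.pairing (-f) (-g) = Λ.pairing f g := by
  simp [pairing]

theorem mulVec_single_one_apply [DecidableEq S] (M : Matrix (V → S) (V → S) ℝ) (m ω : V → S) :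
    (M.mulVec (Pi.single m 1)) ω = M ω m := by
  rw [Matrix.mulVec_single_one]; rfl

variable [PartialOrder S]

theorem monotoneOn_single_top [DecidableEq S] {m : V → S} (hm : ∀ σ ∈ Λ.Ω, σ ≤ m) :
    MonotoneOn (Pi.single m 1 : (V → S) → ℝ) Λ.Ω := by
  intro σ _ τ hτ hle
  by_cases h : σ = m
  · subst h
    rw [le_antisymm (hm τ hτ) hle]
  · rw [Pi.single_eq_of_ne h]
    by_cases h' : τ = m
    · rw [h', Pi.single_eq_same]; exact zero_le_one
    · rw [Pi.single_eq_of_ne h']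

theorem antitoneOn_single_bot [DecidableEq S] {m : V → S} (hm : ∀ σ ∈ Λ.Ω, m ≤ σ) :
    AntitoneOn (Pi.single m 1 : (V → S) → ℝ) Λ.Ω := by
  intro σ hσ τ _ hle
  by_cases h : τ = m
  · subst h
    rw [le_antisymm (hm σ hσ) hle]
  · rw [Pi.single_eq_of_ne h]
    by_cases h' : σ = m
    · rw [h', Pi.single_eq_same]; exact zero_le_one
    · rw [Pi.single_eq_of_ne h']

open Classical in
/-- The censoring inequality for total variation, from an extreme initial configuration: if `A`
is more mixing than `R` against increasing functions, then it is at least as mixing in total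
variation. -/
theorem tvDist_le_of_censorLE {A R : Matrix (V → S) (V → S) ℝ} (hA : Λ.IsKernel A)
    (hA' : Λ.IsReversible A) (hA'' : Λ.PreservesMonotone A) (hR : Λ.IsKernel R)
    (hR' : Λ.IsReversible R) (h : Λ.CensorLE A R) {m : V → S} (hm : m ∈ Λ.Ω)
    (hm' : (∀ σ ∈ Λ.Ω, σ ≤ m) ∨ (∀ σ ∈ Λ.Ω, m ≤ σ)) {δ : ℝ}
    (hδ : ∀ g : (V → S) → ℝ, (∀ σ, g σ = 0 ∨ g σ = 1) → ∀ σ ∈ Λ.Ω, ∀ τ ∈ Λ.Ω,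
      (R.mulVec g) σ - (R.mulVec g) τ ≤ δ) :
    tvDist (A m) Λ.π ≤ δ := by
  rw [tvDist_eq_of_isReversible hA hA' hm]
  set g : (V → S) → ℝ := fun ω => if Λ.π m ≤ A ω m then 1 else 0 with hg
  -- The point mass at the top is increasing, so its image under `A` and the level set `g` are
  -- increasing too; pairing with that point mass evaluates at `m`. At the bottom everything changes
  -- sign.
  have hle : (A.mulVec g) m ≤ (R.mulVec g) m := by
    rcases hm' with hm' | hm'
    · have h1 : MonotoneOn g Λ.Ω := by
        have := hA'' _ (monotoneOn_single_top hm')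
        intro σ hσ τ hτ hle
        have := this hσ hτ hle
        rw [mulVec_single_one_apply, mulVec_single_one_apply] at this
        simp only [hg]
        split_ifs with h1 h2
        · exact le_rfl
        · exact absurd (h1.trans this) h2
        · exact zero_le_one
        · exact le_rfl
      have := h _ _ (monotoneOn_single_top hm') h1
      rw [pairing_single, pairing_single] at this
      exact le_of_mul_le_mul_left this (Λ.pos m hm)
    · have hneg : MonotoneOn (-Pi.single m 1 : (V → S) → ℝ) Λ.Ω := (antitoneOn_single_bot hm').neg
      have h1 : MonotoneOn (-g) Λ.Ω := by
        have := hA'' _ hneg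
        intro σ hσ τ hτ hle
        have := this hσ hτ hle
        rw [Matrix.mulVec_neg, Pi.neg_apply, Pi.neg_apply, mulVec_single_one_apply,
          mulVec_single_one_apply, neg_le_neg_iff] at this
        simp only [hg, Pi.neg_apply, neg_le_neg_iff]
        split_ifs with h1 h2
        · exact le_rfl
        · exact absurd (h1.trans this) h2
        · exact zero_le_one
        · exact le_rfl
      have := h _ _ hneg h1
      rw [Matrix.mulVec_neg, Matrix.mulVec_neg, pairing_neg_neg, pairing_neg_neg, pairing_single,
        pairing_single] at this
      exact le_of_mul_le_mul_left this (Λ.pos m hm)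
  have hb : ∀ σ ∈ Λ.Ω, (R.mulVec g) m - δ ≤ (R.mulVec g) σ := fun σ hσ => by
    have := hδ g (fun σ => by simp only [hg]; split_ifs <;> simp) m hm σ hσ
    linarith
  -- `R` preserves π, so the π-mean of `g` is the π-mean of `R g`, whose values all lie within `δ`
  -- of the one at `m` or above.
  have hs : (R.mulVec g) m - δ ≤ ∑ ω, Λ.π ω * g ω := by
    rw [← hR'.sum_pi_mulVec hR g]
    calc (R.mulVec g) m - δ = ∑ ω, Λ.π ω * ((R.mulVec g) m - δ) := by
          rw [← Finset.sum_mul, Λ.sum_eq_one, one_mul]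
      _ ≤ _ := Finset.sum_le_sum fun ω _ => by
          by_cases hω : ω ∈ Λ.Ω
          · exact mul_le_mul_of_nonneg_left (hb ω hω) (Λ.pi_nonneg ω)
          · simp [Λ.zero ω hω]
  linarith

end TotalVariation

end SpinSystem

/-! ### Weak duality for the Kantorovich distance -/

section Transport

theorem IsCoupling.apply_ne_zero {X : Type*} [Fintype X] {μ ν : X → ℝ} {c : X → X → ℝ}
    (hc : IsCoupling μ ν c) {x y : X} (h : c x y ≠ 0) : μ x ≠ 0 ∧ ν y ≠ 0 := by
  constructor
  · intro h0
    refine h ((Finset.sum_eq_zero_iff_of_nonneg fun y _ => hc.nonneg x y).1 ?_ y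
      (Finset.mem_univ y))
    rw [hc.left, h0]
  · intro h0
    refine h ((Finset.sum_eq_zero_iff_of_nonneg fun x _ => hc.nonneg x y).1 ?_ x
      (Finset.mem_univ x))
    rw [hc.right, h0]

variable {V S : Type*} [Fintype V] [DecidableEq V] [Fintype S] [DecidableEq S]
  {μ ν : (V → S) → ℝ}

theorem isCoupling_mul (hμ : ∀ x, 0 ≤ μ x) (hν : ∀ x, 0 ≤ ν x) (hμ1 : ∑ x, μ x = 1)
    (hν1 : ∑ x, ν x = 1) : IsCoupling μ ν fun x y => μ x * ν y :=
  ⟨fun x y => mul_nonneg (hμ x) (hν y), fun x => by rw [← Finset.mul_sum, hν1, mul_one],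
    fun y => by rw [← Finset.sum_mul, hμ1, one_mul]⟩

/-- Weak duality for the Kantorovich distance. -/
theorem le_kantorovich (hμ : ∀ x, 0 ≤ μ x) (hν : ∀ x, 0 ≤ ν x) (hμ1 : ∑ x, μ x = 1)
    (hν1 : ∑ x, ν x = 1) {g g' : (V → S) → ℝ} {a : ℝ}
    (h : ∀ x y, μ x ≠ 0 → ν y ≠ 0 → g x - g' y ≤ a + (hammingDist x y : ℝ)) :
    ∑ x, μ x * g x - ∑ y, ν y * g' y ≤ a + kantorovich μ ν := by
  rw [← sub_le_iff_le_add']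
  -- The independent coupling shows that the infimum is over a nonempty set, so it is not the
  -- default value 0.
  refine le_csInf ⟨_, _, isCoupling_mul hμ hν hμ1 hν1, rfl⟩ ?_
  rintro _ ⟨c, hc, rfl⟩
  have h1 : ∑ x, μ x * g x = ∑ x, ∑ y, c x y * g x :=
    Finset.sum_congr rfl fun x _ => by rw [← Finset.sum_mul, hc.left]
  have h2 : ∑ y, ν y * g' y = ∑ x, ∑ y, c x y * g' y := by
    rw [Finset.sum_comm]
    exact Finset.sum_congr rfl fun y _ => by rw [← Finset.sum_mul, hc.right]
  have h3 : a = ∑ x, ∑ y, c x y * a := by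
    rw [Finset.sum_congr rfl fun x _ => by rw [← Finset.sum_mul, hc.left], ← Finset.sum_mul, hμ1,
      one_mul]
  rw [h1, h2, h3, ← Finset.sum_sub_distrib, ← Finset.sum_sub_distrib]
  refine Finset.sum_le_sum fun x _ => ?_
  rw [← Finset.sum_sub_distrib, ← Finset.sum_sub_distrib]
  refine Finset.sum_le_sum fun y _ => ?_
  rw [← mul_sub, ← mul_sub]
  by_cases h0 : c x y = 0
  · simp [h0]
  · obtain ⟨hx, hy⟩ := hc.apply_ne_zero h0
    exact mul_le_mul_of_nonneg_left (by linarith [h x y hx hy]) (hc.nonneg x y)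

end Transport

namespace SpinSystem

/-! ### Oscillation and mixing times -/

section TotalVariation

theorem tvDist_comm {X : Type*} [Fintype X] (μ ν : X → ℝ) : tvDist μ ν = tvDist ν μ := by
  unfold tvDist
  simp only [abs_sub_comm]

/-- The oscillation of `g` on `A` is at most `a`. -/
def OscLE {X : Type*} (A : Set X) (g : X → ℝ) (a : ℝ) : Prop :=
  ∀ x ∈ A, ∀ y ∈ A, g x - g y ≤ a

theorem sum_sub_sum_le_tvDist {X : Type*} [Fintype X] {μ ν g : X → ℝ} {A : Set X}
    (hA : A.Nonempty) (hμ : ∀ x, x ∉ A → μ x = 0) (hν : ∀ x, x ∉ A → ν x = 0)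
    (h : ∑ x, μ x = ∑ x, ν x) {a : ℝ} (hg : OscLE A g a) :
    ∑ x, μ x * g x - ∑ x, ν x * g x ≤ tvDist μ ν * a := by
  obtain ⟨z, hz, hmin⟩ := Set.exists_min_image A g (Set.toFinite A) hA
  have hs : ∑ x, (μ x - ν x) = 0 := by rw [Finset.sum_sub_distrib, h, sub_self]
  calc ∑ x, μ x * g x - ∑ x, ν x * g x = ∑ x, (μ x - ν x) * (g x - g z) := by
        simp only [mul_sub, Finset.sum_sub_distrib, sub_mul, ← Finset.sum_mul, h]
        ring
    -- After subtracting the minimum of `g`, only the positive part of μ - ν can contribute, and its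
    -- total mass is `tvDist μ ν`.
    _ ≤ ∑ x, (|μ x - ν x| + (μ x - ν x)) / 2 * a := by
        refine Finset.sum_le_sum fun x _ => ?_
        by_cases hx : x ∈ A
        · have h1 := hmin x hx
          have h2 := hg x hx z hz
          rcases abs_cases (μ x - ν x) with ⟨he, hs⟩ | ⟨he, hs⟩
          · rw [he]; nlinarith
          · rw [he]; nlinarith
        · simp [hμ x hx, hν x hx]
    _ = tvDist μ ν * a := by
        rw [← Finset.sum_mul, ← Finset.sum_div, Finset.sum_add_distrib, hs, tvDist]
        ring

theorem exists_of_mixingTime_le {X : Type*} [Fintype X] [DecidableEq X] {P : Matrix X X ℝ}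
    {A : Set X} {μ : X → ℝ} {ε : ℝ} {T : ℕ} (h : mixingTime P A μ ε ≤ T) :
    ∃ t ≤ T, ∀ ω ∈ A, tvDist ((P ^ t) ω) μ ≤ ε := by
  by_contra! hc
  have : ((T + 1 : ℕ) : ℕ∞) ≤ mixingTime P A μ ε := by
    refine le_iInf₂ fun t ht => ?_
    rw [Nat.cast_le]
    by_contra! hlt
    obtain ⟨ω, hω, h1⟩ := hc t (by omega)
    exact absurd (ht ω hω) h1.not_ge
  have := this.trans h
  rw [Nat.cast_le] at this
  omega

theorem mixingTime_le {X : Type*} [Fintype X] [DecidableEq X] {P : Matrix X X ℝ}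
    {A : Set X} {μ : X → ℝ} {ε : ℝ} {t : ℕ} (h : ∀ ω ∈ A, tvDist ((P ^ t) ω) μ ≤ ε) :
    mixingTime P A μ ε ≤ t :=
  iInf₂_le t h

end TotalVariation

/-! ### Dynamics inside one block: decay, frozen blocks, connectedness of Ω -/

section BlockDynamics

variable {V S : Type*} [Fintype V] [DecidableEq V] [Fintype S] [DecidableEq S]
  {Λ : SpinSystem V S}

theorem agree_trans {B : Finset V} {ρ σ τ : V → S} (h : σ ∈ Λ.agree B ρ) (h' : τ ∈ Λ.agree B σ) :
    τ ∈ Λ.agree B ρ :=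
  ⟨h'.1, fun v hv => (h'.2 v hv).trans (h.2 v hv)⟩

theorem agree_symm {B : Finset V} {σ τ : V → S} (hσ : σ ∈ Λ.Ω) (h : τ ∈ Λ.agree B σ) :
    σ ∈ Λ.agree B τ :=
  ⟨hσ, fun v hv => (h.2 v hv).symm⟩

theorem agree_mono {A B : Finset V} (h : A ⊆ B) (σ : V → S) : Λ.agree A σ ⊆ Λ.agree B σ :=
  fun _ hω => ⟨hω.1, fun v hv => hω.2 v fun hv' => hv (h hv')⟩

theorem self_mem_agree {B : Finset V} {σ : V → S} (hσ : σ ∈ Λ.Ω) : σ ∈ Λ.agree B σ :=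
  ⟨hσ, fun _ _ => rfl⟩

theorem mem_agree_of_glauber_ne_zero {B : Finset V} {σ ω : V → S} (h : Λ.glauber B σ ω ≠ 0) :
    ω ∈ Λ.agree B σ := by
  rw [glauber_eq, average_apply] at h
  obtain ⟨v, hv, h'⟩ := Finset.exists_ne_zero_of_sum_ne_zero (right_ne_zero_of_mul h)
  exact agree_mono (Finset.singleton_subset_iff.2 hv) _ (mem_agree_of_blockUpdate_ne_zero h')

theorem mem_agree_of_glauber_pow_ne_zero {B : Finset V} {σ ω : V → S} (hσ : σ ∈ Λ.Ω) {k : ℕ}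
    (h : (Λ.glauber B ^ k) σ ω ≠ 0) : ω ∈ Λ.agree B σ := by
  induction k generalizing ω with
  | zero =>
    rw [pow_zero] at h
    rw [show ω = σ from by_contra fun hne => h (Matrix.one_apply_ne (Ne.symm hne))]
    exact self_mem_agree hσ
  | succ k ih =>
    rw [pow_succ, Matrix.mul_apply] at h
    obtain ⟨τ, _, h'⟩ := Finset.exists_ne_zero_of_sum_ne_zero h
    exact agree_trans (ih (left_ne_zero_of_mul h'))
      (mem_agree_of_glauber_ne_zero (right_ne_zero_of_mul h'))

theorem IsKernel.oscLE_mulVec {M : Matrix (V → S) (V → S) ℝ} (hM : Λ.IsKernel M)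
    {A : Set (V → S)} (hA : A ⊆ Λ.Ω) (hs : ∀ ω ∈ A, ∀ τ, M ω τ ≠ 0 → τ ∈ A) {g : (V → S) → ℝ}
    {a : ℝ} (h : OscLE A g a) : OscLE A (M.mulVec g) a := by
  intro x hx y hy
  have h1 : ∀ z ∈ A, (M.mulVec g) x ≤ g z + a := fun z hz =>
    hM.mulVec_le (hA hx) fun w _ hw => by linarith [h w (hs x hx w hw) z hz]
  have h2 : (M.mulVec g) x - a ≤ (M.mulVec g) y :=
    hM.le_mulVec (hA hy) fun w _ hw => by linarith [h1 w (hs y hy w hw)]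
  linarith

theorem glauber_pow_closed (B : Finset V) (k : ℕ) (σ : V → S) :
    ∀ ω ∈ Λ.agree B σ, ∀ τ, (Λ.glauber B ^ k) ω τ ≠ 0 → τ ∈ Λ.agree B σ :=
  fun _ hω _ h => agree_trans hω (mem_agree_of_glauber_pow_ne_zero hω.1 h)

theorem oscLE_glauber_pow {B : Finset V} (hB : B.Nonempty) (k : ℕ) {σ : V → S}
    {g : (V → S) → ℝ} {a : ℝ} (h : OscLE (Λ.agree B σ) g a) :
    OscLE (Λ.agree B σ) ((Λ.glauber B ^ k).mulVec g) a :=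
  ((Λ.isKernel_glauber hB).pow k).oscLE_mulVec (fun _ hω => hω.1) (glauber_pow_closed B k σ) h

theorem blockUpdate_sum_eq_one (B : Finset V) {σ : V → S} (hσ : σ ∈ Λ.Ω) :
    ∑ ω, Λ.blockUpdate B σ ω = 1 :=
  (Λ.isKernel_blockKernel B).row_sum σ hσ

/-- Two starts are each within 1/4 of the block law at some time t ≤ T, so their expectations differ
by at most half the oscillation; the remaining T - t steps cannot increase it. -/
theorem oscLE_half_of_blockMixingTime_le {B : Finset V} (hB : B.Nonempty) {σ : V → S} {T : ℕ}
    (hσ : σ ∈ Λ.Ω) (hT : Λ.blockMixingTime B σ (1 / 4) ≤ T) {g : (V → S) → ℝ} {a : ℝ}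
    (h : OscLE (Λ.agree B σ) g a) :
    OscLE (Λ.agree B σ) ((Λ.glauber B ^ T).mulVec g) (a / 2) := by
  obtain ⟨t, ht, hmix⟩ := exists_of_mixingTime_le hT
  have ha : 0 ≤ a := by simpa using h σ (self_mem_agree hσ) σ (self_mem_agree hσ)
  rw [← Nat.sub_add_cancel ht, pow_add, ← Matrix.mulVec_mulVec]
  refine oscLE_glauber_pow hB _ fun x hx y hy => ?_
  have hK := (Λ.isKernel_glauber hB).pow t
  have h0 : ∀ z, z ∉ Λ.agree B σ → Λ.blockUpdate B σ z = 0 := fun z hz => by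
    by_contra h0
    exact hz (mem_agree_of_blockUpdate_ne_zero h0)
  have h1 : ∀ x ∈ Λ.agree B σ, ∀ z, z ∉ Λ.agree B σ → (Λ.glauber B ^ t) x z = 0 :=
    fun x hx z hz => by
      by_contra h0
      exact hz (glauber_pow_closed B t σ x hx z h0)
  have h2 : ∀ x ∈ Λ.agree B σ, ∑ z, (Λ.glauber B ^ t) x z = ∑ z, Λ.blockUpdate B σ z :=
    fun x hx => by rw [hK.row_sum x hx.1, blockUpdate_sum_eq_one B hσ]
  have h3 := sum_sub_sum_le_tvDist ⟨x, hx⟩ (h1 x hx) h0 (h2 x hx) h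
  have h4 := sum_sub_sum_le_tvDist ⟨x, hx⟩ h0 (h1 y hy) (h2 y hy).symm h
  have h5 := mul_le_mul_of_nonneg_right (hmix x hx) ha
  have h6 := mul_le_mul_of_nonneg_right (hmix y hy) ha
  rw [tvDist_comm] at h6
  simp only [Matrix.mulVec, dotProduct]
  linarith

/-- Every `T` steps halve the oscillation, and 1/2 ≤ θ^T. The factor 2 pays for the last incomplete
period. -/
theorem oscLE_glauber_pow_of_blockMixingTime_le {B : Finset V} (hB : B.Nonempty) {σ : V → S}
    {T : ℕ} (hT0 : 0 < T) (hσ : σ ∈ Λ.Ω) (hT : Λ.blockMixingTime B σ (1 / 4) ≤ T) {θ : ℝ}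
    (hθ : 0 < θ) (hθ1 : θ ≤ 1) (hθT : 1 / 2 ≤ θ ^ T) (k : ℕ) {g : (V → S) → ℝ} {a : ℝ}
    (h : OscLE (Λ.agree B σ) g a) :
    OscLE (Λ.agree B σ) ((Λ.glauber B ^ k).mulVec g) (2 * θ ^ k * a) := by
  induction k using Nat.strong_induction_on generalizing g a with
  | _ k ih =>
    have ha : 0 ≤ a := by simpa using h σ (self_mem_agree hσ) σ (self_mem_agree hσ)
    rcases lt_or_ge k T with hk | hk
    · intro x hx y hy
      refine (oscLE_glauber_pow hB k h x hx y hy).trans ?_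
      have := pow_le_pow_of_le_one hθ.le hθ1 hk.le
      nlinarith
    · have h1 := ih (k - T) (by omega) (oscLE_half_of_blockMixingTime_le hB hσ hT h)
      rw [Matrix.mulVec_mulVec, ← pow_add, Nat.sub_add_cancel hk] at h1
      intro x hx y hy
      refine (h1 x hx y hy).trans ?_
      have h2 : θ ^ k = θ ^ (k - T) * θ ^ T := by rw [← pow_add, Nat.sub_add_cancel hk]
      rw [h2]
      have h3 : 0 ≤ θ ^ (k - T) * a := by positivity
      nlinarith

open Classical in
theorem blockKernel_mulVec (B : Finset V) (σ : V → S) (g : (V → S) → ℝ) :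
    ((Λ.blockKernel B).mulVec g) σ = (∑ τ with ∀ v, v ∉ B → τ v = σ v, Λ.π τ)⁻¹ *
      Λ.pairing (fun ω => if ω ∈ Λ.agree B σ then 1 else 0) g := by
  simp only [Matrix.mulVec, dotProduct, pairing, Finset.mul_sum, blockKernel, Matrix.of_apply,
    blockUpdate]
  refine Finset.sum_congr rfl fun ω _ => ?_
  by_cases h : ∀ v, v ∉ B → ω v = σ v
  · rw [if_pos h]
    by_cases h' : ω ∈ Λ.Ω
    · rw [if_pos ⟨h', h⟩]; ring
    · simp [Λ.zero ω h']
  · rw [if_neg h, if_neg fun h' => h h'.2]; simp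

/-- The block law is π restricted to a class that the dynamics in `B` never leaves. The indicator of
that class is harmonic, and reversibility moves the dynamics onto it. -/
theorem blockKernel_mulVec_glauber_pow {B : Finset V} (hB : B.Nonempty) (σ : V → S) (k : ℕ)
    (g : (V → S) → ℝ) :
    ((Λ.blockKernel B).mulVec ((Λ.glauber B ^ k).mulVec g)) σ =
      ((Λ.blockKernel B).mulVec g) σ := by
  classical
  rw [blockKernel_mulVec, blockKernel_mulVec,
    ((Λ.isReversible_glauber B).pow k).pairing_mulVec]
  congr 1
  refine pairing_congr (fun ω hω => ?_) fun _ _ => rfl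
  have hK := (Λ.isKernel_glauber hB).pow k
  refine (hK.mulVec_congr (g := fun _ => if ω ∈ Λ.agree B σ then 1 else 0) hω
    fun τ _ h => ?_).trans (hK.mulVec_const _ hω)
  have h' := mem_agree_of_glauber_pow_ne_zero hω h
  refine if_congr ⟨fun h1 => agree_trans h1 (agree_symm hω h'), fun h1 => agree_trans h1 h'⟩ rfl rfl

theorem glauber_pow_sub_blockKernel_le {B : Finset V} (hB : B.Nonempty) {σ : V → S} {k : ℕ}
    (hσ : σ ∈ Λ.Ω) {g : (V → S) → ℝ} {a : ℝ}
    (h : OscLE (Λ.agree B σ) ((Λ.glauber B ^ k).mulVec g) a) :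
    |((Λ.glauber B ^ k).mulVec g) σ - ((Λ.blockKernel B).mulVec g) σ| ≤ a := by
  rw [← blockKernel_mulVec_glauber_pow hB σ k g]
  have hK := Λ.isKernel_blockKernel B
  rw [abs_sub_le_iff]
  constructor
  · rw [sub_le_comm]
    exact hK.le_mulVec hσ fun ω _ h0 => by
      linarith [h σ (self_mem_agree hσ) ω (mem_agree_of_blockUpdate_ne_zero h0)]
  · rw [sub_le_iff_le_add]
    exact hK.mulVec_le hσ fun ω _ h0 => by
      linarith [h ω (mem_agree_of_blockUpdate_ne_zero h0) σ (self_mem_agree hσ)]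

/-- The event concerns only the spin at `u`, which a step selects with probability at most 1/|B|. -/
theorem glauber_mulVec_sub_le {B : Finset V} (hB : B.Nonempty) (u : V) (s : S) {σ : V → S}
    (hσ : σ ∈ Λ.Ω) :
    |((Λ.glauber B).mulVec fun ω => if ω u = s then 1 else 0) σ - (if σ u = s then 1 else 0)| ≤
      1 / (B.card : ℝ) := by
  have hc : (0 : ℝ) < B.card := by exact_mod_cast hB.card_pos
  rw [glauber_eq, average_mulVec]
  have h1 : (if σ u = s then (1 : ℝ) else 0) =
      1 / (B.card : ℝ) * ∑ v ∈ B, if σ u = s then (1 : ℝ) else 0 := by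
    rw [Finset.sum_const, nsmul_eq_mul]
    field_simp
  rw [h1]
  rw [← mul_sub, ← Finset.sum_sub_distrib, abs_mul, abs_of_pos (by positivity)]
  refine mul_le_of_le_one_right (by positivity) ?_
  refine (Finset.abs_sum_le_sum_abs _ _).trans ?_
  have h2 : ∀ v ∈ B, |((Λ.blockKernel {v}).mulVec fun ω => if ω u = s then 1 else 0) σ -
      (if σ u = s then 1 else 0)| ≤ if v = u then 1 else 0 := by
    intro v _
    have hK := Λ.isKernel_blockKernel {v}
    by_cases hv : v = u
    · have h3 := hK.le_mulVec (f := fun ω => if ω u = s then 1 else 0) (a := 0) hσ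
        fun ω _ _ => by split_ifs <;> norm_num
      have h4 := hK.mulVec_le (f := fun ω => if ω u = s then 1 else 0) (a := 1) hσ
        fun ω _ _ => by split_ifs <;> norm_num
      rw [if_pos hv, abs_sub_le_iff]
      split_ifs <;> constructor <;> linarith
    · rw [if_neg hv, hK.mulVec_congr (g := fun _ => if σ u = s then 1 else 0) hσ fun ω _ h0 => by
        rw [(mem_agree_of_blockUpdate_ne_zero h0).2 u (by simpa using Ne.symm hv)],
        hK.mulVec_const _ hσ, sub_self, abs_zero]
  refine (Finset.sum_le_sum h2).trans ?_
  rw [Finset.sum_ite_eq']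
  split_ifs <;> norm_num

theorem glauber_pow_mulVec_sub_le {B : Finset V} (hB : B.Nonempty) (u : V) (s : S) (t : ℕ)
    {σ : V → S} (hσ : σ ∈ Λ.Ω) :
    |((Λ.glauber B ^ t).mulVec fun ω => if ω u = s then 1 else 0) σ -
      (if σ u = s then 1 else 0)| ≤ t / (B.card : ℝ) := by
  induction t generalizing σ with
  | zero => simp
  | succ t ih =>
    have hK := Λ.isKernel_glauber hB
    have h1 := glauber_mulVec_sub_le hB u s hσ
    set g : (V → S) → ℝ := fun ω => if ω u = s then 1 else 0
    have h2 : |((Λ.glauber B).mulVec ((Λ.glauber B ^ t).mulVec g)) σ -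
        ((Λ.glauber B).mulVec g) σ| ≤ t / (B.card : ℝ) := by
      rw [← Pi.sub_apply, ← Matrix.mulVec_sub, abs_le]
      exact ⟨hK.le_mulVec hσ fun ω hω _ => (abs_le.1 (ih hω)).1,
        hK.mulVec_le hσ fun ω hω _ => (abs_le.1 (ih hω)).2⟩
    rw [pow_succ', ← Matrix.mulVec_mulVec]
    have h3 := abs_add_le (((Λ.glauber B).mulVec ((Λ.glauber B ^ t).mulVec g)) σ -
        ((Λ.glauber B).mulVec g) σ) (((Λ.glauber B).mulVec g) σ - g σ)
    rw [sub_add_sub_cancel] at h3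
    push_cast
    rw [add_div]
    linarith

/-- If the block is too large for its mixing time, then nothing in it can move. -/
theorem eq_of_mem_agree_of_card_lt {B : Finset V} {σ ω : V → S} {T : ℕ} (hσ : σ ∈ Λ.Ω)
    (hT : Λ.blockMixingTime B σ (1 / 4) ≤ T) (hB : 4 * T < B.card) (hω : ω ∈ Λ.agree B σ) :
    ω = σ := by
  have hB' : B.Nonempty := Finset.card_pos.1 (by omega)
  ext u
  by_contra hne
  have h1 : OscLE (Λ.agree B σ) (fun ω => if ω u = σ u then (1 : ℝ) else 0) 1 := by
    intro x _ y _
    dsimp only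
    split_ifs <;> norm_num
  have h2 := oscLE_half_of_blockMixingTime_le hB' hσ hT h1 σ (self_mem_agree hσ) ω hω
  have h3 := abs_le.1 (glauber_pow_mulVec_sub_le hB' u (σ u) T hσ)
  have h4 := abs_le.1 (glauber_pow_mulVec_sub_le hB' u (σ u) T hω.1)
  rw [if_pos rfl] at h3
  rw [if_neg hne] at h4
  -- From either start the probability of spin `σ u` at `u` moves by less than 1/4, so the initial
  -- gap 1 stays above 1/2, whereas mixing brings it down to at most 1/2.
  have h5 : (T : ℝ) / B.card < 1 / 4 := by
    rw [div_lt_div_iff₀ (by exact_mod_cast hB'.card_pos) (by norm_num)]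
    have : ((4 * T : ℕ) : ℝ) < B.card := by exact_mod_cast hB
    push_cast at this
    linarith
  linarith [h3.1, h4.2]

variable {ι : Type*} [Fintype ι] {B : ι → Finset V} {b : ℕ} {γ : ℝ} {T : ℕ}

/-- The indicator of a closed set is invariant under the dynamics in the block; since mixing halves
its oscillation, it must be constant on the class. -/
theorem agree_subset_of_closed {B : Finset V} (hB : B.Nonempty) {D : Set (V → S)}
    (hD : ∀ σ ∈ D, ∀ v s, Function.update σ v s ∈ Λ.Ω → Function.update σ v s ∈ D) {σ : V → S}
    (hσ : σ ∈ Λ.Ω) (hσD : σ ∈ D) (hT : Λ.blockMixingTime B σ (1 / 4) ≤ T) :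
    Λ.agree B σ ⊆ D := by
  classical
  intro ω hω
  by_contra hωD
  have hupd : ∀ x ∈ Λ.Ω, ∀ y ∈ Λ.Ω, ∀ v, Λ.blockUpdate {v} x y ≠ 0 → x ∈ D → y ∈ D := by
    intro x _ y hy v h hx
    have : y = Function.update x v (y v) := by
      ext u
      by_cases hu : u = v
      · subst hu; simp
      · rw [Function.update_of_ne hu]
        exact (mem_agree_of_blockUpdate_ne_zero h).2 u (by simpa using hu)
    rw [this]
    exact hD x hx v (y v) (this ▸ hy)
  set g : (V → S) → ℝ := fun ω => if ω ∈ D then 1 else 0 with hg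
  have h1 : ∀ x ∈ Λ.Ω, ((Λ.glauber B).mulVec g) x = g x := by
    intro x hx
    have hK := Λ.isKernel_glauber hB
    refine (hK.mulVec_congr (g := fun _ => g x) hx fun y hy h => ?_).trans (hK.mulVec_const _ hx)
    rw [glauber_eq, average_apply] at h
    obtain ⟨v, -, h'⟩ := Finset.exists_ne_zero_of_sum_ne_zero (right_ne_zero_of_mul h)
    -- Single-site moves can be undone, so the complement of `D` in Ω is closed as well.
    refine if_congr ⟨fun h1 => hupd y hy x hx v ?_ h1, hupd x hx y hy v h'⟩ rfl rfl
    exact blockUpdate_ne_zero hy (agree_symm hx (mem_agree_of_blockUpdate_ne_zero h'))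
  have h2 : ∀ t, ∀ x ∈ Λ.Ω, ((Λ.glauber B ^ t).mulVec g) x = g x := by
    intro t
    induction t with
    | zero => simp
    | succ t ih =>
      intro x hx
      rw [pow_succ', ← Matrix.mulVec_mulVec,
        (Λ.isKernel_glauber hB).mulVec_congr hx fun y hy _ => ih y hy, h1 x hx]
  have h3 : OscLE (Λ.agree B σ) g 1 := by
    intro x _ y _
    simp only [hg]
    split_ifs <;> norm_num
  have h4 := oscLE_half_of_blockMixingTime_le hB hσ hT h3 σ (self_mem_agree hσ) ω hω
  rw [h2 T σ hσ, h2 T ω hω.1, hg] at h4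
  simp only [hσD, hωD, if_true, if_false] at h4
  norm_num at h4

/-- A set of configurations closed under single-site moves is everything. -/
theorem mem_of_closed [Nonempty ι] (hB : ∀ i, (B i).Nonempty) (hγ : 0 < γ) (hb : 0 < b)
    (hcon : Λ.IsContracting B b γ)
    (hT : ∀ i, ∀ σ ∈ Λ.Ω, Λ.blockMixingTime (B i) σ (1 / 4) ≤ T) {D : Set (V → S)}
    (hD : ∀ σ ∈ D, ∀ v s, Function.update σ v s ∈ Λ.Ω → Function.update σ v s ∈ D)
    (hne : (Λ.Ω ∩ D).Nonempty) : Λ.Ω ⊆ D := by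
  classical
  intro τ₀ hτ₀
  by_contra hτ₀D
  obtain ⟨σ₀, hσ₀, hσ₀D⟩ := hne
  -- Take a closest pair across the boundary of `D`. Block updates keep each configuration on its
  -- side, so no coupling can bring the pair closer, against strict contraction.
  obtain ⟨⟨σ, τ⟩, ⟨⟨hσ, hσD⟩, hτ, hτD⟩, hmin⟩ := Set.exists_min_image
    ((Λ.Ω ∩ D) ×ˢ (Λ.Ω \ D)) (fun p => hammingDist p.1 p.2) (Set.toFinite _)
    ⟨(σ₀, τ₀), ⟨hσ₀, hσ₀D⟩, hτ₀, hτ₀D⟩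
  dsimp only at hσ hσD hτ hτD hmin
  have h1 : ∀ i, (hammingDist σ τ : ℝ) ≤
      kantorovich (Λ.blockUpdate (B i) σ) (Λ.blockUpdate (B i) τ) := by
    intro i
    have := le_kantorovich (a := 0) (g := fun _ => (hammingDist σ τ : ℝ)) (g' := fun _ => 0)
      (blockUpdate_nonneg (Λ := Λ) (B i) σ) (blockUpdate_nonneg (Λ := Λ) (B i) τ)
      (blockUpdate_sum_eq_one (B i) hσ) (blockUpdate_sum_eq_one (B i) hτ) fun x y hx hy => by
        have hx' := mem_agree_of_blockUpdate_ne_zero hx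
        have hy' := mem_agree_of_blockUpdate_ne_zero hy
        rw [sub_zero, zero_add, Nat.cast_le]
        exact hmin (x, y) ⟨⟨hx'.1, agree_subset_of_closed (hB i) hD hσ hσD (hT i σ hσ) hx'⟩,
          hy'.1, fun h => hτD (agree_subset_of_closed (hB i) hD hy'.1 h (hT i y hy'.1)
            (agree_symm hτ hy'))⟩
    simpa [← Finset.sum_mul, blockUpdate_sum_eq_one (B i) hσ] using this
  have h2 := hcon σ hσ τ hτ
  have hι : (0 : ℝ) < Fintype.card ι := by exact_mod_cast Fintype.card_pos
  have h3 : (hammingDist σ τ : ℝ) ≤ (1 / (Fintype.card ι : ℝ)) *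
        ∑ i, kantorovich (Λ.blockUpdate (B i) σ) (Λ.blockUpdate (B i) τ) := by
    calc (hammingDist σ τ : ℝ) = (1 / (Fintype.card ι : ℝ)) * ∑ i : ι, (hammingDist σ τ : ℝ) := by
          rw [Finset.sum_const, nsmul_eq_mul, Finset.card_univ]; field_simp
      _ ≤ _ := mul_le_mul_of_nonneg_left (Finset.sum_le_sum fun i _ => h1 i) (by positivity)
  have h4 : (0 : ℝ) < hammingDist σ τ := by
    rw [Nat.cast_pos, hammingDist_pos]
    rintro rfl
    exact hτD hσD
  have h5 : (0 : ℝ) < Fintype.card V := by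
    obtain ⟨v, -⟩ := hB (Classical.arbitrary ι)
    exact_mod_cast Fintype.card_pos_iff.2 ⟨v⟩
  have h6 : 0 < γ * b / (Fintype.card V : ℝ) := by positivity
  nlinarith

/-- Each site lies in a block that is too large to move, so every singleton is closed under
single-site moves. -/
theorem subsingleton_of_card_lt [Nonempty ι] (hcover : ∀ v, ∃ i, v ∈ B i)
    (hB : ∀ i, 4 * T < (B i).card) (hγ : 0 < γ) (hb : 0 < b) (hcon : Λ.IsContracting B b γ)
    (hT : ∀ i, ∀ σ ∈ Λ.Ω, Λ.blockMixingTime (B i) σ (1 / 4) ≤ T) : Λ.Ω.Subsingleton := by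
  intro τ hτ σ hσ
  refine mem_of_closed (D := {σ}) (fun i => Finset.card_pos.1 ((Nat.zero_le _).trans_lt (hB i)))
    hγ hb hcon hT ?_ ⟨σ, hσ, rfl⟩ hτ
  rintro _ rfl v s h
  obtain ⟨i, hi⟩ := hcover v
  exact eq_of_mem_agree_of_card_lt hσ (hT i _ hσ) (hB i) ⟨h, fun u hu =>
    Function.update_of_ne (fun h' : u = v => hu (h'.symm ▸ hi)) _ _⟩

end BlockDynamics

/-! ### Existence of a top and a bottom configuration -/

section Extremes

variable {V S : Type*} [Fintype V] [DecidableEq V] [Fintype S] [LinearOrder S]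
  {Λ : SpinSystem V S}

theorem sum_update_pos {σ : V → S} (hσ : σ ∈ Λ.Ω) (v : V) :
    0 < ∑ r, Λ.π (Function.update σ v r) :=
  Finset.sum_pos' (fun _ _ => Λ.pi_nonneg _) ⟨σ v, Finset.mem_univ _, by
    rw [Function.update_eq_self]; exact Λ.pos σ hσ⟩

/-- Since `m` is maximal, its conditional law at `v` puts no mass above `m v`; by stochastic
domination the law from any `σ ≤ m` puts none there either. -/
theorem le_of_update_mem (h : Λ.IsMonotone) {σ m : V → S} (hσ : σ ∈ Λ.Ω) (hm : m ∈ Λ.Ω)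
    (hmax : ∀ τ ∈ Λ.Ω, m ≤ τ → τ = m) (hle : σ ≤ m) {v : V} {s : S}
    (hs : Function.update σ v s ∈ Λ.Ω) : Function.update σ v s ≤ m := by
  refine update_le_iff.2 ⟨?_, fun u _ => hle u⟩
  by_contra! hlt
  have h1 := h σ hσ m hm hle v (fun r => if m v < r then 1 else 0) fun a b hab => by
    dsimp only
    split_ifs with h1 h2
    · exact le_rfl
    · exact absurd (h1.trans_le hab) h2
    · exact zero_le_one
    · exact le_rfl
  rw [Finset.sum_eq_zero (s := Finset.univ) (f := fun r => (if m v < r then (1 : ℝ) else 0) *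
    (Λ.π (Function.update m v r) / ∑ r, Λ.π (Function.update m v r)))] at h1
  · refine absurd h1 (not_le.2 (Finset.sum_pos' (fun r _ => ?_) ⟨s, Finset.mem_univ _, ?_⟩))
    · exact mul_nonneg (by split_ifs <;> norm_num)
        (div_nonneg (Λ.pi_nonneg _) (sum_update_pos hσ v).le)
    · rw [if_pos hlt, one_mul]
      exact div_pos (Λ.pos _ hs) (sum_update_pos hσ v)
  · intro r _
    split_ifs with hr
    · rw [Λ.zero, zero_div, mul_zero]
      intro hr'
      have := congrFun (hmax _ hr' (le_update_iff.2 ⟨hr.le, fun _ _ => le_rfl⟩)) v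
      rw [Function.update_self] at this
      exact hr.ne this.symm
    · rw [zero_mul]

theorem le_update_of_mem (h : Λ.IsMonotone) {σ m : V → S} (hσ : σ ∈ Λ.Ω) (hm : m ∈ Λ.Ω)
    (hmin : ∀ τ ∈ Λ.Ω, τ ≤ m → τ = m) (hle : m ≤ σ) {v : V} {s : S}
    (hs : Function.update σ v s ∈ Λ.Ω) : m ≤ Function.update σ v s := by
  refine le_update_iff.2 ⟨?_, fun u _ => hle u⟩
  by_contra! hlt
  have h1 := h m hm σ hσ hle v (fun r => if r < m v then -1 else 0) fun a b hab => by
    dsimp only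
    split_ifs with h1 h2 h2
    · exact le_rfl
    · norm_num
    · exact absurd (hab.trans_lt h2) h1
    · exact le_rfl
  rw [Finset.sum_eq_zero (s := Finset.univ) (f := fun r => (if r < m v then (-1 : ℝ) else 0) *
    (Λ.π (Function.update m v r) / ∑ r, Λ.π (Function.update m v r)))] at h1
  · refine absurd h1 (not_le.2 (Finset.sum_neg' (fun r _ => ?_) ⟨s, Finset.mem_univ _, ?_⟩))
    · exact mul_nonpos_of_nonpos_of_nonneg (by split_ifs <;> norm_num)
        (div_nonneg (Λ.pi_nonneg _) (sum_update_pos hσ v).le)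
    · rw [if_pos hlt, neg_one_mul, neg_lt_zero]
      exact div_pos (Λ.pos _ hs) (sum_update_pos hσ v)
  · intro r _
    split_ifs with hr
    · rw [Λ.zero, zero_div, mul_zero]
      intro hr'
      have := congrFun (hmin _ hr' (update_le_iff.2 ⟨hr.le, fun _ _ => le_rfl⟩)) v
      rw [Function.update_self] at this
      exact hr.ne this
    · rw [zero_mul]

variable {ι : Type*} [Fintype ι] {B : ι → Finset V} {b : ℕ} {γ : ℝ} {T : ℕ}

/-- The configurations below a maximal element are closed under single-site moves, hence are all of
Ω. -/
theorem exists_top [Nonempty ι] (h : Λ.IsMonotone) (hB : ∀ i, (B i).Nonempty) (hγ : 0 < γ)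
    (hb : 0 < b) (hcon : Λ.IsContracting B b γ)
    (hT : ∀ i, ∀ σ ∈ Λ.Ω, Λ.blockMixingTime (B i) σ (1 / 4) ≤ T) :
    ∃ m ∈ Λ.Ω, ∀ σ ∈ Λ.Ω, σ ≤ m := by
  obtain ⟨m, hm⟩ := (Set.toFinite Λ.Ω).exists_maximal Λ.nonempty
  exact ⟨m, hm.1, fun σ hσ => (mem_of_closed (D := {σ | σ ∈ Λ.Ω ∧ σ ≤ m}) hB hγ hb hcon hT
    (fun τ hτ v s hs => ⟨hs, le_of_update_mem h hτ.1 hm.1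
      (fun τ hτ hle => le_antisymm (hm.2 hτ hle) hle) hτ.2 hs⟩) ⟨m, hm.1, hm.1, le_rfl⟩ hσ).2⟩

theorem exists_bot [Nonempty ι] (h : Λ.IsMonotone) (hB : ∀ i, (B i).Nonempty) (hγ : 0 < γ)
    (hb : 0 < b) (hcon : Λ.IsContracting B b γ)
    (hT : ∀ i, ∀ σ ∈ Λ.Ω, Λ.blockMixingTime (B i) σ (1 / 4) ≤ T) :
    ∃ m ∈ Λ.Ω, ∀ σ ∈ Λ.Ω, m ≤ σ := by
  obtain ⟨m, hm⟩ := (Set.toFinite Λ.Ω).exists_minimal Λ.nonempty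
  exact ⟨m, hm.1, fun σ hσ => (mem_of_closed (D := {σ | σ ∈ Λ.Ω ∧ m ≤ σ}) hB hγ hb hcon hT
    (fun τ hτ v s hs => ⟨hs, le_update_of_mem h hτ.1 hm.1
      (fun τ hτ hle => le_antisymm hle (hm.2 hτ hle)) hτ.2 hs⟩) ⟨m, hm.1, hm.1, le_rfl⟩ hσ).2⟩

end Extremes

end SpinSystem

namespace SpinSystem

/-! ### Counting discrepancies; Lipschitz extension -/

section Disagreement

variable {V S : Type*} [Fintype V] [DecidableEq V] [Fintype S] [DecidableEq S]

/-- The number of sites of `A` at which `σ` and `τ` differ. -/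
def disagreement (A : Finset V) (σ τ : V → S) : ℕ := (A.filter fun v => σ v ≠ τ v).card

theorem hammingDist_eq_disagreement (σ τ : V → S) :
    hammingDist σ τ = disagreement Finset.univ σ τ := rfl

theorem disagreement_le_card (A : Finset V) (σ τ : V → S) : disagreement A σ τ ≤ A.card :=
  Finset.card_filter_le _ _

theorem disagreement_eq_sum (A : Finset V) (σ τ : V → S) :
    disagreement A σ τ = ∑ v ∈ A, if σ v ≠ τ v then 1 else 0 :=
  Finset.card_filter _ _

theorem disagreement_sdiff_add {A B : Finset V} (h : B ⊆ A) (σ τ : V → S) :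
    disagreement (A \ B) σ τ + disagreement B σ τ = disagreement A σ τ := by
  simp only [disagreement_eq_sum]
  exact Finset.sum_sdiff h

theorem disagreement_congr {A : Finset V} {σ σ' τ τ' : V → S} (h : ∀ v ∈ A, σ v = σ' v)
    (h' : ∀ v ∈ A, τ v = τ' v) : disagreement A σ τ = disagreement A σ' τ' := by
  unfold disagreement
  congr 1
  exact Finset.filter_congr fun v hv => by rw [h v hv, h' v hv]

theorem disagreement_piecewise_of_subset {A B : Finset V} (h : B ⊆ A) (ω ω' η η' : V → S) :
    disagreement A (B.piecewise ω η) (B.piecewise ω' η') =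
      disagreement (A \ B) η η' + disagreement B ω ω' := by
  rw [← disagreement_sdiff_add h]
  congr 1
  · exact disagreement_congr
      (fun v hv => Finset.piecewise_eq_of_notMem _ _ _ (Finset.mem_sdiff.1 hv).2)
      (fun v hv => Finset.piecewise_eq_of_notMem _ _ _ (Finset.mem_sdiff.1 hv).2)
  · exact disagreement_congr (fun v hv => Finset.piecewise_eq_of_mem _ _ _ hv)
      (fun v hv => Finset.piecewise_eq_of_mem _ _ _ hv)

theorem disagreement_self (A : Finset V) (σ : V → S) : disagreement A σ σ = 0 := by
  simp [disagreement]

theorem disagreement_mono {A B : Finset V} (h : A ⊆ B) (σ τ : V → S) :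
    disagreement A σ τ ≤ disagreement B σ τ :=
  Finset.card_le_card (Finset.filter_subset_filter _ h)

/-- `F` is `1`-Lipschitz for the Hamming distance on `A`. -/
def HammingLipschitzOn (F : (V → S) → ℝ) (A : Set (V → S)) : Prop :=
  ∀ σ ∈ A, ∀ τ ∈ A, F σ - F τ ≤ hammingDist σ τ

/-- The McShane extension. It is needed because configurations glued together from blocks may fall
outside Ω. -/
theorem exists_hammingLipschitz_extension {f : (V → S) → ℝ} {A : Set (V → S)}
    (hA : A.Nonempty) (hf : HammingLipschitzOn f A) :
    ∃ F, HammingLipschitzOn F Set.univ ∧ Set.EqOn F f A := by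
  have hfin : (A.toFinite.toFinset).Nonempty := by simpa using hA
  refine ⟨fun σ => A.toFinite.toFinset.inf' hfin fun ω => f ω + (hammingDist σ ω : ℝ),
    fun σ _ τ _ => ?_, fun σ hσ => le_antisymm ?_ ?_⟩
  · obtain ⟨ω, hω, he⟩ := Finset.exists_mem_eq_inf' hfin
      fun ω => f ω + (hammingDist τ ω : ℝ)
    dsimp only
    rw [he]
    have h1 := Finset.inf'_le (fun ω => f ω + (hammingDist σ ω : ℝ)) hω
    have h2 : (hammingDist σ ω : ℝ) ≤ hammingDist σ τ + hammingDist τ ω := by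
      exact_mod_cast hammingDist_triangle σ τ ω
    linarith
  · refine (Finset.inf'_le _ (A.toFinite.mem_toFinset.2 hσ)).trans ?_
    simp
  · refine Finset.le_inf' _ _ fun ω hω => ?_
    have := hf σ hσ ω (A.toFinite.mem_toFinset.1 hω)
    linarith

end Disagreement

/-! ### Independent evolution of separated blocks -/

section Parallel

variable {V S ι : Type*} [Fintype V] [DecidableEq V] [Fintype S] [DecidableEq S]
  [DecidableEq ι] {Λ : SpinSystem V S} {G : SimpleGraph V}

/-- The exterior boundary of `B`. -/
def exteriorBoundary (G : SimpleGraph V) (B : Finset V) : Set V :=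
  {u | u ∉ B ∧ ∃ v ∈ B, G.Adj v u}

theorem IsMarkovRandomField.siteUpdate_eq (h : Λ.IsMarkovRandomField G) {σ τ : V → S}
    (hσ : σ ∈ Λ.Ω) (hτ : τ ∈ Λ.Ω) {u : V} (hu : ∀ w, G.Adj u w → σ w = τ w) (s : S) :
    Λ.blockUpdate {u} σ (Function.update σ u s) = Λ.blockUpdate {u} τ (Function.update τ u s) := by
  have := h {u} σ hσ τ hτ (fun w _ ⟨v, hv, hvw⟩ => hu w (Finset.mem_singleton.1 hv ▸ hvw))
    fun _ => s
  simpa only [Finset.piecewise_singleton] using this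

theorem IsMarkovRandomField.piecewise_mem (h : Λ.IsMarkovRandomField G) {σ η ω : V → S}
    (hσ : σ ∈ Λ.Ω) (hη : η ∈ Λ.Ω) {B : Finset V}
    (hB : ∀ u ∈ exteriorBoundary G B, η u = σ u) (hω : ω ∈ Λ.agree B σ) :
    B.piecewise ω η ∈ Λ.Ω := by
  have h1 := h B σ hσ η hη (fun u hu hv => (hB u ⟨hu, hv⟩).symm) ω
  have h2 : B.piecewise ω σ = ω := by
    ext v
    by_cases hv : v ∈ B
    · exact Finset.piecewise_eq_of_mem _ _ _ hv
    · rw [Finset.piecewise_eq_of_notMem _ _ _ hv, hω.2 v hv]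
  rw [h2] at h1
  exact (mem_agree_of_blockUpdate_ne_zero (h1 ▸ blockUpdate_ne_zero hσ hω)).1

theorem glauber_mulVec (B : Finset V) (f : (V → S) → ℝ) (η : V → S) :
    ((Λ.glauber B).mulVec f) η = 1 / (B.card : ℝ) * ∑ u ∈ B, ∑ s,
      Λ.blockUpdate {u} η (Function.update η u s) * f (Function.update η u s) := by
  rw [glauber_eq, average_mulVec]
  simp only [siteKernel_mulVec]

/-- The operator that resamples the spins in `B` from the distribution `μ`. -/
noncomputable def resample (B : Finset V) (μ : (V → S) → ℝ) : Module.End ℝ ((V → S) → ℝ) where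
  toFun F η := ∑ ω, μ ω * F (B.piecewise ω η)
  map_add' F F' := by
    ext η
    simp only [Pi.add_apply, mul_add, Finset.sum_add_distrib]
  map_smul' c F := by
    ext η
    simp only [Pi.smul_apply, smul_eq_mul, RingHom.id_apply, Finset.mul_sum]
    exact Finset.sum_congr rfl fun ω _ => by ring

theorem resample_apply (B : Finset V) (μ F : (V → S) → ℝ) (η : V → S) :
    resample B μ F η = ∑ ω, μ ω * F (B.piecewise ω η) := rfl

/-- The operator that, for every `i` in the list, independently resamples the block `B i` from
the law of `k i` steps of single-site dynamics in `B i` started from `σ`. -/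
noncomputable def parallel (Λ : SpinSystem V S) (B : ι → Finset V) (σ : V → S) (k : ι → ℕ)
    (l : List ι) : Module.End ℝ ((V → S) → ℝ) :=
  (l.map fun i => resample (B i) ((Λ.glauber (B i) ^ k i) σ)).prod

theorem parallel_cons (B : ι → Finset V) (σ : V → S) (k : ι → ℕ) (i : ι) (l : List ι)
    (F : (V → S) → ℝ) : Λ.parallel B σ k (i :: l) F =
      resample (B i) ((Λ.glauber (B i) ^ k i) σ) (Λ.parallel B σ k l F) := by
  simp [parallel]

theorem parallel_congr (B : ι → Finset V) (σ : V → S) {k k' : ι → ℕ} {l : List ι}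
    (h : ∀ i ∈ l, k i = k' i) : Λ.parallel B σ k l = Λ.parallel B σ k' l := by
  unfold parallel
  congr 1
  exact List.map_congr_left fun i hi => by rw [h i hi]

/-- Distinct blocks in the family are disjoint and not joined by an edge. -/
def Separated (G : SimpleGraph V) (B : ι → Finset V) (s : Set ι) : Prop :=
  ∀ i ∈ s, ∀ j ∈ s, i ≠ j → ∀ u ∈ B i, ∀ v ∈ B j, u ≠ v ∧ ¬ G.Adj u v

/-- `η` is a configuration that agrees with `σ` around the blocks. -/
def GoodFor (Λ : SpinSystem V S) (G : SimpleGraph V) (B : ι → Finset V) (s : Set ι)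
    (σ η : V → S) : Prop :=
  η ∈ Λ.Ω ∧ ∀ i ∈ s, ∀ u ∈ exteriorBoundary G (B i), η u = σ u

section

variable {B : ι → Finset V} {s : Set ι} {σ η : V → S}

theorem GoodFor.piecewise (h : Λ.IsMarkovRandomField G) (hs : Separated G B s) (hσ : σ ∈ Λ.Ω)
    (hη : GoodFor Λ G B s σ η) {i : ι} (hi : i ∈ s) {ω : V → S} (hω : ω ∈ Λ.agree (B i) σ) :
    GoodFor Λ G B s σ ((B i).piecewise ω η) := by
  refine ⟨h.piecewise_mem hσ hη.1 (hη.2 i hi) hω, fun j hj u hu => ?_⟩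
  have : u ∉ B i := by
    intro hui
    by_cases hij : i = j
    · exact hu.1 (hij ▸ hui)
    · obtain ⟨v, hv, hvu⟩ := hu.2
      exact (hs i hi j hj hij u hui v hv).2 hvu.symm
  rw [Finset.piecewise_eq_of_notMem _ _ _ this, hη.2 j hj u hu]

theorem resample_glauber_congr (hσ : σ ∈ Λ.Ω) {B : Finset V} {k : ℕ} {F F' : (V → S) → ℝ}
    (h : ∀ ω ∈ Λ.agree B σ, F (B.piecewise ω η) = F' (B.piecewise ω η)) :
    resample B ((Λ.glauber B ^ k) σ) F η = resample B ((Λ.glauber B ^ k) σ) F' η := by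
  refine Finset.sum_congr rfl fun ω _ => ?_
  by_cases h0 : (Λ.glauber B ^ k) σ ω = 0
  · rw [h0, zero_mul, zero_mul]
  · rw [h ω (mem_agree_of_glauber_pow_ne_zero hσ h0)]

/-- A step in block `j` reads only the block and its boundary, where the glued configuration
coincides with one reachable from `σ`. It is therefore one more step of the dynamics being sampled.
-/
theorem resample_glauber_self (h : Λ.IsMarkovRandomField G) (hs : Separated G B s) (hσ : σ ∈ Λ.Ω)
    (hη : GoodFor Λ G B s σ η) {j : ι} (hj : j ∈ s) (hB : (B j).Nonempty) (k : ℕ)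
    (F : (V → S) → ℝ) :
    resample (B j) ((Λ.glauber (B j) ^ k) σ) ((Λ.glauber (B j)).mulVec F) η =
      resample (B j) ((Λ.glauber (B j) ^ (k + 1)) σ) F η := by
  have h1 : ∀ ω ∈ Λ.agree (B j) σ, ((Λ.glauber (B j)).mulVec F) ((B j).piecewise ω η) =
      ((Λ.glauber (B j)).mulVec fun ω => F ((B j).piecewise ω η)) ω := by
    intro ω hω
    rw [glauber_mulVec, glauber_mulVec]
    congr 1
    refine Finset.sum_congr rfl fun u hu => Finset.sum_congr rfl fun r _ => ?_
    rw [Finset.update_piecewise_of_mem _ _ _ hu]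
    rw [← Finset.update_piecewise_of_mem _ _ _ hu, h.siteUpdate_eq
      (hη.piecewise h hs hσ hj hω).1 hω.1 (fun w hw => ?_) r]
    by_cases hwB : w ∈ B j
    · exact Finset.piecewise_eq_of_mem _ _ _ hwB
    · rw [Finset.piecewise_eq_of_notMem _ _ _ hwB, hη.2 j hj w ⟨hwB, u, hu, hw⟩, hω.2 w hwB]
  have h2 := (((Λ.isKernel_glauber hB).pow k).mulVec_congr
    (f := fun ω => ((Λ.glauber (B j)).mulVec F) ((B j).piecewise ω η)) hσ fun ω _ h0 =>
      h1 ω (mem_agree_of_glauber_pow_ne_zero hσ h0))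
  rw [Matrix.mulVec_mulVec, ← pow_succ] at h2
  exact h2

/-- Separation keeps block `i` away from all neighbours of sites of block `j`, so resampling the
former does not alter update laws in the latter. -/
theorem resample_glauber_comm (h : Λ.IsMarkovRandomField G) (hs : Separated G B s) (hσ : σ ∈ Λ.Ω)
    (hη : GoodFor Λ G B s σ η) {i j : ι} (hi : i ∈ s) (hj : j ∈ s) (hij : i ≠ j) (k : ℕ)
    (F : (V → S) → ℝ) :
    resample (B i) ((Λ.glauber (B i) ^ k) σ) ((Λ.glauber (B j)).mulVec F) η =
      ((Λ.glauber (B j)).mulVec (resample (B i) ((Λ.glauber (B i) ^ k) σ) F)) η := by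
  have h1 : ∀ ω, (Λ.glauber (B i) ^ k) σ ω * ((Λ.glauber (B j)).mulVec F) ((B i).piecewise ω η) =
      1 / ((B j).card : ℝ) * ∑ u ∈ B j, ∑ r, Λ.blockUpdate {u} η (Function.update η u r) *
        ((Λ.glauber (B i) ^ k) σ ω * F ((B i).piecewise ω (Function.update η u r))) := by
    intro ω
    by_cases h0 : (Λ.glauber (B i) ^ k) σ ω = 0
    · simp [h0]
    have hω := mem_agree_of_glauber_pow_ne_zero hσ h0
    rw [glauber_mulVec, mul_left_comm, Finset.mul_sum]
    congr 1
    refine Finset.sum_congr rfl fun u hu => ?_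
    rw [Finset.mul_sum]
    refine Finset.sum_congr rfl fun r _ => ?_
    have hui : u ∉ B i := fun hui => (hs i hi j hj hij u hui u hu).1 rfl
    rw [h.siteUpdate_eq (hη.piecewise h hs hσ hi hω).1 hη.1 (fun w hw => ?_) r,
      Finset.update_piecewise_of_notMem _ _ _ hui]
    · ring
    · exact Finset.piecewise_eq_of_notMem _ _ _
        fun hwi => (hs i hi j hj hij w hwi u hu).2 hw.symm
  rw [resample_apply, Finset.sum_congr rfl fun ω _ => h1 ω, ← Finset.mul_sum, glauber_mulVec]
  congr 1
  rw [Finset.sum_comm]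
  refine Finset.sum_congr rfl fun u _ => ?_
  rw [Finset.sum_comm]
  refine Finset.sum_congr rfl fun r _ => ?_
  rw [← Finset.mul_sum, resample_apply]

theorem parallel_glauber_comm (h : Λ.IsMarkovRandomField G) (hs : Separated G B s)
    (hσ : σ ∈ Λ.Ω) {j : ι} (hj : j ∈ s) (k : ι → ℕ) (F : (V → S) → ℝ) {l : List ι}
    (hl : ∀ i ∈ l, i ∈ s) (hjl : j ∉ l) (hη : GoodFor Λ G B s σ η) :
    Λ.parallel B σ k l ((Λ.glauber (B j)).mulVec F) η =
      ((Λ.glauber (B j)).mulVec (Λ.parallel B σ k l F)) η := by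
  induction l generalizing η with
  | nil => rfl
  | cons i l ih =>
    rw [List.mem_cons, not_or] at hjl
    have hi := hl i List.mem_cons_self
    rw [parallel_cons, parallel_cons, ← resample_glauber_comm h hs hσ hη hi hj (Ne.symm hjl.1)]
    exact resample_glauber_congr hσ fun ω hω => ih (fun i hi => hl i (List.mem_cons_of_mem _ hi))
      hjl.2 (hη.piecewise h hs hσ hi hω)

/-- The step passes through the other blocks and is absorbed by its own, raising that block's
counter by one. The base point `η` varies because each resampling changes it for the rest of the
list. -/
theorem parallel_glauber (h : Λ.IsMarkovRandomField G) (hs : Separated G B s)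
    (hB : ∀ i ∈ s, (B i).Nonempty)
    (hσ : σ ∈ Λ.Ω) {j : ι} (k : ι → ℕ) (F : (V → S) → ℝ) {l : List ι}
    (hl : ∀ i ∈ l, i ∈ s) (hd : l.Nodup) (hjl : j ∈ l) (hη : GoodFor Λ G B s σ η) :
    Λ.parallel B σ k l ((Λ.glauber (B j)).mulVec F) η =
      Λ.parallel B σ (Function.update k j (k j + 1)) l F η := by
  induction l generalizing η with
  | nil => simp at hjl
  | cons i l ih =>
    have hi := hl i List.mem_cons_self
    have hl' : ∀ i ∈ l, i ∈ s := fun i hi => hl i (List.mem_cons_of_mem _ hi)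
    rw [List.nodup_cons] at hd
    rw [parallel_cons, parallel_cons]
    by_cases hij : j = i
    · subst hij
      rw [Function.update_self, ← resample_glauber_self h hs hσ hη hi (hB j hi),
        ← parallel_congr B σ (k := k) fun i' hi' =>
          (Function.update_of_ne (fun h' : i' = j => hd.1 (h' ▸ hi')) _ _).symm]
      exact resample_glauber_congr hσ fun ω hω => parallel_glauber_comm h hs hσ hi k F hl' hd.1
        (hη.piecewise h hs hσ hi hω)
    · rw [Function.update_of_ne (Ne.symm hij)]
      exact resample_glauber_congr hσ fun ω hω => ih hl' hd.2
        ((List.mem_cons.1 hjl).resolve_left hij) (hη.piecewise h hs hσ hi hω)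

theorem parallel_zero (F : (V → S) → ℝ) (l : List ι) : Λ.parallel B σ 0 l F σ = F σ := by
  induction l with
  | nil => rfl
  | cons i l ih =>
    rw [parallel_cons, resample_apply, Finset.sum_eq_single σ, Pi.zero_apply, pow_zero,
      Matrix.one_apply_eq, one_mul, Finset.piecewise_same, ih]
    · intro ω _ hω
      rw [Pi.zero_apply, pow_zero, Matrix.one_apply_ne (Ne.symm hω), zero_mul]
    · simp

end

/-- Running `k` steps in `B` from `σ` and from `τ` yields laws on `B` that are at transport
distance at most `h`, in dual form. -/
def BlockGap (Λ : SpinSystem V S) (B : Finset V) (k : ℕ) (σ τ : V → S) (h : ℝ) : Prop :=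
  ∀ (a : ℝ) (g g' : (V → S) → ℝ), (∀ ω ω', (∀ v ∈ B, ω v = ω' v) → g ω = g ω') →
    (∀ ω ω', (∀ v ∈ B, ω v = ω' v) → g' ω = g' ω') →
    (∀ ω ω', g ω - g ω' ≤ B.card) → (∀ ω ω', g' ω - g' ω' ≤ B.card) →
    (∀ ω ω', g ω - g' ω' ≤ a + disagreement B ω ω') →
    ((Λ.glauber B ^ k).mulVec g) σ - ((Λ.glauber B ^ k).mulVec g') τ ≤ a + h

theorem glauber_pow_local (h : Λ.IsMarkovRandomField G) {B : Finset V} (k : ℕ)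
    {g : (V → S) → ℝ} (hg : ∀ ω ω', (∀ v ∈ B, ω v = ω' v) → g ω = g ω') {σ τ : V → S}
    (hσ : σ ∈ Λ.Ω) (hτ : τ ∈ Λ.Ω) (hB : ∀ v ∈ B, σ v = τ v)
    (hB' : ∀ v ∈ exteriorBoundary G B, σ v = τ v) :
    ((Λ.glauber B ^ k).mulVec g) σ = ((Λ.glauber B ^ k).mulVec g) τ := by
  induction k generalizing σ τ with
  | zero => simpa using hg σ τ hB
  | succ k ih =>
    rw [pow_succ', ← Matrix.mulVec_mulVec, glauber_mulVec, glauber_mulVec]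
    congr 1
    refine Finset.sum_congr rfl fun u hu => Finset.sum_congr rfl fun r _ => ?_
    have h1 : Λ.blockUpdate {u} σ (Function.update σ u r) =
        Λ.blockUpdate {u} τ (Function.update τ u r) :=
      h.siteUpdate_eq hσ hτ (fun w hw => by
        by_cases hwB : w ∈ B
        · exact hB w hwB
        · exact hB' w ⟨hwB, u, hu, hw⟩) r
    by_cases h0 : Λ.blockUpdate {u} σ (Function.update σ u r) = 0
    · rw [← h1, h0, zero_mul, zero_mul]
    · rw [← h1, ih (mem_agree_of_blockUpdate_ne_zero h0).1
        (mem_agree_of_blockUpdate_ne_zero (h1 ▸ h0)).1 (fun v hv => ?_) fun v hv => ?_]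
      · by_cases hvu : v = u
        · rw [hvu, Function.update_self, Function.update_self]
        · rw [Function.update_of_ne hvu, Function.update_of_ne hvu, hB v hv]
      · have hvu : v ≠ u := fun hvu => hv.1 (hvu ▸ hu)
        rw [Function.update_of_ne hvu, Function.update_of_ne hvu, hB' v hv]

theorem blockGap_zero (h : Λ.IsMarkovRandomField G) {B : Finset V} (hB : B.Nonempty) (k : ℕ)
    {σ τ : V → S} (hσ : σ ∈ Λ.Ω) (hτ : τ ∈ Λ.Ω) (hB1 : ∀ v ∈ B, σ v = τ v)
    (hB2 : ∀ v ∈ exteriorBoundary G B, σ v = τ v) : BlockGap Λ B k σ τ 0 := by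
  intro a g g' hg hg' _ _ hgg
  rw [← glauber_pow_local h k hg' hσ hτ hB1 hB2, ← Pi.sub_apply, ← Matrix.mulVec_sub, add_zero]
  refine ((Λ.isKernel_glauber hB).pow k).mulVec_le hσ fun ω _ _ => ?_
  have := hgg ω ω
  rwa [disagreement_self, Nat.cast_zero, add_zero] at this

theorem BlockGap.mono {B : Finset V} {k : ℕ} {σ τ : V → S} {h h' : ℝ}
    (hg : BlockGap Λ B k σ τ h) (hle : h ≤ h') : BlockGap Λ B k σ τ h' :=
  fun a g g' h1 h2 h3 h4 h5 => (hg a g g' h1 h2 h3 h4 h5).trans (by linarith)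

theorem hammingDist_eq_of_mem_agree {B : Finset V} {σ τ x y : V → S} (hx : x ∈ Λ.agree B σ)
    (hy : y ∈ Λ.agree B τ) :
    hammingDist x y = disagreement Bᶜ σ τ + disagreement B x y := by
  rw [hammingDist_eq_disagreement, ← disagreement_sdiff_add (Finset.subset_univ B),
    ← Finset.compl_eq_univ_sdiff]
  congr 1
  exact disagreement_congr (fun v hv => hx.2 v (Finset.mem_compl.1 hv))
    (fun v hv => hy.2 v (Finset.mem_compl.1 hv))

theorem disagreement_compl_le_kantorovich (B : Finset V) {σ τ : V → S} (hσ : σ ∈ Λ.Ω)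
    (hτ : τ ∈ Λ.Ω) : (disagreement Bᶜ σ τ : ℝ) ≤
      kantorovich (Λ.blockUpdate B σ) (Λ.blockUpdate B τ) := by
  have := le_kantorovich (a := 0) (g := fun _ => (disagreement Bᶜ σ τ : ℝ)) (g' := fun _ => 0)
    (blockUpdate_nonneg (Λ := Λ) B σ) (blockUpdate_nonneg (Λ := Λ) B τ)
    (blockUpdate_sum_eq_one B hσ) (blockUpdate_sum_eq_one B hτ) fun x y hx hy => by
      rw [hammingDist_eq_of_mem_agree (mem_agree_of_blockUpdate_ne_zero hx)
        (mem_agree_of_blockUpdate_ne_zero hy)]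
      push_cast
      have : (0 : ℝ) ≤ disagreement B x y := Nat.cast_nonneg _
      linarith
  simpa [← Finset.sum_mul, blockUpdate_sum_eq_one B hσ] using this

/-- Both laws are replaced by their block laws, at a cost of 2|B|θ^k each. Weak duality compares the
block laws; discrepancies off `B` survive in every coupling and are subtracted. -/
theorem blockGap_kantorovich {B : Finset V} (hB : B.Nonempty) {T : ℕ} (hT0 : 0 < T)
    (hT : ∀ σ ∈ Λ.Ω, Λ.blockMixingTime B σ (1 / 4) ≤ T) {θ : ℝ} (hθ : 0 < θ) (hθ1 : θ ≤ 1)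
    (hθT : 1 / 2 ≤ θ ^ T) (k : ℕ) {σ τ : V → S} (hσ : σ ∈ Λ.Ω) (hτ : τ ∈ Λ.Ω) :
    BlockGap Λ B k σ τ (kantorovich (Λ.blockUpdate B σ) (Λ.blockUpdate B τ) -
      disagreement Bᶜ σ τ + 4 * B.card * θ ^ k) := by
  intro a g g' _ _ hg hg' hgg
  have h1 := abs_le.1 (glauber_pow_sub_blockKernel_le hB hσ
    (oscLE_glauber_pow_of_blockMixingTime_le hB hT0 hσ (hT σ hσ) hθ hθ1 hθT k
      fun x _ y _ => hg x y))
  have h2 := abs_le.1 (glauber_pow_sub_blockKernel_le hB hτ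
    (oscLE_glauber_pow_of_blockMixingTime_le hB hT0 hτ (hT τ hτ) hθ hθ1 hθT k
      fun x _ y _ => hg' x y))
  have h3 := le_kantorovich (a := a - disagreement Bᶜ σ τ) (g := g) (g' := g')
    (blockUpdate_nonneg (Λ := Λ) B σ) (blockUpdate_nonneg (Λ := Λ) B τ)
    (blockUpdate_sum_eq_one B hσ) (blockUpdate_sum_eq_one B hτ) fun x y hx hy => by
      rw [hammingDist_eq_of_mem_agree (mem_agree_of_blockUpdate_ne_zero hx)
        (mem_agree_of_blockUpdate_ne_zero hy)]
      push_cast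
      linarith [hgg x y]
  have h4 : ((Λ.blockKernel B).mulVec g) σ - ((Λ.blockKernel B).mulVec g') τ ≤
    a - disagreement Bᶜ σ τ + kantorovich (Λ.blockUpdate B σ) (Λ.blockUpdate B τ) := h3
  linarith [h1.2, h2.1]

theorem hammingLipschitz_parallel {B : ι → Finset V} {σ : V → S} (hσ : σ ∈ Λ.Ω) (k : ι → ℕ)
    {F : (V → S) → ℝ} (hF : HammingLipschitzOn F Set.univ) {l : List ι}
    (hB : ∀ i ∈ l, (B i).Nonempty) :
    HammingLipschitzOn (Λ.parallel B σ k l F) Set.univ := by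
  induction l with
  | nil => exact hF
  | cons i l ih =>
    have ih := ih fun i hi => hB i (List.mem_cons_of_mem _ hi)
    intro η _ η' _
    have hK := (Λ.isKernel_glauber (hB i List.mem_cons_self)).pow (k i)
    rw [parallel_cons, resample_apply, resample_apply, ← Finset.sum_sub_distrib]
    calc _ ≤ ∑ ω, (Λ.glauber (B i) ^ k i) σ ω * (hammingDist η η' : ℝ) := by
          refine Finset.sum_le_sum fun ω _ => ?_
          rw [← mul_sub]
          refine mul_le_mul_of_nonneg_left ((ih _ trivial _ trivial).trans ?_) (hK.nonneg _ _)
          rw [hammingDist_eq_disagreement, hammingDist_eq_disagreement,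
            disagreement_piecewise_of_subset (Finset.subset_univ _), disagreement_self, add_zero,
            Nat.cast_le]
          exact disagreement_mono Finset.sdiff_subset _ _
      _ = _ := by rw [← Finset.sum_mul, hK.row_sum σ hσ, one_mul]

/-- Tensorization of transport cost, one block at a time. After the inner blocks are resampled from
different laws the two test functions differ, which is why `BlockGap` allows two functions and an
offset. -/
theorem parallel_sub_le {B : ι → Finset V} {σ τ : V → S} (hσ : σ ∈ Λ.Ω) (hτ : τ ∈ Λ.Ω)
    (k : ι → ℕ) {F : (V → S) → ℝ} (hF : HammingLipschitzOn F Set.univ) {h : ι → ℝ} {l : List ι}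
    (hd : l.Nodup) (hdisj : ∀ i ∈ l, ∀ j ∈ l, i ≠ j → Disjoint (B i) (B j))
    (hB : ∀ i ∈ l, (B i).Nonempty) (hgap : ∀ i ∈ l, BlockGap Λ (B i) (k i) σ τ (h i))
    (η η' : V → S) :
    Λ.parallel B σ k l F η - Λ.parallel B τ k l F η' ≤
      disagreement (Finset.univ.filter fun v => ∀ i ∈ l, v ∉ B i) η η' + (l.map h).sum := by
  induction l generalizing η η' with
  | nil => simpa [parallel, hammingDist_eq_disagreement] using hF η trivial η' trivial
  | cons i l ih =>
    rw [List.nodup_cons] at hd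
    have hmem : ∀ j ∈ l, j ∈ i :: l := fun j hj => List.mem_cons_of_mem _ hj
    have hB' : ∀ j ∈ l, (B j).Nonempty := fun j hj => hB j (hmem j hj)
    have ih := ih hd.2 (fun j hj j' hj' => hdisj j (hmem j hj) j' (hmem j' hj')) hB'
      fun j hj => hgap j (hmem j hj)
    have hLσ := hammingLipschitz_parallel hσ k hF hB'
    have hLτ := hammingLipschitz_parallel hτ k hF hB'
    set F₁ := Λ.parallel B σ k l F
    set F₂ := Λ.parallel B τ k l F
    set A := Finset.univ.filter fun v => ∀ j ∈ l, v ∉ B j with hA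
    have hsub : B i ⊆ A := fun v hv => by
      rw [hA, Finset.mem_filter]
      refine ⟨Finset.mem_univ _, fun j hj hvj => ?_⟩
      exact Finset.disjoint_left.1 (hdisj i List.mem_cons_self j (hmem j hj)
        fun h => hd.1 (h ▸ hj)) hv hvj
    have hA' : (Finset.univ.filter fun v => ∀ j ∈ i :: l, v ∉ B j) = A \ B i := by
      ext v
      simp [hA, and_comm]
    have hosc : ∀ {F : (V → S) → ℝ}, HammingLipschitzOn F Set.univ → ∀ ξ ω ω' : V → S,
        F ((B i).piecewise ω ξ) - F ((B i).piecewise ω' ξ) ≤ (B i).card := by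
      intro F hF ξ ω ω'
      refine (hF _ trivial _ trivial).trans ?_
      rw [hammingDist_eq_disagreement, disagreement_piecewise_of_subset (Finset.subset_univ _),
        disagreement_self, zero_add, Nat.cast_le]
      exact disagreement_le_card _ _ _
    have hloc : ∀ (F : (V → S) → ℝ) (ξ ω ω' : V → S), (∀ v ∈ B i, ω v = ω' v) →
        F ((B i).piecewise ω ξ) = F ((B i).piecewise ω' ξ) := fun F ξ ω ω' h =>
      congrArg F ((B i).piecewise_congr h fun _ _ => rfl)
    -- The offset holds the discrepancies outside the blocks treated so far and the budget of the
    -- other blocks.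
    have := hgap i List.mem_cons_self ((disagreement (A \ B i) η η' : ℝ) + (l.map h).sum)
      (fun ω => F₁ ((B i).piecewise ω η)) (fun ω => F₂ ((B i).piecewise ω η'))
      (hloc F₁ η) (hloc F₂ η') (hosc hLσ η) (hosc hLτ η') fun ω ω' => by
        refine (ih _ _).trans_eq ?_
        rw [disagreement_piecewise_of_subset hsub]
        push_cast
        ring
    rw [parallel_cons, parallel_cons, hA', List.map_cons, List.sum_cons]
    refine le_trans (le_of_eq ?_) (this.trans_eq (by ring))
    rfl

end Parallel

end SpinSystem

namespace SpinSystem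

/-! ### One round of censored dynamics -/

section Censored

variable {V S ι : Type*} [Fintype V] [DecidableEq V] [Fintype S] [DecidableEq S]
  [DecidableEq ι] {Λ : SpinSystem V S} {G : SimpleGraph V}

/-- Single-site dynamics on all of `V` with the updates outside `W` suppressed. -/
noncomputable def censored (Λ : SpinSystem V S) (W : Finset V) : Matrix (V → S) (V → S) ℝ :=
  (1 / ((Finset.univ : Finset V).card : ℝ)) • ∑ v, if v ∈ W then Λ.blockKernel {v} else 1

theorem isKernel_censored [Nonempty V] (W : Finset V) : Λ.IsKernel (Λ.censored W) :=
  IsKernel.average Finset.univ_nonempty fun v _ => by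
    split_ifs
    · exact Λ.isKernel_blockKernel _
    · exact IsKernel.one

theorem isReversible_censored (W : Finset V) : Λ.IsReversible (Λ.censored W) :=
  IsReversible.average fun v _ => by
    split_ifs
    · exact Λ.isReversible_blockKernel _
    · exact IsReversible.one

theorem censored_mulVec [Nonempty V] {B : ι → Finset V} {s : Finset ι} {b : ℕ}
    (hb : ∀ i ∈ s, (B i).card = b) (hb0 : 0 < b)
    (hdisj : ∀ i ∈ s, ∀ j ∈ s, i ≠ j → Disjoint (B i) (B j)) (f : (V → S) → ℝ) :
    (Λ.censored (s.biUnion B)).mulVec f =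
      ((b : ℝ) / Fintype.card V) • ∑ i ∈ s, (Λ.glauber (B i)).mulVec f +
        (1 - s.card * ((b : ℝ) / Fintype.card V)) • f := by
  have hn : (0 : ℝ) < Fintype.card V := by exact_mod_cast Fintype.card_pos
  have hb0' : (0 : ℝ) < b := by exact_mod_cast hb0
  have hcard : (s.biUnion B).card = s.card * b := by
    rw [Finset.card_biUnion hdisj, Finset.sum_congr rfl hb, Finset.sum_const, smul_eq_mul]
  have h1 : ∀ i ∈ s, ∀ η, ∑ v ∈ B i, ((Λ.blockKernel {v}).mulVec f) η =
      b * ((Λ.glauber (B i)).mulVec f) η := by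
    intro i hi η
    rw [glauber_eq, average_mulVec, hb i hi]
    field_simp
  ext η
  have h2 : ∀ v : V, ((if v ∈ s.biUnion B then Λ.blockKernel {v} else 1).mulVec f) η =
      (if v ∈ s.biUnion B then ((Λ.blockKernel {v}).mulVec f) η - f η else 0) + f η := by
    intro v
    split_ifs <;> simp
  rw [censored, average_mulVec, Finset.sum_congr rfl fun v _ => h2 v, Finset.sum_add_distrib,
    ← Finset.sum_filter, Finset.filter_mem_eq_inter, Finset.univ_inter, Finset.sum_sub_distrib,
    Finset.sum_biUnion hdisj, Finset.sum_congr rfl fun i hi => h1 i hi η, Finset.sum_const,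
    Finset.sum_const, hcard, ← Finset.mul_sum]
  simp only [Finset.card_univ, nsmul_eq_mul, Pi.add_apply, Pi.smul_apply, Finset.sum_apply,
    smul_eq_mul]
  push_cast
  field_simp
  ring

/-- The counter of a block gains one with probability p = b/|V| per step, so the expectation of θ to
its power is multiplied by 1 - p(1 - θ) each time. Induction on `m` computes this without naming the
binomial law. -/
theorem parallel_censored_pow_sub_le [Nonempty V] (h : Λ.IsMarkovRandomField G)
    {B : ι → Finset V} {s : Finset ι} (hs : Separated G B s) {b : ℕ}
    (hb : ∀ i ∈ s, (B i).card = b) (hb0 : 0 < b) {σ τ : V → S} (hσ : σ ∈ Λ.Ω) (hτ : τ ∈ Λ.Ω)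
    {F : (V → S) → ℝ} {θ base : ℝ} {a : ι → ℝ}
    (h0 : ∀ k : ι → ℕ, Λ.parallel B σ k s.toList F σ - Λ.parallel B τ k s.toList F τ ≤
      base + ∑ i ∈ s, a i * θ ^ k i) (m : ℕ) (k : ι → ℕ) :
    Λ.parallel B σ k s.toList ((Λ.censored (s.biUnion B) ^ m).mulVec F) σ -
        Λ.parallel B τ k s.toList ((Λ.censored (s.biUnion B) ^ m).mulVec F) τ ≤
      base + (1 - (b : ℝ) / Fintype.card V * (1 - θ)) ^ m * ∑ i ∈ s, a i * θ ^ k i := by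
  have hn : (0 : ℝ) < Fintype.card V := by exact_mod_cast Fintype.card_pos
  have hdisj : ∀ i ∈ s, ∀ j ∈ s, i ≠ j → Disjoint (B i) (B j) := fun i hi j hj hij =>
    Finset.disjoint_left.2 fun u hu hu' => (hs i hi j hj hij u hu u hu').1 rfl
  have hB : ∀ i ∈ (s : Set ι), (B i).Nonempty := fun i hi =>
    Finset.card_pos.1 (by rw [hb i hi]; exact hb0)
  induction m generalizing k with
  | zero => simpa using h0 k
  | succ m ih =>
    set C := Λ.censored (s.biUnion B)
    set p := (b : ℝ) / Fintype.card V with hp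
    set q := 1 - p * (1 - θ)
    have hp0 : 0 ≤ p := by positivity
    have hsp : s.card * p ≤ 1 := by
      rw [hp, ← mul_div_assoc, div_le_one hn]
      have : s.card * b ≤ Fintype.card V := by
        rw [← smul_eq_mul, ← Finset.sum_const, ← Finset.sum_congr rfl hb,
          ← Finset.card_biUnion hdisj]
        exact Finset.card_le_univ _
      exact_mod_cast this
    have hstep : ∀ ρ ∈ Λ.Ω, Λ.parallel B ρ k s.toList ((C ^ (m + 1)).mulVec F) ρ =
        p * ∑ j ∈ s, Λ.parallel B ρ (Function.update k j (k j + 1)) s.toList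
          ((C ^ m).mulVec F) ρ +
        (1 - s.card * p) * Λ.parallel B ρ k s.toList ((C ^ m).mulVec F) ρ := by
      intro ρ hρ
      rw [pow_succ', ← Matrix.mulVec_mulVec, censored_mulVec hb hb0 hdisj, map_add, map_smul,
        map_smul, map_sum, Pi.add_apply, Pi.smul_apply, Pi.smul_apply, Finset.sum_apply,
        smul_eq_mul, smul_eq_mul]
      congr 2
      exact Finset.sum_congr rfl fun j hj => parallel_glauber h hs hB hρ k _
        (fun i hi => Finset.mem_toList.1 hi) s.nodup_toList (Finset.mem_toList.2 hj)
        ⟨hρ, fun _ _ _ _ => rfl⟩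
    have hsum : ∑ j ∈ s, ∑ i ∈ s, a i * θ ^ Function.update k j (k j + 1) i =
        (s.card - (1 - θ)) * ∑ i ∈ s, a i * θ ^ k i := by
      rw [Finset.sum_comm, Finset.mul_sum]
      refine Finset.sum_congr rfl fun i hi => ?_
      have : ∀ j ∈ s, a i * θ ^ Function.update k j (k j + 1) i =
          a i * θ ^ k i - if i = j then (1 - θ) * (a i * θ ^ k i) else 0 := by
        intro j _
        split_ifs with hij
        · rw [← hij, Function.update_self, pow_succ]; ring
        · rw [Function.update_of_ne hij, sub_zero]
      rw [Finset.sum_congr rfl this, Finset.sum_sub_distrib, Finset.sum_const,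
        Finset.sum_ite_eq, if_pos hi, nsmul_eq_mul]
      ring
    rw [hstep σ hσ, hstep τ hτ]
    have h1 : ∑ j ∈ s, (Λ.parallel B σ (Function.update k j (k j + 1)) s.toList
          ((C ^ m).mulVec F) σ - Λ.parallel B τ (Function.update k j (k j + 1)) s.toList
          ((C ^ m).mulVec F) τ) ≤
        ∑ j ∈ s, (base + q ^ m * ∑ i ∈ s, a i * θ ^ Function.update k j (k j + 1) i) :=
      Finset.sum_le_sum fun j _ => ih _
    rw [Finset.sum_sub_distrib, Finset.sum_add_distrib, ← Finset.mul_sum, hsum, Finset.sum_const,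
      nsmul_eq_mul] at h1
    have h2 := mul_le_mul_of_nonneg_left h1 hp0
    have h3 := mul_le_mul_of_nonneg_left (ih k) (sub_nonneg.2 hsp)
    calc _ = p * (∑ j ∈ s, Λ.parallel B σ (Function.update k j (k j + 1)) s.toList
              ((C ^ m).mulVec F) σ - ∑ j ∈ s, Λ.parallel B τ (Function.update k j (k j + 1))
              s.toList ((C ^ m).mulVec F) τ) +
            (1 - s.card * p) * (Λ.parallel B σ k s.toList ((C ^ m).mulVec F) σ -
              Λ.parallel B τ k s.toList ((C ^ m).mulVec F) τ) := by ring
      _ ≤ _ := add_le_add h2 h3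
      _ = _ := by
        simp only [q, pow_succ]
        ring

/-- `σ` and `τ` disagree somewhere in or next to the block `B`. -/
def Affects (G : SimpleGraph V) (B : Finset V) (σ τ : V → S) : Prop :=
  ∃ u, σ u ≠ τ u ∧ (u ∈ B ∨ u ∈ exteriorBoundary G B)

open Classical in
/-- One round of censored dynamics moves the expected number of discrepancies by at most what
the updates of the separate blocks do, up to an exponentially small error for each block that
sees a discrepancy. -/
theorem censored_pow_sub_le [Nonempty V] (h : Λ.IsMarkovRandomField G)
    {B : ι → Finset V} {s : Finset ι} (hs : Separated G B s) {b : ℕ}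
    (hb : ∀ i ∈ s, (B i).card = b) (hb0 : 0 < b) {T : ℕ} (hT0 : 0 < T)
    (hT : ∀ i ∈ s, ∀ σ ∈ Λ.Ω, Λ.blockMixingTime (B i) σ (1 / 4) ≤ T) {θ : ℝ} (hθ : 0 < θ)
    (hθ1 : θ ≤ 1) (hθT : 1 / 2 ≤ θ ^ T) {σ τ : V → S} (hσ : σ ∈ Λ.Ω) (hτ : τ ∈ Λ.Ω)
    {F : (V → S) → ℝ} (hF : HammingLipschitzOn F Λ.Ω) (m : ℕ) :
    ((Λ.censored (s.biUnion B) ^ m).mulVec F) σ - ((Λ.censored (s.biUnion B) ^ m).mulVec F) τ ≤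
      hammingDist σ τ + ∑ i ∈ s, (kantorovich (Λ.blockUpdate (B i) σ) (Λ.blockUpdate (B i) τ) -
        hammingDist σ τ) + 4 * b * (1 - (b : ℝ) / Fintype.card V * (1 - θ)) ^ m *
          (s.filter fun i => Affects G (B i) σ τ).card := by
  obtain ⟨F', hF', hFF'⟩ := exists_hammingLipschitz_extension Λ.nonempty hF
  have hK := (isKernel_censored (Λ := Λ) (s.biUnion B)).pow m
  rw [← hK.mulVec_congr hσ fun ω hω _ => hFF' hω, ← hK.mulVec_congr hτ fun ω hω _ => hFF' hω]
  have hdisj : ∀ i ∈ s, ∀ j ∈ s, i ≠ j → Disjoint (B i) (B j) := fun i hi j hj hij =>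
    Finset.disjoint_left.2 fun u hu hu' => (hs i hi j hj hij u hu u hu').1 rfl
  have hB : ∀ i ∈ s, (B i).Nonempty := fun i hi =>
    Finset.card_pos.1 (by rw [hb i hi]; exact hb0)
  have hmem : ∀ i, i ∈ s.toList ↔ i ∈ s := fun i => Finset.mem_toList
  set ρ : ι → ℝ := fun i => kantorovich (Λ.blockUpdate (B i) σ) (Λ.blockUpdate (B i) τ) -
    disagreement (B i)ᶜ σ τ with hρ
  set A := Finset.univ.filter fun v => ∀ i ∈ s, v ∉ B i with hA
  set a : ι → ℝ := fun i => if Affects G (B i) σ τ then 4 * (b : ℝ) else 0 with ha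
  -- The blocks are disjoint, so the transport costs of separate block updates add up relative to
  -- the common starting distance.
  have hbase : (disagreement A σ τ : ℝ) + ∑ i ∈ s, ρ i = hammingDist σ τ + ∑ i ∈ s,
      (kantorovich (Λ.blockUpdate (B i) σ) (Λ.blockUpdate (B i) τ) - hammingDist σ τ) := by
    have h1 : ∀ i, (hammingDist σ τ : ℝ) = disagreement (B i)ᶜ σ τ + disagreement (B i) σ τ := by
      intro i
      exact_mod_cast hammingDist_eq_of_mem_agree (self_mem_agree hσ) (self_mem_agree hτ)
    have h2 : A = Finset.univ \ s.biUnion B := by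
      ext v
      simp [hA]
    have h3 : disagreement (s.biUnion B) σ τ = ∑ i ∈ s, disagreement (B i) σ τ := by
      simp only [disagreement_eq_sum]
      exact Finset.sum_biUnion hdisj
    have h4 : (hammingDist σ τ : ℝ) =
        disagreement A σ τ + ∑ i ∈ s, (disagreement (B i) σ τ : ℝ) := by
      rw [hammingDist_eq_disagreement, ← disagreement_sdiff_add (Finset.subset_univ (s.biUnion B)),
        ← h2, h3]
      push_cast
      rfl
    have h5 : ∑ i ∈ s, (kantorovich (Λ.blockUpdate (B i) σ) (Λ.blockUpdate (B i) τ) -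
        hammingDist σ τ) = ∑ i ∈ s, ρ i - ∑ i ∈ s, (disagreement (B i) σ τ : ℝ) := by
      rw [← Finset.sum_sub_distrib]
      refine Finset.sum_congr rfl fun i _ => ?_
      rw [h1 i, hρ]
      ring
    linarith
  have hgap : ∀ k : ι → ℕ, ∀ i ∈ s, BlockGap Λ (B i) (k i) σ τ (ρ i + a i * θ ^ k i) := by
    intro k i hi
    -- A block that sees no discrepancy has the same law from both starts and pays no mixing error;
    -- this makes the total error proportional to the Hamming distance.
    by_cases haff : Affects G (B i) σ τ
    · have := blockGap_kantorovich (hB i hi) hT0 (hT i hi) hθ hθ1 hθT (k i) hσ hτ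
      rw [hb i hi] at this
      simpa [ha, hρ, haff] using this
    · have h1 : ∀ u, u ∈ B i ∨ u ∈ exteriorBoundary G (B i) → σ u = τ u := fun u hu => by
        by_contra hne
        exact haff ⟨u, hne, hu⟩
      refine (blockGap_zero h (hB i hi) (k i) hσ hτ (fun v hv => h1 v (Or.inl hv))
        fun v hv => h1 v (Or.inr hv)).mono ?_
      simp only [ha, if_neg haff, zero_mul, add_zero, hρ, sub_nonneg]
      exact disagreement_compl_le_kantorovich _ hσ hτ
  have h0 : ∀ k : ι → ℕ, Λ.parallel B σ k s.toList F' σ - Λ.parallel B τ k s.toList F' τ ≤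
      (disagreement A σ τ + ∑ i ∈ s, ρ i) + ∑ i ∈ s, a i * θ ^ k i := by
    intro k
    refine (parallel_sub_le hσ hτ k hF' s.nodup_toList
      (fun i hi j hj => hdisj i ((hmem i).1 hi) j ((hmem j).1 hj))
      (fun i hi => hB i ((hmem i).1 hi)) (fun i hi => hgap k i ((hmem i).1 hi)) σ τ).trans_eq ?_
    rw [Finset.sum_map_toList, Finset.sum_add_distrib, ← add_assoc]
    simp only [hmem, hA]
  -- With all counters at zero, `parallel` is evaluation at the starting configuration.
  have := parallel_censored_pow_sub_le h hs hb hb0 hσ hτ h0 m 0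
  rw [parallel_zero, parallel_zero, hbase] at this
  refine this.trans_eq ?_
  congr 1
  simp only [Pi.zero_apply, pow_zero, mul_one, ha]
  rw [← Finset.sum_filter, Finset.sum_const, nsmul_eq_mul]
  ring

end Censored

end SpinSystem

namespace SpinSystem

/-! ### Contraction for a random translate of the blocks -/

section Contraction

variable {V S : Type*} [Fintype V] [DecidableEq V] [Fintype S] [DecidableEq S]
  {Λ : SpinSystem V S} {G : SimpleGraph V}

theorem hammingLipschitzOn_of_zero_one {g : (V → S) → ℝ} (hg : ∀ σ, g σ = 0 ∨ g σ = 1)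
    (A : Set (V → S)) : HammingLipschitzOn g A := by
  intro σ _ τ _
  by_cases h : σ = τ
  · simp [h]
  · have h1 : (1 : ℝ) ≤ hammingDist σ τ := by
      exact_mod_cast Nat.one_le_iff_ne_zero.2 (hammingDist_ne_zero.2 h)
    rcases hg σ with h2 | h2 <;> rcases hg τ with h3 | h3 <;> rw [h2, h3] <;> linarith

/-- Dividing `R ^ k F` by `c ^ k` gives a 1-Lipschitz function again, to which the one-step bound
applies. -/
theorem pow_contraction {R : Matrix (V → S) (V → S) ℝ} {c : ℝ} (hc : 0 < c)
    (hR : ∀ F, HammingLipschitzOn F Λ.Ω → ∀ σ ∈ Λ.Ω, ∀ τ ∈ Λ.Ω,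
      (R.mulVec F) σ - (R.mulVec F) τ ≤ c * hammingDist σ τ) (k : ℕ) {F : (V → S) → ℝ}
    (hF : HammingLipschitzOn F Λ.Ω) : ∀ σ ∈ Λ.Ω, ∀ τ ∈ Λ.Ω,
      ((R ^ k).mulVec F) σ - ((R ^ k).mulVec F) τ ≤ c ^ k * hammingDist σ τ := by
  induction k with
  | zero =>
    intro σ hσ τ hτ
    simpa using hF σ hσ τ hτ
  | succ k ih =>
    have hck : 0 < c ^ k := pow_pos hc k
    have h1 : HammingLipschitzOn ((c ^ k)⁻¹ • (R ^ k).mulVec F) Λ.Ω := by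
      intro σ hσ τ hτ
      rw [Pi.smul_apply, Pi.smul_apply, smul_eq_mul, smul_eq_mul, ← mul_sub, inv_mul_le_iff₀ hck]
      exact ih σ hσ τ hτ
    intro σ hσ τ hτ
    have h2 := hR _ h1 σ hσ τ hτ
    rw [Matrix.mulVec_smul, Matrix.mulVec_mulVec, ← pow_succ', Pi.smul_apply, Pi.smul_apply,
      smul_eq_mul, smul_eq_mul, ← mul_sub, inv_mul_le_iff₀ hck] at h2
    rw [pow_succ c, mul_assoc]
    exact h2

theorem pow_mulVec_sub_le {R : Matrix (V → S) (V → S) ℝ} {c : ℝ} (hc : 0 < c)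
    (hR : ∀ F, HammingLipschitzOn F Λ.Ω → ∀ σ ∈ Λ.Ω, ∀ τ ∈ Λ.Ω,
      (R.mulVec F) σ - (R.mulVec F) τ ≤ c * hammingDist σ τ) (k : ℕ) (g : (V → S) → ℝ)
    (hg : ∀ σ, g σ = 0 ∨ g σ = 1) : ∀ σ ∈ Λ.Ω, ∀ τ ∈ Λ.Ω,
      ((R ^ k).mulVec g) σ - ((R ^ k).mulVec g) τ ≤ c ^ k * Fintype.card V := by
  intro σ hσ τ hτ
  refine (pow_contraction hc hR k (hammingLipschitzOn_of_zero_one hg _) σ hσ τ hτ).trans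
    (mul_le_mul_of_nonneg_left ?_ (pow_pos hc k).le)
  exact_mod_cast hammingDist_le_card_fintype

theorem glauber_contraction [Nonempty V] {γ : ℝ}
    (hcon : Λ.IsContracting (fun v : V => {v}) 1 γ) {F : (V → S) → ℝ}
    (hF : HammingLipschitzOn F Λ.Ω) {σ τ : V → S} (hσ : σ ∈ Λ.Ω) (hτ : τ ∈ Λ.Ω) :
    ((Λ.glauber Finset.univ).mulVec F) σ - ((Λ.glauber Finset.univ).mulVec F) τ ≤
      Real.exp (-(γ / Fintype.card V)) * hammingDist σ τ := by
  rw [glauber_eq, average_mulVec, average_mulVec, ← mul_sub, ← Finset.sum_sub_distrib,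
    Finset.card_univ]
  calc _ ≤ 1 / (Fintype.card V : ℝ) *
        ∑ v : V, kantorovich (Λ.blockUpdate {v} σ) (Λ.blockUpdate {v} τ) := by
        refine mul_le_mul_of_nonneg_left (Finset.sum_le_sum fun v _ => ?_) (by positivity)
        rw [← zero_add (kantorovich _ _)]
        refine le_kantorovich (blockUpdate_nonneg _ σ) (blockUpdate_nonneg _ τ)
          (blockUpdate_sum_eq_one _ hσ) (blockUpdate_sum_eq_one _ hτ) fun x y hx hy => ?_
        rw [zero_add]
        exact hF x (mem_agree_of_blockUpdate_ne_zero hx).1 y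
          (mem_agree_of_blockUpdate_ne_zero hy).1
    _ ≤ _ := hcon σ hσ τ hτ
    _ ≤ _ := by
        refine mul_le_mul_of_nonneg_right ?_ (Nat.cast_nonneg _)
        have := Real.add_one_le_exp (-(γ / Fintype.card V))
        rw [Nat.cast_one, mul_one]
        linarith

theorem sum_sum_add {V : Type*} [Fintype V] [AddCommGroup V] (Γ : Finset V) (φ : V → ℝ) :
    ∑ x, ∑ z ∈ Γ, φ (x + z) = Γ.card * ∑ v, φ v := by
  rw [Finset.sum_comm, ← nsmul_eq_mul, ← Finset.sum_const]
  exact Finset.sum_congr rfl fun z _ => Equiv.sum_comp (Equiv.addRight z) φ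

variable [AddCommGroup V]

/-- Censored dynamics in the blocks of a uniformly random translate of a family. -/
noncomputable def translateAverage (Λ : SpinSystem V S) (B : V → Finset V) (Γ : Finset V)
    (m : ℕ) : Matrix (V → S) (V → S) ℝ :=
  (1 / ((Finset.univ : Finset V).card : ℝ)) •
    ∑ x : V, Λ.censored ((Γ.map (addLeftEmbedding x)).biUnion B) ^ m

theorem isKernel_translateAverage (B : V → Finset V) (Γ : Finset V) (m : ℕ) :
    Λ.IsKernel (Λ.translateAverage B Γ m) :=
  IsKernel.average ⟨0, Finset.mem_univ _⟩ fun _ _ => (isKernel_censored _).pow m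

theorem isReversible_translateAverage (B : V → Finset V) (Γ : Finset V) (m : ℕ) :
    Λ.IsReversible (Λ.translateAverage B Γ m) :=
  IsReversible.average fun _ _ => (isReversible_censored _).pow m

theorem card_affects_le {B : V → Finset V} {D : ℕ} {σ τ : V → S}
    [DecidablePred fun v => Affects G (B v) σ τ]
    (hD : ∀ (u : V) (A : Finset V), (∀ v ∈ A, u ∈ B v ∨ u ∈ exteriorBoundary G (B v)) →
      A.card ≤ D) :
    (Finset.univ.filter fun v => Affects G (B v) σ τ).card ≤ hammingDist σ τ * D := by
  classical
  have h1 : (Finset.univ.filter fun v => Affects G (B v) σ τ) ⊆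
      (Finset.univ.filter fun u => σ u ≠ τ u).biUnion fun u =>
        Finset.univ.filter fun v => u ∈ B v ∨ u ∈ exteriorBoundary G (B v) := by
    intro v hv
    obtain ⟨u, hu, huv⟩ := (Finset.mem_filter.1 hv).2
    simp only [Finset.mem_biUnion, Finset.mem_filter, Finset.mem_univ, true_and]
    exact ⟨u, hu, huv⟩
  refine (Finset.card_le_card h1).trans (Finset.card_biUnion_le_card_mul _ _ _ fun u _ => ?_)
  exact hD u _ fun v hv => (Finset.mem_filter.1 hv).2

theorem translateAverage_contraction (h : Λ.IsMarkovRandomField G) {B : V → Finset V}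
    {Γ : Finset V}
    (hs : ∀ x, Separated G B (Γ.map (addLeftEmbedding x) : Finset V)) {b : ℕ}
    (hb : ∀ v, (B v).card = b) (hb0 : 0 < b) {γ : ℝ} (hγ : 0 < γ)
    (hcon : Λ.IsContracting B b γ) {T : ℕ} (hT0 : 0 < T)
    (hT : ∀ v, ∀ σ ∈ Λ.Ω, Λ.blockMixingTime (B v) σ (1 / 4) ≤ T) {D : ℕ}
    (hD : ∀ (u : V) (A : Finset V), (∀ v ∈ A, u ∈ B v ∨ u ∈ exteriorBoundary G (B v)) →
      A.card ≤ D) {c : ℕ} (hc : 0 < c) (hΓ : Fintype.card V ≤ Γ.card * c) {K : ℕ}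
    (hK : 8 * D * Real.exp (-(b * K / (2 * T))) ≤ γ) {F : (V → S) → ℝ}
    (hF : HammingLipschitzOn F Λ.Ω) {σ τ : V → S} (hσ : σ ∈ Λ.Ω) (hτ : τ ∈ Λ.Ω) :
    ((Λ.translateAverage B Γ (K * Fintype.card V)).mulVec F) σ -
        ((Λ.translateAverage B Γ (K * Fintype.card V)).mulVec F) τ ≤
      Real.exp (-(γ * b / (2 * c))) * hammingDist σ τ := by
  classical
  have hn : (0 : ℝ) < Fintype.card V := by exact_mod_cast Fintype.card_pos
  have hT0' : (1 : ℝ) ≤ T := by exact_mod_cast hT0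
  have hbR : (0 : ℝ) < b := by exact_mod_cast hb0
  have hcR : (0 : ℝ) < c := by exact_mod_cast hc
  set n : ℝ := (Fintype.card V : ℝ) with hn_def
  set H : ℝ := (hammingDist σ τ : ℝ) with hH
  have hH0 : 0 ≤ H := Nat.cast_nonneg _
  -- Bernoulli's inequality gives θ^T ≥ 1/2, as the oscillation bound requires.
  set θ : ℝ := 1 - 1 / (2 * T) with hθ_def
  have hT2 : 1 / (2 * (T : ℝ)) ≤ 1 / 2 := by
    rw [div_le_div_iff₀ (by positivity) (by norm_num)]
    linarith
  have hT2' : 0 < 1 / (2 * (T : ℝ)) := by positivity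
  have hθT : 1 / 2 ≤ θ ^ T := by
    have := one_add_mul_le_pow (a := -(1 / (2 * (T : ℝ)))) (by linarith) T
    rw [← sub_eq_add_neg] at this
    refine le_trans (le_of_eq ?_) this
    field_simp
    norm_num
  set q : ℝ := (1 - b / n * (1 - θ)) ^ (K * Fintype.card V) with hq_def
  -- Then the mixing error 4bqDH is at most γbH/2, half of what contraction gains.
  have hq : 8 * D * q ≤ γ := by
    refine le_trans (mul_le_mul_of_nonneg_left ?_ (by positivity)) hK
    have hbn : b / n ≤ 1 := by
      rw [div_le_one hn, ← hb 0, hn_def, Nat.cast_le]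
      exact Finset.card_le_univ _
    have h1 : b / n * (1 - θ) ≤ 1 := by
      have : 1 - θ ≤ 1 := by rw [hθ_def]; linarith
      exact mul_le_one₀ hbn (by rw [hθ_def]; linarith) this
    calc q ≤ Real.exp (-(b / n * (1 - θ))) ^ (K * Fintype.card V) := by
          refine pow_le_pow_left₀ (by linarith) ?_ _
          have := Real.add_one_le_exp (-(b / n * (1 - θ)))
          linarith
      _ = _ := by
          rw [← Real.exp_nat_mul]
          congr 1
          rw [hθ_def]
          push_cast
          rw [← hn_def]
          field_simp
          ring
  set ψ : V → ℝ := fun v =>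
    kantorovich (Λ.blockUpdate (B v) σ) (Λ.blockUpdate (B v) τ) - H with hψ
  have hψs : ∑ v, ψ v ≤ -(γ * b * H) := by
    have := hcon σ hσ τ hτ
    rw [hψ, Finset.sum_sub_distrib, Finset.sum_const, Finset.card_univ, nsmul_eq_mul, ← hn_def]
    rw [← hn_def, ← hH, one_div, inv_mul_le_iff₀ hn] at this
    have h1 : n * ((1 - γ * b / n) * H) = n * H - γ * b * H := by field_simp
    linarith
  have hround : ∀ x : V,
      ((Λ.censored ((Γ.map (addLeftEmbedding x)).biUnion B) ^ (K * Fintype.card V)).mulVec F) σ -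
      ((Λ.censored ((Γ.map (addLeftEmbedding x)).biUnion B) ^ (K * Fintype.card V)).mulVec F) τ ≤
      H + ∑ z ∈ Γ, (ψ (x + z) + 4 * b * q * if Affects G (B (x + z)) σ τ then 1 else 0) := by
    intro x
    refine (censored_pow_sub_le h (hs x) (fun i _ => hb i) hb0 hT0 (fun i _ => hT i)
      (θ := θ) (by rw [hθ_def]; linarith) (by rw [hθ_def]; linarith) hθT hσ hτ hF _).trans_eq ?_
    rw [Finset.sum_map, Finset.card_filter, Finset.sum_map, Finset.sum_add_distrib,
      ← Finset.mul_sum, ← add_assoc]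
    push_cast
    rfl
  have haff : ∑ v, (if Affects G (B v) σ τ then (1 : ℝ) else 0) ≤ H * D := by
    rw [Finset.sum_boole, hH]
    exact_mod_cast card_affects_le hD
  rw [translateAverage, average_mulVec, average_mulVec, ← mul_sub, ← Finset.sum_sub_distrib,
    Finset.card_univ, ← hn_def]
  have hq0 : 0 ≤ q := by
    have hbn : b / n ≤ 1 := by
      rw [div_le_one hn, ← hb 0, hn_def, Nat.cast_le]
      exact Finset.card_le_univ _
    have h1 : b / n * (1 - θ) ≤ 1 :=
      mul_le_one₀ hbn (by rw [hθ_def]; linarith) (by rw [hθ_def]; linarith)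
    exact pow_nonneg (by linarith) _
  -- A given block occurs in a uniformly random translate with probability |Γ|/n.
  have hΓ' : 1 / c ≤ Γ.card / n := by
    rw [div_le_div_iff₀ hcR hn, one_mul, hn_def]
    exact_mod_cast hΓ
  calc _ ≤ 1 / n * ∑ x : V, (H + ∑ z ∈ Γ,
        (ψ (x + z) + 4 * b * q * if Affects G (B (x + z)) σ τ then 1 else 0)) :=
        mul_le_mul_of_nonneg_left (Finset.sum_le_sum fun x _ => hround x) (by positivity)
    _ = H + Γ.card / n * (∑ v, ψ v +
        4 * b * q * ∑ v, if Affects G (B v) σ τ then (1 : ℝ) else 0) := by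
        rw [Finset.sum_add_distrib, sum_sum_add Γ fun v =>
          ψ v + 4 * b * q * if Affects G (B v) σ τ then 1 else 0, Finset.sum_const,
          Finset.card_univ, nsmul_eq_mul, ← hn_def, Finset.sum_add_distrib, ← Finset.mul_sum]
        field_simp
    _ ≤ H + Γ.card / n * (-(γ * b * H) + 4 * b * q * (H * D)) := by
        gcongr
    _ ≤ H + Γ.card / n * (-(γ * b / 2 * H)) := by
        gcongr
        have := mul_le_mul_of_nonneg_left hq (show 0 ≤ b * H / 2 by positivity)
        linarith
    _ ≤ H + 1 / c * (-(γ * b / 2 * H)) := by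
        have := mul_le_mul_of_nonneg_right hΓ' (show 0 ≤ γ * b / 2 * H by positivity)
        linarith
    _ = (-(γ * b / (2 * c)) + 1) * H := by field_simp; ring
    _ ≤ _ := mul_le_mul_of_nonneg_right (Real.add_one_le_exp _) hH0

end Contraction

/-! ### From censored rounds to single-site dynamics -/

section Decay

variable {V S : Type*} [Fintype V] [DecidableEq V] [Fintype S] [LinearOrder S]
  {Λ : SpinSystem V S} {G : SimpleGraph V}

theorem preservesMonotone_glauber (h : Λ.IsMonotone) (A : Finset V) :
    Λ.PreservesMonotone (Λ.glauber A) := by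
  rw [glauber_eq]
  exact PreservesMonotone.average (by positivity) fun v _ => preservesMonotone_siteKernel h v

theorem preservesMonotone_censored (h : Λ.IsMonotone) (W : Finset V) :
    Λ.PreservesMonotone (Λ.censored W) :=
  PreservesMonotone.average (by positivity) fun v _ => by
    split_ifs
    · exact preservesMonotone_siteKernel h v
    · exact PreservesMonotone.one

theorem glauber_censorLE_censored (Λ : SpinSystem V S) (W : Finset V) :
    Λ.CensorLE (Λ.glauber Finset.univ) (Λ.censored W) := by
  rw [glauber_eq]
  refine CensorLE.average (by positivity) fun v _ => ?_
  split_ifs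
  · exact CensorLE.refl _
  · exact censorLE_siteKernel Λ v

/-- The configuration `m` is the top or the bottom of `Ω`. -/
def IsExtreme (Λ : SpinSystem V S) (m : V → S) : Prop :=
  m ∈ Λ.Ω ∧ ((∀ σ ∈ Λ.Ω, σ ≤ m) ∨ ∀ σ ∈ Λ.Ω, m ≤ σ)

/-- For blocks of one site the chain itself contracts, so it is compared with itself. The factor 1
gives the bound the same shape as that for larger blocks. -/
theorem tvDist_glauber_pow_le_of_singleton [Nonempty V] (hmon : Λ.IsMonotone) {γ : ℝ}
    (hcon : Λ.IsContracting (fun v : V => {v}) 1 γ) {m : V → S} (hm : Λ.IsExtreme m) (k : ℕ) :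
    tvDist ((Λ.glauber Finset.univ ^ (1 * Fintype.card V * k)) m) Λ.π ≤
      Real.exp (-γ) ^ k * Fintype.card V := by
  have hn : (Fintype.card V : ℝ) ≠ 0 := by exact_mod_cast Fintype.card_ne_zero
  have hK := (Λ.isKernel_glauber Finset.univ_nonempty).pow (1 * Fintype.card V * k)
  have hR := (Λ.isReversible_glauber Finset.univ).pow (1 * Fintype.card V * k)
  refine tvDist_le_of_censorLE hK hR ((preservesMonotone_glauber hmon _).pow _) hK hR
    (CensorLE.refl _) hm.1 hm.2 fun g hg σ hσ τ hτ => ?_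
  refine (pow_mulVec_sub_le (Real.exp_pos _) (fun F hF σ hσ τ hτ =>
    glauber_contraction hcon hF hσ hτ) _ g hg σ hσ τ hτ).trans_eq ?_
  rw [← Real.exp_nat_mul, ← Real.exp_nat_mul]
  congr 2
  push_cast
  field_simp

/-- A round of uncensored steps lies below the censored round of every translate, hence below their
average; rounds are then composed. -/
theorem tvDist_glauber_pow_le [AddCommGroup V] (hmon : Λ.IsMonotone)
    (h : Λ.IsMarkovRandomField G) {B : V → Finset V} {Γ : Finset V}
    (hs : ∀ x, Separated G B (Γ.map (addLeftEmbedding x) : Finset V)) {b : ℕ}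
    (hb : ∀ v, (B v).card = b) (hb0 : 0 < b) {γ : ℝ} (hγ : 0 < γ)
    (hcon : Λ.IsContracting B b γ) {T : ℕ} (hT0 : 0 < T)
    (hT : ∀ v, ∀ σ ∈ Λ.Ω, Λ.blockMixingTime (B v) σ (1 / 4) ≤ T) {D : ℕ}
    (hD : ∀ (u : V) (A : Finset V), (∀ v ∈ A, u ∈ B v ∨ u ∈ exteriorBoundary G (B v)) →
      A.card ≤ D) {c : ℕ} (hc : 0 < c) (hΓ : Fintype.card V ≤ Γ.card * c) {K : ℕ}
    (hK : 8 * D * Real.exp (-(b * K / (2 * T))) ≤ γ) {m : V → S} (hm : Λ.IsExtreme m) (k : ℕ) :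
    tvDist ((Λ.glauber Finset.univ ^ (K * Fintype.card V * k)) m) Λ.π ≤
      Real.exp (-(γ * b / (2 * c))) ^ k * Fintype.card V := by
  have hne : (Finset.univ : Finset V).Nonempty := ⟨0, Finset.mem_univ _⟩
  have hP := preservesMonotone_glauber hmon Finset.univ
  have hPr := Λ.isReversible_glauber Finset.univ
  set M := K * Fintype.card V with hM
  have hcens : Λ.CensorLE (Λ.glauber Finset.univ ^ M) (Λ.translateAverage B Γ M) := by
    have : Λ.glauber Finset.univ ^ M = (1 / ((Finset.univ : Finset V).card : ℝ)) •
        ∑ x : V, Λ.glauber Finset.univ ^ M := by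
      rw [Finset.sum_const, ← Nat.cast_smul_eq_nsmul ℝ, smul_smul, one_div,
        inv_mul_cancel₀ (by exact_mod_cast hne.card_ne_zero), one_smul]
    rw [this]
    exact CensorLE.average (by positivity) fun x _ =>
      (glauber_censorLE_censored Λ _).pow hPr hP (preservesMonotone_censored hmon _) M
  have hR : Λ.PreservesMonotone (Λ.translateAverage B Γ M) :=
    PreservesMonotone.average (by positivity) fun x _ => (preservesMonotone_censored hmon _).pow M
  have hle : Λ.CensorLE (Λ.glauber Finset.univ ^ (M * k)) (Λ.translateAverage B Γ M ^ k) := by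
    rw [pow_mul]
    exact hcens.pow (hPr.pow M) (hP.pow M) hR k
  exact tvDist_le_of_censorLE ((Λ.isKernel_glauber hne).pow _) (hPr.pow _) (hP.pow _)
    ((isKernel_translateAverage B Γ M).pow k) ((isReversible_translateAverage B Γ M).pow k) hle
    hm.1 hm.2 (pow_mulVec_sub_le (Real.exp_pos _) (fun F hF σ hσ τ hτ =>
      translateAverage_contraction h hs hb hb0 hγ hcon hT0 hT hD hc hΓ hK hF hσ hτ) k)

/-- Total variation from an arbitrary start, in terms of the two extreme starts. -/
theorem tvDist_le_of_extremes [Nonempty V] {M : Matrix (V → S) (V → S) ℝ} (hK : Λ.IsKernel M)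
    (hM : Λ.IsReversible M) (hmon : Λ.PreservesMonotone M) {p r : V → S} (hp : p ∈ Λ.Ω)
    (hr : r ∈ Λ.Ω) (hp' : ∀ σ ∈ Λ.Ω, σ ≤ p) (hr' : ∀ σ ∈ Λ.Ω, r ≤ σ) {δ : ℝ}
    (hpδ : tvDist (M p) Λ.π ≤ δ) (hrδ : tvDist (M r) Λ.π ≤ δ) {σ : V → S} (hσ : σ ∈ Λ.Ω) :
    tvDist (M σ) Λ.π ≤ 2 * (Fintype.card V * Fintype.card S) * δ := by
  classical
  rw [tvDist_eq_of_isReversible hK hM hσ]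
  set g : (V → S) → ℝ := fun ω => if Λ.π σ ≤ M ω σ then 1 else 0 with hg
  have hg0 : ∀ ω, 0 ≤ g ω := fun ω => by simp only [hg]; split_ifs <;> norm_num
  have hg1 : ∀ ω, g ω ≤ 1 := fun ω => by simp only [hg]; split_ifs <;> norm_num
  set rank : S → ℕ := fun s => (Finset.univ.filter fun t => t < s).card with hrank
  have hrank_lt : ∀ {s t : S}, s < t → rank s < rank t := fun {s t} hst =>
    Finset.card_lt_card (Finset.ssubset_iff_subset_ne.2 ⟨fun x hx => by
      simp only [Finset.mem_filter, Finset.mem_univ, true_and] at hx ⊢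
      exact hx.trans hst, fun he => by
      have : s ∈ Finset.univ.filter fun x => x < t := by simpa using hst
      rw [← he] at this
      simp at this⟩)
  have hrank_mono : Monotone rank := fun s t hst =>
    hst.eq_or_lt.elim (fun h => h ▸ le_rfl) fun h => (hrank_lt h).le
  have hrank_card : ∀ s, rank s + 1 ≤ Fintype.card S := fun s =>
    Finset.card_lt_card (Finset.ssubset_univ_iff.2 fun he => by
      have := Finset.mem_univ s
      rw [← he] at this
      simp at this)
  -- `Q` rises by at least 1 along every strict inequality, so `g + Q` is increasing for any
  -- indicator `g`. Then `g = (g + Q) - Q` is bounded from the top start for the first term and the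
  -- bottom start for the second.
  set Q : (V → S) → ℝ := fun ω => ((∑ v, rank (ω v) : ℕ) : ℝ) with hQ
  have hQmono : Monotone Q := fun ω ω' h => Nat.cast_le.2
    (Finset.sum_le_sum fun v _ => hrank_mono (h v))
  have hQlt : ∀ {ω ω' : V → S}, ω < ω' → Q ω + 1 ≤ Q ω' := fun {ω ω'} h => by
    obtain ⟨hle, v, hv⟩ := Pi.lt_def.1 h
    have : ∑ v, rank (ω v) + 1 ≤ ∑ v, rank (ω' v) :=
      Finset.sum_lt_sum (fun v _ => hrank_mono (hle v)) ⟨v, Finset.mem_univ _, hrank_lt hv⟩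
    simp only [hQ]
    exact_mod_cast this
  -- The spare 1 leaves room for the indicator in the oscillation of `g + Q`.
  have hQcard : ∀ ω, Q ω + 1 ≤ Fintype.card V * Fintype.card S := fun ω => by
    have h1 : ∑ v, (rank (ω v) + 1) ≤ ∑ _v : V, Fintype.card S :=
      Finset.sum_le_sum fun v _ => hrank_card _
    rw [Finset.sum_add_distrib, Finset.sum_const, Finset.sum_const, Finset.card_univ, smul_eq_mul,
      smul_eq_mul, mul_one] at h1
    have h2 : 1 ≤ Fintype.card V := Fintype.card_pos
    simp only [hQ]
    exact_mod_cast (by omega : ∑ v, rank (ω v) + 1 ≤ Fintype.card V * Fintype.card S)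
  have hQ0 : ∀ ω, 0 ≤ Q ω := fun ω => Nat.cast_nonneg _
  have hgQ : Monotone (g + Q) := by
    intro ω ω' h
    rcases h.eq_or_lt with h | h
    · rw [h]
    · simp only [Pi.add_apply]
      linarith [hQlt h, hg1 ω, hg0 ω']
  have hrow : ∀ m ∈ Λ.Ω, ∑ x, M m x = ∑ x, Λ.π x := fun m hm => sum_row_eq hK hm
  have ha : (0 : ℝ) ≤ Fintype.card V * Fintype.card S := by positivity
  have h1 := sum_sub_sum_le_tvDist (A := Set.univ) (μ := M p) (ν := Λ.π) (g := g + Q)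
    (a := Fintype.card V * Fintype.card S) ⟨p, trivial⟩ (fun x hx => absurd trivial hx)
    (fun x hx => absurd trivial hx) (hrow p hp) fun x _ y _ => by
      simp only [Pi.add_apply]
      linarith [hQcard x, hg1 x, hg0 y, hQ0 y]
  have h2 := sum_sub_sum_le_tvDist (A := Set.univ) (μ := Λ.π) (ν := M r) (g := Q)
    (a := Fintype.card V * Fintype.card S) ⟨r, trivial⟩ (fun x hx => absurd trivial hx)
    (fun x hx => absurd trivial hx) (hrow r hr).symm fun x _ y _ => by
      linarith [hQcard x, hQ0 y]
  rw [tvDist_comm] at h2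
  have h3 := mul_le_mul_of_nonneg_right hpδ ha
  have h4 := mul_le_mul_of_nonneg_right hrδ ha
  have h5 : (M.mulVec (g + Q)) σ ≤ (M.mulVec (g + Q)) p :=
    hmon _ (hgQ.monotoneOn _) hσ hp (hp' σ hσ)
  have h6 : (M.mulVec Q) r ≤ (M.mulVec Q) σ := hmon _ (hQmono.monotoneOn _) hr hσ (hr' σ hσ)
  have h7 : ∑ x, M p x * (g + Q) x = (M.mulVec (g + Q)) p := rfl
  have h8 : ∑ x, M r x * Q x = (M.mulVec Q) r := rfl
  have h9 : ∑ x, Λ.π x * (g + Q) x = ∑ x, Λ.π x * g x + ∑ x, Λ.π x * Q x := by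
    simp only [Pi.add_apply, mul_add, Finset.sum_add_distrib]
  rw [Matrix.mulVec_add, Pi.add_apply] at h5
  rw [h7] at h1
  rw [h8] at h2
  rw [Matrix.mulVec_add] at h1
  linarith

end Decay

end SpinSystem

/-! ### From exponential decay to step counts -/

namespace SpinSystem

/-- The term 2 absorbs the rounding: log n ≥ log 2 ≥ 1/2, so 1 is at most twice the sum of
logarithms. -/
theorem exists_decay_steps {n δ κ : ℝ} (hn : 2 ≤ n) (hδ : 0 < δ) (hδ1 : δ < 1) (hκ : 0 < κ) :
    ∃ k : ℕ, Real.exp (-κ) ^ k * n ≤ δ ∧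
      (k : ℝ) ≤ (1 / κ + 2) * (Real.log n + Real.log (1 / δ)) := by
  have hn0 : 0 < n := by linarith
  set X := Real.log n + Real.log (1 / δ) with hX
  have h1 : 1 / 2 ≤ Real.log n :=
    (by linarith [Real.log_two_gt_d9] : (1 : ℝ) / 2 ≤ Real.log 2).trans
      (Real.log_le_log (by norm_num) hn)
  have h2 : 0 < Real.log (1 / δ) := Real.log_pos (by rwa [lt_div_iff₀ hδ, one_mul])
  refine ⟨⌈X / κ⌉₊, ?_, ?_⟩
  · have h3 : X ≤ ⌈X / κ⌉₊ * κ := (div_le_iff₀ hκ).1 (Nat.le_ceil _)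
    have h4 : Real.exp (-X) = δ / n := by
      rw [hX, neg_add, Real.exp_add, Real.exp_neg, Real.exp_log hn0, ← Real.log_inv,
        Real.exp_log (by positivity)]
      field_simp
    rw [← Real.exp_nat_mul, ← le_div_iff₀ hn0, ← h4]
    exact Real.exp_le_exp.2 (by linarith)
  · have h3 := (Nat.ceil_lt_add_one (show 0 ≤ X / κ by positivity)).le
    have h4 : (1 / κ + 2) * X = X / κ + 2 * X := by ring
    linarith

section

variable {V S : Type*} [Fintype V] [DecidableEq V] [Fintype S] [LinearOrder S]
  {Λ : SpinSystem V S}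

theorem mixingTime_extremes_le {K : ℕ} {κ C : ℝ} (hκ : 0 < κ) (hC : 3 * (K * (1 / κ + 2)) ≤ C)
    (hV : 2 ≤ Fintype.card V)
    (hdecay : ∀ m, Λ.IsExtreme m → ∀ k : ℕ,
      tvDist ((Λ.glauber Finset.univ ^ (K * Fintype.card V * k)) m) Λ.π ≤
        Real.exp (-κ) ^ k * Fintype.card V) {ε : ℝ} (hε : 0 < ε) (hε1 : ε < 1) :
    mixingTime (Λ.glauber Finset.univ) {ω | Λ.IsExtreme ω} Λ.π ε ≤
      (⌊C * (Fintype.card V : ℕ) * (Real.log (Fintype.card V : ℕ) + Real.log (1 / ε))⌋₊ : ℕ∞) := by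
  have hn : (2 : ℝ) ≤ Fintype.card V := by exact_mod_cast hV
  obtain ⟨k, hk, hk'⟩ := exists_decay_steps hn hε hε1 hκ
  refine (mixingTime_le (t := K * Fintype.card V * k) fun m hm => (hdecay m hm k).trans hk).trans ?_
  rw [Nat.cast_le]
  refine Nat.le_floor ?_
  have h1 : 0 ≤ Real.log (Fintype.card V) + Real.log (1 / ε) :=
    add_nonneg (Real.log_nonneg (by linarith))
      (Real.log_nonneg (by rw [le_div_iff₀ hε]; linarith))
  have h2 : 0 ≤ (K : ℝ) * (1 / κ + 2) := by positivity
  push_cast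
  calc (K : ℝ) * Fintype.card V * k ≤ K * Fintype.card V *
        ((1 / κ + 2) * (Real.log (Fintype.card V) + Real.log (1 / ε))) := by gcongr
    _ = K * (1 / κ + 2) * Fintype.card V *
        (Real.log (Fintype.card V) + Real.log (1 / ε)) := by ring
    _ ≤ _ := by
      gcongr
      linarith

theorem glauberMixingTime_le (hmon : Λ.IsMonotone) {p r : V → S} (hp : p ∈ Λ.Ω)
    (hr : r ∈ Λ.Ω) (hp' : ∀ σ ∈ Λ.Ω, σ ≤ p) (hr' : ∀ σ ∈ Λ.Ω, r ≤ σ)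
    {K : ℕ} {κ C : ℝ} (hκ : 0 < κ) (hC : 3 * (K * (1 / κ + 2)) ≤ C)
    (hV : 2 ≤ Fintype.card V)
    (hdecay : ∀ m, Λ.IsExtreme m → ∀ k : ℕ,
      tvDist ((Λ.glauber Finset.univ ^ (K * Fintype.card V * k)) m) Λ.π ≤
        Real.exp (-κ) ^ k * Fintype.card V) {ε : ℝ} (hε : 0 < ε) (hε1 : ε < 1) :
    Λ.glauberMixingTime ε ≤
      (⌊C * (Fintype.card V : ℕ) * (Real.log (Fintype.card V : ℕ) +
        Real.log (Fintype.card S) + Real.log (1 / ε))⌋₊ : ℕ∞) := by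
  have hn : (2 : ℝ) ≤ Fintype.card V := by exact_mod_cast hV
  have : Nonempty V := Fintype.card_pos_iff.1 (by omega)
  have : Nonempty S := ⟨p (Classical.arbitrary V)⟩
  have hS : (1 : ℝ) ≤ Fintype.card S := by exact_mod_cast Fintype.card_pos
  set n : ℝ := (Fintype.card V : ℝ) with hn_def
  -- The extreme starts must reach accuracy ε/w to offset the loss for general starts. The sum of
  -- logarithms becomes 2 log n + log 2 + log|S| + log(1/ε), at most 3Y; hence the 3 in `hC`.
  set w : ℝ := 2 * (n * Fintype.card S) with hw
  have hw1 : 1 ≤ w := by rw [hw]; nlinarith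
  have hδ : 0 < ε / w := by positivity
  have hδ1 : ε / w < 1 := by rw [div_lt_one (by linarith)]; linarith
  obtain ⟨k, hk, hk'⟩ := exists_decay_steps hn hδ hδ1 hκ
  have hmix : Λ.glauberMixingTime ε ≤ (K * Fintype.card V * k : ℕ) := by
    refine mixingTime_le fun σ hσ => ?_
    refine (tvDist_le_of_extremes ((Λ.isKernel_glauber Finset.univ_nonempty).pow _)
      ((Λ.isReversible_glauber _).pow _) ((preservesMonotone_glauber hmon _).pow _) hp hr hp' hr'
      ((hdecay p ⟨hp, Or.inl hp'⟩ k).trans hk) ((hdecay r ⟨hr, Or.inr hr'⟩ k).trans hk)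
      hσ).trans_eq ?_
    rw [← hn_def, ← hw]
    field_simp
  refine hmix.trans ?_
  rw [Nat.cast_le]
  refine Nat.le_floor ?_
  have h0 : Real.log 2 ≤ Real.log n := Real.log_le_log (by norm_num) hn
  have h1 : 0 ≤ Real.log n := Real.log_nonneg (by linarith)
  have h2 : 0 ≤ Real.log (1 / ε) := Real.log_nonneg (by rw [le_div_iff₀ hε]; linarith)
  have h3 : 0 ≤ Real.log (Fintype.card S) := Real.log_nonneg hS
  have h4 : Real.log (1 / (ε / w)) =
      Real.log 2 + Real.log n + Real.log (Fintype.card S) + Real.log (1 / ε) := by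
    have : 1 / (ε / w) = 2 * (n * Fintype.card S) * (1 / ε) := by rw [hw]; field_simp
    rw [this, Real.log_mul (by positivity) (by positivity), Real.log_mul (by norm_num)
      (by positivity), Real.log_mul (by positivity) (by positivity)]
    ring
  rw [h4] at hk'
  set Y := Real.log n + Real.log (Fintype.card S) + Real.log (1 / ε) with hY
  have h5 : (0 : ℝ) ≤ Y := by positivity
  have h6 : (k : ℝ) ≤ (1 / κ + 2) * (3 * Y) := by
    refine hk'.trans (mul_le_mul_of_nonneg_left ?_ (by positivity))
    linarith
  push_cast
  rw [← hn_def]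
  calc (K : ℝ) * n * k ≤ K * n * ((1 / κ + 2) * (3 * Y)) := by gcongr
    _ = 3 * (K * (1 / κ + 2)) * n * Y := by ring
    _ ≤ _ := by gcongr

theorem mixingTime_eq_zero_of_subsingleton (h : Λ.Ω.Subsingleton) {A : Set (V → S)}
    (hA : A ⊆ Λ.Ω) {ε : ℝ} (hε : 0 < ε) :
    mixingTime (Λ.glauber Finset.univ) A Λ.π ε ≤ 0 := by
  refine mixingTime_le (t := 0) fun σ hσ => ?_
  have h1 : ∀ τ, τ ≠ σ → Λ.π τ = 0 := fun τ hτ =>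
    Λ.zero τ fun hτ' => hτ (h hτ' (hA hσ))
  have h2 : Λ.π σ = 1 := by
    rw [← Λ.sum_eq_one, Finset.sum_eq_single σ (fun τ _ hτ => h1 τ hτ) (by simp)]
  have h3 : ∀ τ, (Λ.glauber Finset.univ ^ 0) σ τ = Λ.π τ := by
    intro τ
    rw [pow_zero]
    by_cases hτ : τ = σ
    · rw [hτ, Matrix.one_apply_eq, h2]
    · rw [Matrix.one_apply_ne (Ne.symm hτ), h1 τ hτ]
  rw [tvDist, Finset.sum_eq_zero fun τ _ => by rw [h3 τ, sub_self, abs_zero], mul_zero]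
  exact hε.le

end

end SpinSystem

/-! ### Geometry of cubes in the torus -/

section Torus

variable {d N : ℕ} [NeZero N]

theorem card_filter_val_sub_lt {ℓ : ℕ} (h : ℓ ≤ N) (c : ZMod N) :
    (Finset.univ.filter fun y : ZMod N => (y - c).val < ℓ).card = ℓ := by
  have h1 : (Finset.univ.filter fun y : ZMod N => (y - c).val < ℓ) =
      (Finset.range ℓ).image fun a : ℕ => c + (a : ZMod N) := by
    ext y
    simp only [Finset.mem_filter, Finset.mem_univ, true_and, Finset.mem_image, Finset.mem_range]
    constructor
    · intro hy
      exact ⟨_, hy, by rw [ZMod.natCast_zmod_val, add_sub_cancel]⟩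
    · rintro ⟨a, ha, rfl⟩
      rwa [add_sub_cancel_left, ZMod.val_natCast_of_lt (ha.trans_le h)]
  rw [h1, Finset.card_image_of_injOn, Finset.card_range]
  intro a ha a' ha' he
  rw [Finset.coe_range, Set.mem_Iio] at ha ha'
  have he' := congrArg ZMod.val (add_left_cancel he)
  rwa [ZMod.val_natCast_of_lt (ha.trans_le h), ZMod.val_natCast_of_lt (ha'.trans_le h)] at he'

theorem mem_torusCube {ℓ : ℕ} {x v : Fin d → ZMod N} :
    x ∈ torusCube ℓ v ↔ ∀ i, (x i - v i).val < ℓ := by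
  simp [torusCube]

theorem card_torusCube {ℓ : ℕ} (h : ℓ ≤ N) (v : Fin d → ZMod N) :
    (torusCube ℓ v).card = ℓ ^ d := by
  have h1 : torusCube ℓ v =
      Fintype.piFinset fun i => Finset.univ.filter fun y : ZMod N => (y - v i).val < ℓ := by
    ext x
    simp [mem_torusCube, Fintype.mem_piFinset]
  rw [h1, Fintype.card_piFinset]
  simp [card_filter_val_sub_lt h]

theorem torusCube_one (v : Fin d → ZMod N) : torusCube 1 v = {v} := by
  ext x
  rw [mem_torusCube, Finset.mem_singleton, funext_iff]
  refine forall_congr' fun i => ?_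
  rw [Nat.lt_one_iff, ZMod.val_eq_zero, sub_eq_zero]

theorem self_mem_torusCube {ℓ : ℕ} (h : 0 < ℓ) (v : Fin d → ZMod N) : v ∈ torusCube ℓ v := by
  rw [mem_torusCube]
  exact fun i => by simpa using h

theorem card_le_of_mem_torusCube {ℓ : ℕ} (h : ℓ ≤ N) (w : Fin d → ZMod N)
    {A : Finset (Fin d → ZMod N)} (hA : ∀ v ∈ A, w ∈ torusCube ℓ v) : A.card ≤ ℓ ^ d := by
  rw [← card_torusCube h w]
  -- Reflection in `w` sends the anchors of cubes containing `w` into the cube anchored at `w`.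
  refine Finset.card_le_card_of_injOn (fun v => w + w - v) (fun v hv => ?_) fun v _ v' _ he => ?_
  · have := mem_torusCube.1 (hA v hv)
    rw [Finset.mem_coe, mem_torusCube]
    intro i
    have he : (w + w - v) i - w i = w i - v i := by simp only [Pi.sub_apply, Pi.add_apply]; ring
    rw [he]
    exact this i
  · exact sub_right_injective he

/-- Adjacent sites differ by a unit vector. -/
theorem exists_of_torusGraph_adj {u v : Fin d → ZMod N} (h : (torusGraph d N).Adj u v) :
    ∃ i, v = u + Pi.single i 1 ∨ v = u - Pi.single i 1 := by
  rw [torusGraph, SimpleGraph.fromRel_adj] at h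
  rcases h.2 with ⟨i, hi⟩ | ⟨i, hi⟩
  · exact ⟨i, Or.inl hi⟩
  · exact ⟨i, Or.inr (by rw [hi, add_sub_cancel_right])⟩

open SpinSystem in
theorem card_le_of_near_torusCube {ℓ : ℕ} (h : ℓ ≤ N) (u : Fin d → ZMod N)
    (A : Finset (Fin d → ZMod N)) (hA : ∀ v ∈ A, u ∈ torusCube ℓ v ∨
      u ∈ exteriorBoundary (torusGraph d N) (torusCube ℓ v)) :
    A.card ≤ (2 * d + 1) * ℓ ^ d := by
  set nb : Finset (Fin d → ZMod N) := insert u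
    ((Finset.univ.image fun i : Fin d => u + Pi.single i 1) ∪
      Finset.univ.image fun i : Fin d => u - Pi.single i 1) with hnb
  have hcard : nb.card ≤ 2 * d + 1 := by
    refine (Finset.card_insert_le _ _).trans (Nat.succ_le_succ ((Finset.card_union_le _ _).trans ?_))
    have h1 := Finset.card_image_le (s := Finset.univ)
      (f := fun i : Fin d => u + (Pi.single i 1 : Fin d → ZMod N))
    have h2 := Finset.card_image_le (s := Finset.univ)
      (f := fun i : Fin d => u - (Pi.single i 1 : Fin d → ZMod N))
    rw [Finset.card_univ, Fintype.card_fin] at h1 h2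
    omega
  have hsub : A ⊆ nb.biUnion fun w => A.filter fun v => w ∈ torusCube ℓ v := by
    intro v hv
    rw [Finset.mem_biUnion]
    rcases hA v hv with hu | ⟨-, w, hw, hadj⟩
    · exact ⟨u, Finset.mem_insert_self _ _, Finset.mem_filter.2 ⟨hv, hu⟩⟩
    · refine ⟨w, Finset.mem_insert_of_mem ?_, Finset.mem_filter.2 ⟨hv, hw⟩⟩
      obtain ⟨i, hi | hi⟩ := exists_of_torusGraph_adj hadj.symm
      · exact Finset.mem_union_left _ (Finset.mem_image.2 ⟨i, Finset.mem_univ _, hi.symm⟩)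
      · exact Finset.mem_union_right _ (Finset.mem_image.2 ⟨i, Finset.mem_univ _, hi.symm⟩)
  refine (Finset.card_le_card hsub).trans ((Finset.card_biUnion_le_card_mul _ _ _ fun w _ =>
    card_le_of_mem_torusCube h w fun v hv => (Finset.mem_filter.1 hv).2).trans ?_)
  exact Nat.mul_le_mul_right _ hcard

/-- The sites all of whose coordinates are multiples of `k`. -/
def sublattice (d N k : ℕ) [NeZero N] : Finset (Fin d → ZMod N) :=
  Finset.univ.filter fun z => ∀ i, k ∣ (z i).val

theorem card_le_card_sublattice_mul {k : ℕ} (hk : 0 < k) :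
    Fintype.card (Fin d → ZMod N) ≤ (sublattice d N k).card * k ^ d := by
  have h1 : (Finset.univ : Finset (Fin d → ZMod N)) ⊆
      (sublattice d N k ×ˢ (Finset.univ : Finset (Fin d → Fin k))).image
        fun p i => p.1 i + ((p.2 i : ℕ) : ZMod N) := by
    intro v _
    rw [Finset.mem_image]
    refine ⟨(fun i => (((v i).val / k * k : ℕ) : ZMod N), fun i =>
      ⟨(v i).val % k, Nat.mod_lt _ hk⟩), ?_, ?_⟩
    · rw [Finset.mem_product, sublattice, Finset.mem_filter]
      refine ⟨⟨Finset.mem_univ _, fun i => ?_⟩, Finset.mem_univ _⟩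
      dsimp only
      rw [ZMod.val_natCast_of_lt ((Nat.div_mul_le_self _ _).trans_lt (ZMod.val_lt _))]
      exact dvd_mul_left _ _
    · ext i
      dsimp only
      rw [← Nat.cast_add, Nat.div_add_mod', ZMod.natCast_zmod_val]
  have h2 := (Finset.card_le_card h1).trans Finset.card_image_le
  rw [Finset.card_product] at h2
  simpa using h2

/-- Modulo `k`, which divides `N`, both anchors have the same residue, so `k` divides b - b' + e.
This integer has absolute value at most (ℓ-1) + 1 < k, hence is 0. Spacing ℓ+1 is exactly what
leaves a free site between cubes. -/
theorem eq_of_mem_sublattice_of_sub_eq {k ℓ : ℕ} (hk : k = ℓ + 1) (hN : k ∣ N)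
    {x z z' a a' : ZMod N} {e : ℤ} (hz : k ∣ z.val) (hz' : k ∣ z'.val)
    (ha : (a - (x + z)).val < ℓ) (ha' : (a' - (x + z')).val < ℓ) (he : |e| ≤ 1)
    (h : a' = a + (e : ZMod N)) : z = z' := by
  have hcast : ∀ y : ZMod N, k ∣ y.val → ZMod.castHom hN (ZMod k) y = 0 := by
    intro y hy
    rw [← ZMod.natCast_zmod_val y, map_natCast]
    exact (ZMod.natCast_eq_zero_iff _ _).2 hy
  set b := (a - (x + z)).val with hb
  set b' := (a' - (x + z')).val with hb'
  have h1 : a = x + z + (b : ZMod N) := by rw [hb, ZMod.natCast_zmod_val]; ring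
  have h2 : a' = x + z' + (b' : ZMod N) := by rw [hb', ZMod.natCast_zmod_val]; ring
  have h3 : z' = z + ((b - b' + e : ℤ) : ZMod N) := by
    push_cast
    linear_combination (-1 : ZMod N) * h2 + h + h1
  have h4 := congrArg (ZMod.castHom hN (ZMod k)) h3
  rw [map_add, hcast z hz, hcast z' hz', zero_add, map_intCast] at h4
  have h5 := (ZMod.intCast_zmod_eq_zero_iff_dvd _ _).1 h4.symm
  have h6 : (b - b' + e : ℤ) = 0 := by
    refine Int.eq_zero_of_abs_lt_dvd h5 ?_
    rw [abs_le] at he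
    rw [abs_lt]
    omega
  rw [h3, h6, Int.cast_zero, add_zero]

open SpinSystem in
theorem separated_torusCube {ℓ : ℕ} (hN : (ℓ + 1) ∣ N) (x : Fin d → ZMod N) :
    Separated (torusGraph d N) (torusCube ℓ)
      ((sublattice d N (ℓ + 1)).map (addLeftEmbedding x) : Finset (Fin d → ZMod N)) := by
  intro i hi j hj hij u hu v hv
  rw [Finset.mem_coe, Finset.mem_map] at hi hj
  obtain ⟨z, hz, rfl⟩ := hi
  obtain ⟨z', hz', rfl⟩ := hj
  have hz := (Finset.mem_filter.1 hz).2
  have hz' := (Finset.mem_filter.1 hz').2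
  have hu := mem_torusCube.1 hu
  have hv := mem_torusCube.1 hv
  have key : ∀ e : Fin d → ℤ, (∀ c, |e c| ≤ 1) → (∀ c, v c = u c + (e c : ZMod N)) → False := by
    intro e he h
    refine hij (congrArg _ (funext fun c => ?_))
    exact eq_of_mem_sublattice_of_sub_eq rfl hN (hz c) (hz' c) (hu c) (hv c) (he c) (h c)
  constructor
  · rintro rfl
    exact key 0 (by simp) (by simp)
  · intro hadj
    obtain ⟨i, rfl | rfl⟩ := exists_of_torusGraph_adj hadj
    · refine key (Pi.single i 1) (fun c => ?_) fun c => ?_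
      · rcases eq_or_ne c i with rfl | hc <;> simp [*]
      · rcases eq_or_ne c i with rfl | hc <;> simp [*]
    · refine key (-Pi.single i 1) (fun c => ?_) fun c => ?_
      · rcases eq_or_ne c i with rfl | hc <;> simp [*]
      · rcases eq_or_ne c i with rfl | hc <;> simp [*, sub_eq_add_neg]

end Torus

/-! ### Choice of the constants and the theorem -/

theorem exists_nat_mul_exp_neg_le {D b T γ : ℝ} (hb : 0 < b) (hT : 0 < T) (hγ : 0 < γ) :
    ∃ K : ℕ, 8 * D * Real.exp (-(b * K / (2 * T))) ≤ γ := by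
  have h : Filter.Tendsto (fun K : ℕ => 8 * D * Real.exp (-(b * K / (2 * T)))) Filter.atTop
      (nhds (8 * D * 0)) := by
    refine Filter.Tendsto.const_mul _ (Real.tendsto_exp_neg_atTop_nhds_zero.comp ?_)
    have h1 : (fun K : ℕ => b * (K : ℝ) / (2 * T)) = fun K : ℕ => (b / (2 * T)) * (K : ℝ) := by
      ext K; ring
    rw [h1]
    exact Filter.Tendsto.const_mul_atTop (by positivity) tendsto_natCast_atTop_atTop
  rw [mul_zero] at h
  exact (h.eventually (ge_mem_nhds hγ)).exists

theorem theorem1p2 (ℓ : ℕ) (hℓ : 0 < ℓ) (γ : ℝ) (hγ : 0 < γ) (T : ℕ) :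
    ∃ C : ℝ, 0 < C ∧
      ∀ (d N : ℕ) [NeZero N], 0 < d → (ℓ + 1) ∣ N →
      ∀ (S : Type*) [Fintype S] [LinearOrder S] (Λ : SpinSystem (Fin d → ZMod N) S),
        Λ.IsMonotone →
        Λ.IsMarkovRandomField (torusGraph d N) →
        Λ.IsContracting (torusCube (d := d) (N := N) ℓ) (ℓ ^ d) γ →
        (∀ v : Fin d → ZMod N, ∀ σ ∈ Λ.Ω,
          Λ.blockMixingTime (torusCube ℓ v) σ (1 / 4) ≤ (T : ℕ∞)) →
        ∀ ε : ℝ, 0 < ε → ε < 1 →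
          -- started from the top or from the bottom configuration
          mixingTime (Λ.glauber Finset.univ)
              {ω | ω ∈ Λ.Ω ∧ ((∀ σ ∈ Λ.Ω, σ ≤ ω) ∨ (∀ σ ∈ Λ.Ω, ω ≤ σ))} Λ.π ε ≤
            (⌊C * (N ^ d : ℕ) * (Real.log (N ^ d : ℕ) + Real.log (1 / ε))⌋₊ : ℕ∞) ∧
          -- started from an arbitrary configuration
          Λ.glauberMixingTime ε ≤
            (⌊C * (N ^ d : ℕ) * (Real.log (N ^ d : ℕ) + Real.log (Fintype.card S)
              + Real.log (1 / ε))⌋₊ : ℕ∞) := by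
  classical
  have hK : ∀ d : ℕ, ∃ K : ℕ, 0 < T → 8 * (((2 * d + 1) * ℓ ^ d : ℕ) : ℝ) *
      Real.exp (-(((ℓ ^ d : ℕ) : ℝ) * K / (2 * T))) ≤ γ := by
    intro d
    by_cases hT : 0 < T
    · obtain ⟨K, hK⟩ := exists_nat_mul_exp_neg_le (D := (((2 * d + 1) * ℓ ^ d : ℕ) : ℝ))
        (b := ((ℓ ^ d : ℕ) : ℝ)) (T := T) (by exact_mod_cast pow_pos hℓ d)
        (by exact_mod_cast hT) hγ
      exact ⟨K, fun _ => hK⟩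
    -- For `T = 0` the value is never used: every block is then frozen.
    · exact ⟨0, fun h => absurd h hT⟩
  choose K hK using hK
  set κ : ℕ → ℝ := fun d => γ * ((ℓ ^ d : ℕ) : ℝ) / (2 * ((ℓ + 1) ^ d : ℕ)) with hκ
  have hκ0 : ∀ d, 0 < κ d := fun d => by
    have h1 : (0 : ℝ) < (ℓ ^ d : ℕ) := by exact_mod_cast pow_pos hℓ d
    have h2 : (0 : ℝ) < ((ℓ + 1) ^ d : ℕ) := by exact_mod_cast pow_pos ℓ.succ_pos d
    simp only [hκ]
    positivity
  have hterm : ∀ d, 0 ≤ 3 * ((K d : ℝ) * (1 / κ d + 2)) := fun d => by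
    have := hκ0 d
    positivity
  -- The first term serves ℓ = 1 in every dimension; the sum serves ℓ ≥ 2, where d < 2^d ≤ ℓ^d ≤ 4T
  -- unless the blocks are frozen.
  set C : ℝ := 3 * ((1 : ℕ) * (1 / γ + 2)) +
    ∑ d ∈ Finset.range (4 * T), 3 * (K d * (1 / κ d + 2)) with hC
  have hsum : 0 ≤ ∑ d ∈ Finset.range (4 * T), 3 * ((K d : ℝ) * (1 / κ d + 2)) :=
    Finset.sum_nonneg fun d _ => hterm d
  refine ⟨C, by positivity, ?_⟩
  intro d N _ hd hN S _ _ Λ hmon hmrf hcon hmix ε hε hε1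
  have hℓN : ℓ + 1 ≤ N := Nat.le_of_dvd (NeZero.pos N) hN
  have hcard : Fintype.card (Fin d → ZMod N) = N ^ d := by simp [ZMod.card]
  have hV : 2 ≤ Fintype.card (Fin d → ZMod N) := by
    rw [hcard]
    calc 2 ≤ N := by omega
      _ ≤ N ^ d := Nat.le_self_pow hd.ne' N
  have hb : ∀ v : Fin d → ZMod N, (torusCube ℓ v).card = ℓ ^ d :=
    fun v => card_torusCube (by omega) v
  have hb0 : 0 < ℓ ^ d := pow_pos hℓ d
  have hne : ∀ v : Fin d → ZMod N, (torusCube ℓ v).Nonempty :=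
    fun v => ⟨v, self_mem_torusCube hℓ v⟩
  by_cases hfrozen : 4 * T < ℓ ^ d
  · have hsub := SpinSystem.subsingleton_of_card_lt (fun v => ⟨v, self_mem_torusCube hℓ v⟩)
      (fun v => (hb v).symm ▸ hfrozen) hγ hb0 hcon hmix
    exact ⟨(SpinSystem.mixingTime_eq_zero_of_subsingleton hsub (fun ω hω => hω.1) hε).trans
      zero_le, (SpinSystem.mixingTime_eq_zero_of_subsingleton hsub le_rfl hε).trans
      zero_le⟩
  have hT0 : 0 < T := by omega
  have hdecay : ∃ (K' : ℕ) (κ' : ℝ), 0 < κ' ∧ 3 * (K' * (1 / κ' + 2)) ≤ C ∧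
      ∀ m, Λ.IsExtreme m → ∀ k : ℕ,
        tvDist ((Λ.glauber Finset.univ ^ (K' * Fintype.card (Fin d → ZMod N) * k)) m) Λ.π ≤
          Real.exp (-κ') ^ k * Fintype.card (Fin d → ZMod N) := by
    rcases Nat.eq_or_lt_of_le (Nat.succ_le_of_lt hℓ) with h1 | h1
    · obtain rfl : ℓ = 1 := h1.symm
      have hcon' : Λ.IsContracting (fun v : Fin d → ZMod N => {v}) 1 γ := by
        rw [one_pow] at hcon
        convert hcon using 2 with v
        exact (torusCube_one v).symm
      exact ⟨1, γ, hγ, by rw [hC]; linarith, fun m hm k =>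
        SpinSystem.tvDist_glauber_pow_le_of_singleton hmon hcon' hm k⟩
    · have hd4 : d ∈ Finset.range (4 * T) := by
        rw [Finset.mem_range]
        calc d < 2 ^ d := Nat.lt_two_pow_self
          _ ≤ ℓ ^ d := Nat.pow_le_pow_left h1 d
          _ ≤ 4 * T := not_lt.1 hfrozen
      refine ⟨K d, κ d, hκ0 d, ?_, fun m hm k =>
        SpinSystem.tvDist_glauber_pow_le hmon hmrf (fun x => separated_torusCube hN x) hb hb0 hγ
          hcon hT0 hmix (fun u A hA => card_le_of_near_torusCube (by omega) u A hA)
          (pow_pos ℓ.succ_pos d) (card_le_card_sublattice_mul ℓ.succ_pos) (hK d hT0) hm k⟩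
      have h2 := Finset.single_le_sum (f := fun d => 3 * ((K d : ℝ) * (1 / κ d + 2)))
        (fun d _ => hterm d) hd4
      have h3 : 0 ≤ 3 * (((1 : ℕ) : ℝ) * (1 / γ + 2)) := by positivity
      rw [hC]
      linarith
  obtain ⟨K', κ', hκ', hC', hdecay⟩ := hdecay
  obtain ⟨p, hp, hp'⟩ := SpinSystem.exists_top hmon hne hγ hb0 hcon hmix
  obtain ⟨r, hr, hr'⟩ := SpinSystem.exists_bot hmon hne hγ hb0 hcon hmix
  rw [← hcard]
  exact ⟨SpinSystem.mixingTime_extremes_le hκ' hC' hV hdecay hε hε1,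
    SpinSystem.glauberMixingTime_le hmon hp hr hp' hr' hκ' hC' hV hdecay hε hε1⟩
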